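/- **Setting.** Let $d\ge 1$, $N\ge 1$ be integers, let $r>0$, $\lambda\ge 0$, $\delta>0$ be real, and put $\Lambda=\{-N,\dots,N\}^d\subseteq\mathbb Z^d$, $I=[-r/2,r/2]$, $K=\Lambda\times I$. Let $\mathcal E_N$ be the set of unordered pairs $xy$ of points $x,y\in\Lambda$ with $\|x-y\|_1=1$. Let $\mathbb E$ be a probability measure governing the following independent random variables: for each $xy\in\mathcal E_N$, Poisson processes $B_{xy}$ and $\hat B_{xy}$ on $I$ of intensity $\lambda$ (whose points are called bridges); for each $x\in\Lambda$, fair $\{0,1\}$-valued coins $\tau_x$ and $\hat\tau_x$; for each $x\in\Lambda$, a Poisson process $G_x$ on $I$ of intensity $\lambda\cdot\#\{y\in\mathbb Z^d\setminus\Lambda:\|x-y\|_1=1\}$; for each $x\in\Lambda$, a Poisson process $\Delta_x$ on $I$ of intensity $4\delta$ (the cuts). **Labellings.** For a finite set $A\subseteq\Lambda\times(-r/2,r/2)$ of sources let $S_x$ be the set of all $t$ such that $(x,t)\in A$ or $t\in B_{xy}$ for some $y$; and let $\hat S_x$ be the set of all $t$ such that $(x,t)\in A$, or $t\in\hat B_{xy}$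 for some $y$, or $t\in G_x$. Call $S$ (respectively $\hat S$) consistent if $|S_x|$ (respectively $|\hat S_x|$) is even for every $x\in\Lambda$. For $\mathfrak t\in\{\mathfrak f,\mathfrak w,\mathfrak p\}$ (free, wired, periodic) and consistent $S$, the labelling $\psi_A^{\mathfrak t}$ of $K$ by the labels `even' and `odd' is defined by requiring that on each line $\{x\}\times I$ the label switches exactly at the points of $S_x$, where the label is: `even' at the endpoints $(x,\pm r/2)$ if $\mathfrak t=\mathfrak f$; `odd' at these endpoints if $\mathfrak t=\mathfrak w$; and, if $\mathfrak t=\mathfrak p$, `odd' at $(x,0)$ precisely when $\tau_x=1$ (if $0\in S_x$ this is the label immediately after time $0$). The odd set is taken to be closed, so that switching points are odd. The labelling $\hat\psi_A^{\mathfrak t}$ is defined in the same way from $\hat S$ and $\hat\tau$. The weight $\partial\psi_A^{\mathfrak t}$ (respectively $\partial\hat\psi_A^{\mathfrak t}$) is $e^{2\delta\epsilon}$, where $\epsilon$ is the total length of the part of $K$ labelled `even', and it is $0$ if $S$ (respectively $\hat S$) is not consistent. **Paths.** Let $(\mathfrak t_1,\mathfrak t_2)$ be either $(\mathfrak p,\mathfrak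 p)$ (used for $\beta<\infty$, with $r=\beta$) or $(\mathfrak f,\mathfrak w)$ (used for $\beta=\infty$). In the first case put $\hat G_x=G_x$; in the second put $\hat G_x=G_x\cup\{-r/2,r/2\}$. Given $\psi_{A_1}^{\mathfrak t_1}$, $\hat\psi_{A_2}^{\mathfrak t_2}$ and $\Delta$, an open path from $\kappa$ to $\kappa'$ is a sequence $\kappa=\kappa_0,\kappa_1,\dots,\kappa_{2m+1}=\kappa'$ in $K$ such that 1. for $0\le j\le m$, the points $\kappa_{2j}=(x,s)$ and $\kappa_{2j+1}=(x,t)$ lie on the same line and $[s\wedge t,s\vee t]$ contains no point of $\Delta_x$ that is labelled `even' in both labellings; in the case $(\mathfrak p,\mathfrak p)$, $\{x\}\times I$ is regarded as a circle (the endpoints $\pm r/2$ being identified) and it suffices that one of the two arcs between $s$ and $t$ contains no such point; 2. for $0\le j<m$, the points $\kappa_{2j+1}=(x,s)$ and $\kappa_{2j+2}=(y,t)$ satisfy either $s=t\in B_{xy}\cup\hat B_{xy}$, or $s\in\hat G_x$ and $t\in\hat G_y$ (a jump via the ghost site $\Gamma$). Let $\{\kappa\leftrightarrow\kappa'\text{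 off }\Gamma\}$ be the event that there is an open path from $\kappa$ to $\kappa'$ no jump of which is a jump via $\Gamma$ (that is, there is no $j$ with $\kappa_{2j+1}=(x,s)$, $\kappa_{2j+2}=(y,t)$, $s\in\hat G_x$, $t\in\hat G_y$; here $x=y$ is not excepted). **Lemma (switching lemma).** Write $0$ for the point $(0,0)\in K$, and let $\kappa\in\Lambda\times(-r/2,r/2)$, $\kappa\ne 0$. Then, for each of the two pairs $(\mathfrak t_1,\mathfrak t_2)$ above, the random variables below are integrable and $$\mathbb E\big(\partial\psi_{\{0,\kappa\}}^{\mathfrak t_1}\,\partial\hat\psi_{\varnothing}^{\mathfrak t_2}\big)=\mathbb E\big(\partial\psi_{\varnothing}^{\mathfrak t_1}\,\partial\hat\psi_{\{0,\kappa\}}^{\mathfrak t_2}\,\mathbf 1\{0\leftrightarrow\kappa\text{ off }\Gamma\}\big),$$ where on the right-hand side the event is taken with respect to the labellings $\psi_{\varnothing}^{\mathfrak t_1}$ and $\hat\psi_{\{0,\kappa\}}^{\mathfrak t_2}$. -/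

import Mathlib

open MeasureTheory ProbabilityTheory Set

namespace RandomParity

noncomputable section

/-! ### The box -/

/-- The box `Λ_N = {-N, …, N}^d` in `ℤ^d`. -/
def box (d N : ℕ) : Finset (Fin d → ℤ) :=
  Finset.Icc (fun _ => -(N : ℤ)) (fun _ => (N : ℤ))

/-- The sites of the box, as a type. -/
abbrev Site (d N : ℕ) : Type := {x : Fin d → ℤ // x ∈ box d N}

/-- The nearest-neighbour graph of `ℤ^d`: `x` and `y` are adjacent when `‖x - y‖₁ = 1`. -/
def lattice (d : ℕ) : SimpleGraph (Fin d → ℤ) where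
  Adj x y := ∑ i, |x i - y i| = 1
  symm := ⟨fun x y h => by simpa only [abs_sub_comm] using h⟩
  loopless := ⟨fun x h => by simp at h⟩

/-- The nearest-neighbour graph of the box. -/
def boxGraph (d N : ℕ) : SimpleGraph (Site d N) :=
  (lattice d).comap Subtype.val

/-- Unordered pairs of nearest neighbours in the box. -/
abbrev Bond (d N : ℕ) : Type := {e : Sym2 (Site d N) // e ∈ (boxGraph d N).edgeSet}

instance (d N : ℕ) : Fintype (Bond d N) := Fintype.ofFinite _

/-- The origin of `ℤ^d`, as a site of the box. -/
def origin (d N : ℕ) : Site d N :=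
  ⟨0, by simp [box, Pi.le_def]⟩

/-- The number of lattice neighbours of `x` outside the box. It is zero unless `x` lies on the
boundary of the box. -/
def outerDegree {d N : ℕ} (x : Site d N) : ℕ :=
  {y : Fin d → ℤ | y ∉ box d N ∧ (lattice d).Adj x.1 y}.ncard

/-- The time interval `I_r = [-r/2, r/2]`. -/
def timeInterval (r : ℝ) : Set ℝ := Icc (-(r / 2)) (r / 2)

/-! ### Poisson processes -/

/-- A finite configuration of points of `ℝ`, listed in some order. -/
abbrev PointConfig : Type := Σ n : ℕ, (Fin n → ℝ)

/-- The set of points of a configuration. -/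
def PointConfig.points (c : PointConfig) : Set ℝ := Set.range c.2

/-- The law of a Poisson process on `I_r` of constant intensity `ρ`: the number of points has the
Poisson distribution of mean `ρ r` and, given that there are `n` points, these are independent
and uniformly distributed on `I_r`. -/
def poissonProcess (ρ r : ℝ) : Measure PointConfig :=
  Measure.sum fun n : ℕ =>
    poissonMeasure (Real.toNNReal (ρ * r)) {n} •
      (Measure.pi fun _ : Fin n => volume[|timeInterval r]).map (Sigma.mk n)

/-- The law of a fair coin. -/
def fairCoin : Measure Bool := (PMF.uniformOfFintype Bool).toMeasure

/-! ### The probability measures `E`, `Ê`, `P_Δ` and their product -/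

/-- Samples under `E`: the bridges `B` and the coins `τ`. -/
abbrev FreeSample (d N : ℕ) : Type := (Bond d N → PointConfig) × (Site d N → Bool)

/-- Samples under `Ê`: the bridges, the coins and the ghost process `G`. -/
abbrev WiredSample (d N : ℕ) : Type := FreeSample d N × (Site d N → PointConfig)

/-- Samples under the product measure: a sample of `E`, a sample of `Ê`, and the cuts `Δ`. -/
abbrev Sample (d N : ℕ) : Type := FreeSample d N × WiredSample d N × (Site d N → PointConfig)

/-- `E_{N,r}`: bridges of intensity `lam` on each bond, and a fair coin at each site. -/
def freeLaw (d N : ℕ) (r lam : ℝ) : Measure (FreeSample d N) :=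
  (Measure.pi fun _ : Bond d N => poissonProcess lam r).prod
    (Measure.pi fun _ : Site d N => fairCoin)

/-- `Ê_{N,r}`: in addition, independent ghost processes `G_x`, of intensity `lam` times the number
of neighbours of `x` outside the box. -/
def wiredLaw (d N : ℕ) (r lam : ℝ) : Measure (WiredSample d N) :=
  (freeLaw d N r lam).prod
    (Measure.pi fun x : Site d N => poissonProcess (lam * outerDegree x) r)

/-- `P_Δ`: independent cut processes of intensity `4 δ`. -/
def cutLaw (d N : ℕ) (r δ : ℝ) : Measure (Site d N → PointConfig) :=
  Measure.pi fun _ : Site d N => poissonProcess (4 * δ) r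

/-- `𝔼_{N,r} = E_{N,r} × Ê_{N,r} × P_Δ`. -/
def jointLaw (d N : ℕ) (r lam δ : ℝ) : Measure (Sample d N) :=
  (freeLaw d N r lam).prod ((wiredLaw d N r lam).prod (cutLaw d N r δ))

/-! ### Labellings and their weights -/

/-- Temporal boundary conditions. -/
inductive TimeBC
  | free
  | wired
  | periodic

/-- The space-time points: `(x, t)` with `x` in the box and `t` a time. -/
abbrev SpaceTime (d N : ℕ) : Type := Site d N × ℝ

/-- The switching points on the line of `x`: the sources, the endpoints of bridges, and the
points of the ghost process `G` (taken to be empty in the spatially free case). -/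
def switchingPoints {d N : ℕ} (A : Set (SpaceTime d N)) (B : Bond d N → PointConfig)
    (G : Site d N → Set ℝ) (x : Site d N) : Set ℝ :=
  {t | (x, t) ∈ A} ∪ {t | ∃ e : Bond d N, x ∈ e.1 ∧ t ∈ (B e).points} ∪ G x

/-- `S` is consistent if the number of switching points on each line is even. -/
def Consistent {d N : ℕ} (S : Site d N → Set ℝ) : Prop :=
  ∀ x, Even (S x).ncard

/-- The point `(x, u)` is labelled `odd`. The label is `even` (resp. `odd`) at the endpoints of
each line for the free (resp. wired) condition, and is given by `τ` at time `0` for the periodic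
one; it switches at the points of `S`. The `odd` set is closed, so the switching points
themselves are `odd` (if `0` is a switching point, `τ` gives the label just after time `0`). -/
def IsOdd {d N : ℕ} (b : TimeBC) (r : ℝ) (τ : Site d N → Bool) (S : Site d N → Set ℝ)
    (x : Site d N) (u : ℝ) : Prop :=
  u ∈ S x ∨
    match b with
    | .free => Odd (S x ∩ Ioc (-(r / 2)) u).ncard
    | .wired => Odd (1 + (S x ∩ Ioc (-(r / 2)) u).ncard)
    | .periodic => Odd ((τ x).toNat + (S x ∩ uIoc 0 u).ncard)

/-- The total length of the part of the space-time region that is labelled `even`. -/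
def evenLength {d N : ℕ} (b : TimeBC) (r : ℝ) (τ : Site d N → Bool) (S : Site d N → Set ℝ) : ℝ :=
  ∑ x : Site d N, volume.real {u ∈ timeInterval r | ¬ IsOdd b r τ S x u}

open Classical in
/-- The weight of a labelling: `exp (2 δ ε)`, with `ε` the total length of the `even` part, and
zero if `S` is not consistent. -/
def weight {d N : ℕ} (b : TimeBC) (r δ : ℝ) (τ : Site d N → Bool) (S : Site d N → Set ℝ) : ℝ :=
  if Consistent S then Real.exp (2 * δ * evenLength b r τ S) else 0

namespace Sample

variable {d N : ℕ} (ω : Sample d N)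

/-- The bridges of the first copy. -/
def B : Bond d N → PointConfig := ω.1.1
/-- The coins of the first copy. -/
def τ : Site d N → Bool := ω.1.2
/-- The bridges of the second copy. -/
def Bhat : Bond d N → PointConfig := ω.2.1.1.1
/-- The coins of the second copy. -/
def τhat : Site d N → Bool := ω.2.1.1.2
/-- The ghost process. -/
def G (x : Site d N) : Set ℝ := (ω.2.1.2 x).points
/-- The cuts. -/
def cuts (x : Site d N) : Set ℝ := (ω.2.2 x).points

/-- The switching points of `ψ_A`. -/
def S (A : Set (SpaceTime d N)) : Site d N → Set ℝ := switchingPoints A ω.B fun _ => ∅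

/-- The switching points of `ψ̂_A`. -/
def Shat (A : Set (SpaceTime d N)) : Site d N → Set ℝ := switchingPoints A ω.Bhat ω.G

/-- The weight `∂ψ_A^b`. -/
def psiWeight (b : TimeBC) (r δ : ℝ) (A : Set (SpaceTime d N)) : ℝ :=
  weight b r δ ω.τ (ω.S A)

/-- The weight `∂ψ̂_A^b`. -/
def psiHatWeight (b : TimeBC) (r δ : ℝ) (A : Set (SpaceTime d N)) : ℝ :=
  weight b r δ ω.τhat (ω.Shat A)

end Sample

/-! ### Open paths -/

/-- The two combinations of temporal boundary conditions: `(periodic, periodic)` for `β < ∞`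
and `(free, wired)` for `β = ∞`. -/
inductive Regime
  | positiveTemperature
  | groundState

/-- The temporal boundary condition of `ψ`. -/
def Regime.bc₁ : Regime → TimeBC
  | .positiveTemperature => .periodic
  | .groundState => .free

/-- The temporal boundary condition of `ψ̂`. -/
def Regime.bc₂ : Regime → TimeBC
  | .positiveTemperature => .periodic
  | .groundState => .wired

section Paths

variable {d N : ℕ} (R : Regime) (r : ℝ) (A₁ A₂ : Set (SpaceTime d N)) (ω : Sample d N)

/-- The cuts on the line of `x` that block paths: those labelled `even` in both labellings
`ψ_{A₁}` and `ψ̂_{A₂}`. -/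
def blockingCuts (x : Site d N) : Set ℝ :=
  {u ∈ ω.cuts x | ¬ IsOdd R.bc₁ r ω.τ (ω.S A₁) x u ∧ ¬ IsOdd R.bc₂ r ω.τhat (ω.Shat A₂) x u}

/-- The times at which the line of `x` is connected to the ghost site: `G_x` for `β < ∞`, and
`Ĝ_x = G_x ∪ {-r/2, r/2}` for `β = ∞`. -/
def ghostTimes (x : Site d N) : Set ℝ :=
  match R with
  | .positiveTemperature => ω.G x
  | .groundState => ω.G x ∪ {-(r / 2), r / 2}

/-- One may move along a line from `p` to `q`: the interval between the two times contains no
blocking cut; or, when the line is a circle, one of the two arcs between them contains none. -/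
def Traverse (p q : SpaceTime d N) : Prop :=
  p.1 = q.1 ∧
    match R with
    | .groundState => Disjoint (uIcc p.2 q.2) (blockingCuts R r A₁ A₂ ω p.1)
    | .positiveTemperature =>
        Disjoint (uIcc p.2 q.2) (blockingCuts R r A₁ A₂ ω p.1) ∨
        Disjoint (Icc (-(r / 2)) (min p.2 q.2) ∪ Icc (max p.2 q.2) (r / 2))
          (blockingCuts R r A₁ A₂ ω p.1)

/-- `p` and `q` are the two endpoints of a bridge of `B` or `B̂`. -/
def BridgeJump (p q : SpaceTime d N) : Prop :=
  p.2 = q.2 ∧ ∃ e : Bond d N, e.1 = s(p.1, q.1) ∧ p.2 ∈ (ω.B e).points ∪ (ω.Bhat e).points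

/-- `p` and `q` are both connected to the ghost site. -/
def GhostJump (p q : SpaceTime d N) : Prop :=
  p.2 ∈ ghostTimes R r ω p.1 ∧ q.2 ∈ ghostTimes R r ω q.1

/-- The sequence `k 0, k 1, …, k (2 m + 1)` is an open path from `p` to `q`. -/
structure IsOpenPath (p q : SpaceTime d N) (m : ℕ) (k : ℕ → SpaceTime d N) : Prop where
  mem : ∀ i ≤ 2 * m + 1, (k i).2 ∈ timeInterval r
  first : k 0 = p
  last : k (2 * m + 1) = q
  traverse : ∀ j ≤ m, Traverse R r A₁ A₂ ω (k (2 * j)) (k (2 * j + 1))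
  jump : ∀ j < m, BridgeJump ω (k (2 * j + 1)) (k (2 * j + 2)) ∨
    GhostJump R r ω (k (2 * j + 1)) (k (2 * j + 2))

/-- The event `p ↔ q off Γ`: there is an open path from `p` to `q` none of whose jumps is made via
the ghost site. -/
def ConnectedOffGhost (p q : SpaceTime d N) : Prop :=
  ∃ (m : ℕ) (k : ℕ → SpaceTime d N), IsOpenPath R r A₁ A₂ ω p q m k ∧
    ∀ j < m, ¬ GhostJump R r ω (k (2 * j + 1)) (k (2 * j + 2))

end Paths

end

end RandomParity

open RandomParity

namespace RandomParity

noncomputable section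

open scoped ENNReal NNReal Nat

/-! ### Poisson processes on a finite interval: configurations, superposition, thinning. -/

/-! ### Measurability on the space of point configurations -/

/-! Let `EE` be the part of `K` that is even in both labellings. The two even lengths add up to
`2|EE|` plus the length on which the labellings differ, so the product of the weights is
`exp(4δ|EE|)` times a reduced weight that only sees where the labels differ. The cut intensity `4δ`
is tuned to the first factor: the cuts lying in `EE` have the law of the cut process restricted to
the event that all cuts lie in `EE`, multiplied by `exp(4δ|K \ EE|)`
(`poissonProcess_filter_apply`). The two exponentials combine into the constant `exp(4δ|K|)`. Thus
(`lintegral_sampleWeight_mul`) both sides become the same constant times an integral of the reduced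
weight over samples all of whose cuts are even in both copies. There every cut blocks, so the
connection event depends only on the positions of bridges and cuts, not on the labels.

The bridges of the two copies are next realised as one process of intensity `2λ` whose points carry
fair marks telling to which copy they belong (`poissonProcess_prod_self`). Given all positions, a
path from `p` to `q` that meets no cut prescribes a flip: toggle the marks of the bridges it crosses
and, on circles, suitable coins in both copies. This moves the sources from the first copy to the
second and adds to both labellings the same function, which vanishes at the cuts
(`Linked.of_reach`). The set where the labels differ, the consistency of both copies and the
evenness of the cuts are therefore kept, and so is the law of marks and coins
(`measurePreserving_flip`). This gives `lintegral_evenCutWeight_swap`.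

The left side carries no connection event, but there it comes for free (`reach_of_sources`). When
all cuts are even in the first copy, the odd segments contain none. Let `f` be the indicator of the
points reachable from `p`. It takes equal values at the two ends of an odd segment and at the two
ends of a bridge, so summing it modulo 2 over all switching points gives `f p + f q = 0`.

Almost surely all random points are distinct, are interior and avoid the source times. On such
samples set cardinalities become additive sums in `ZMod 2`, and open paths off `Γ` are exactly paths
through bridges. -/

/-- The configuration of the points listed by a vector. -/
def ofVec (n : ℕ) (u : Fin n → ℝ) : PointConfig := ⟨n, u⟩

lemma ofVec_injective (n : ℕ) : Function.Injective (ofVec n) := fun _ _ h =>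
  sigma_mk_injective (β := fun n => Fin n → ℝ) h

lemma measurable_ofVec (n : ℕ) : Measurable (ofVec n) :=
  Measurable.of_le_map (iInf_le _ n)

lemma measurableSet_pointConfig_iff {s : Set PointConfig} :
    MeasurableSet s ↔ ∀ n, MeasurableSet ((ofVec n) ⁻¹' s) := by
  change MeasurableSet[⨅ a, _] s ↔ _
  rw [MeasurableSpace.measurableSet_iInf]
  rfl

lemma measurableEmbedding_ofVec (n : ℕ) :
    MeasurableEmbedding (ofVec n) where
  injective := ofVec_injective n
  measurable := measurable_ofVec n
  measurableSet_image' := by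
    intro s hs
    rw [measurableSet_pointConfig_iff]
    intro m
    by_cases h : m = n
    · subst h
      rwa [preimage_image_eq _ (ofVec_injective m)]
    · convert! MeasurableSet.empty
      ext u
      simp only [mem_preimage, mem_image, mem_empty_iff_false, iff_false, not_exists, not_and]
      rintro v - hv
      exact h (congrArg Sigma.fst hv).symm

lemma measurable_pointConfig {γ : Type*} [MeasurableSpace γ] {f : PointConfig → γ}
    (hf : ∀ n, Measurable fun u : Fin n → ℝ => f ⟨n, u⟩) : Measurable f := fun _ hs =>
  measurableSet_pointConfig_iff.2 fun n => hf n hs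

/-- The number of points of a configuration. -/
def PointConfig.size (c : PointConfig) : ℕ := c.1

/-- The `i`-th point of a configuration, and `0` if there is none. -/
def PointConfig.pt (c : PointConfig) (i : ℕ) : ℝ := if h : i < c.1 then c.2 ⟨i, h⟩ else 0

lemma PointConfig.pt_val (c : PointConfig) (i : Fin c.1) : c.pt i = c.2 i := by
  simp [PointConfig.pt]

lemma PointConfig.mem_points_iff (c : PointConfig) (t : ℝ) :
    t ∈ c.points ↔ ∃ i < c.size, c.pt i = t := by
  constructor
  · rintro ⟨i, rfl⟩
    exact ⟨i, i.2, c.pt_val i⟩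
  · rintro ⟨i, hi, rfl⟩
    exact ⟨⟨i, hi⟩, (c.pt_val ⟨i, hi⟩).symm⟩

@[fun_prop]
lemma measurable_size : Measurable PointConfig.size :=
  measurable_pointConfig fun _ => measurable_const

@[fun_prop]
lemma measurable_pt (i : ℕ) : Measurable fun c : PointConfig => c.pt i := by
  refine measurable_pointConfig fun n => ?_
  unfold PointConfig.pt
  by_cases h : i < n
  · simp only [h, dite_true]
    exact measurable_pi_apply (X := fun _ : Fin n => ℝ) ⟨i, h⟩
  · simp only [h, dite_false]
    fun_prop

/-- The σ-algebra of the product is not by definition the one glued from the pieces with a fixed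
number of points, so measurability on each piece needs an argument. -/
lemma measurable_pointConfig_prod {β γ : Type*} [MeasurableSpace β] [MeasurableSpace γ]
    {f : PointConfig × β → γ}
    (hf : ∀ n, Measurable fun p : (Fin n → ℝ) × β => f (⟨n, p.1⟩, p.2)) : Measurable f := by
  -- The number of points becomes a free countable variable, padded by the default `0` of `pt`;
  -- substituting `size` for it recovers `f`.
  let h : ℕ × (PointConfig × β) → γ := fun q => f (⟨q.1, fun i => q.2.1.pt i⟩, q.2.2)
  have hh : Measurable h := by
    refine measurable_from_prod_countable_right fun n => ?_
    exact (hf n).comp (g := f ∘ fun p : (Fin n → ℝ) × β => (⟨n, p.1⟩, p.2))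
      (f := fun q : PointConfig × β => ((fun i : Fin n => q.1.pt i), q.2))
      (by fun_prop)
  have : f = fun q : PointConfig × β => h (q.1.size, q) := by
    funext ⟨⟨n, u⟩, b⟩
    simp only [h, PointConfig.size]
    congr 3
    funext i
    exact (PointConfig.pt_val ⟨n, u⟩ i).symm
  rw [this]
  exact hh.comp (by fun_prop)

/-! ### Selecting points of a configuration -/

/-- The configuration of the points of `u` with index in `T`. -/
def selectSet {n : ℕ} (u : Fin n → ℝ) (T : Finset (Fin n)) : PointConfig :=
  ofVec T.card (u ∘ T.orderEmbOfFin rfl)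

/-- The configuration of those points of `u` whose mark is `true`. -/
def selectFin {n : ℕ} (u : Fin n → ℝ) (b : Fin n → Bool) : PointConfig :=
  selectSet u (Finset.univ.filter fun i => b i = true)

/-- The configuration of those points of `c` whose mark is `true`. -/
def PointConfig.select (c : PointConfig) (m : ℕ → Bool) : PointConfig :=
  selectFin c.2 fun i => m i

open Classical in
/-- The configuration of those points of `c` that belong to `E`. -/
def PointConfig.filter (E : Set ℝ) (c : PointConfig) : PointConfig :=
  selectFin c.2 fun i => decide (c.2 i ∈ E)

/-- The sum of a function over the points of a configuration. -/
def PointConfig.sum {M : Type*} [AddCommMonoid M] (c : PointConfig) (g : ℝ → M) : M :=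
  ∑ i, g (c.2 i)

lemma selectFin_sum {M : Type*} [AddCommMonoid M] {n : ℕ} (u : Fin n → ℝ) (b : Fin n → Bool)
    (g : ℝ → M) : (selectFin u b).sum g = ∑ i, if b i = true then g (u i) else 0 := by
  rw [← Finset.sum_filter]
  set T : Finset (Fin n) := Finset.univ.filter fun i => b i = true
  change ∑ i : Fin T.card, g (u (T.orderEmbOfFin rfl i)) = _
  conv_rhs => rw [← Finset.image_orderEmbOfFin_univ T rfl]
  rw [Finset.sum_image fun x _ y _ h => (T.orderEmbOfFin rfl).injective h]

lemma selectFin_points {n : ℕ} (u : Fin n → ℝ) (b : Fin n → Bool) :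
    (selectFin u b).points = {t | ∃ i, b i = true ∧ u i = t} := by
  set T : Finset (Fin n) := Finset.univ.filter fun i => b i = true with hT
  change range (u ∘ T.orderEmbOfFin rfl) = _
  rw [range_comp, Finset.range_orderEmbOfFin]
  ext t
  simp [hT]

lemma filter_points (E : Set ℝ) (c : PointConfig) :
    (c.filter E).points = c.points ∩ E := by
  ext t
  rw [PointConfig.filter, selectFin_points]
  simp only [mem_ofPred_eq, decide_eq_true_eq, PointConfig.points, mem_inter_iff, mem_range]
  constructor
  · rintro ⟨i, hi, rfl⟩
    exact ⟨⟨i, rfl⟩, hi⟩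
  · rintro ⟨⟨i, rfl⟩, hi⟩
    exact ⟨i, hi, rfl⟩

lemma select_points_union (c : PointConfig) (m : ℕ → Bool) :
    (c.select m).points ∪ (c.select fun i => !(m i)).points = c.points := by
  ext t
  rw [PointConfig.select, PointConfig.select, selectFin_points, selectFin_points]
  simp only [mem_union, mem_ofPred_eq, PointConfig.points, mem_range]
  constructor
  · rintro (⟨i, -, rfl⟩ | ⟨i, -, rfl⟩) <;> exact ⟨i, rfl⟩
  · rintro ⟨i, rfl⟩
    cases h : m i
    · exact Or.inr ⟨i, by simp [h], rfl⟩
    · exact Or.inl ⟨i, by simp [h], rfl⟩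

lemma measurable_selectFin (n : ℕ) :
    Measurable fun p : (Fin n → Bool) × (Fin n → ℝ) => selectFin p.2 p.1 := by
  refine measurable_from_prod_countable_right fun b => ?_
  exact (measurable_ofVec _).comp (f := fun u : Fin n → ℝ =>
    u ∘ (Finset.univ.filter fun i => b i = true).orderEmbOfFin rfl) (by fun_prop)

lemma measurable_select :
    Measurable fun p : PointConfig × (ℕ → Bool) => p.1.select p.2 := by
  refine measurable_pointConfig_prod fun n => ?_
  exact (measurable_selectFin n).comp
    (f := fun p : (Fin n → ℝ) × (ℕ → Bool) => ((fun i : Fin n => p.2 i), p.1)) (by fun_prop)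

lemma measurable_filter {E : Set ℝ} (hE : MeasurableSet E) :
    Measurable (PointConfig.filter E) := by
  classical
  refine measurable_pointConfig fun n => ?_
  refine (measurable_selectFin n).comp
    (f := fun u : Fin n → ℝ => ((fun i : Fin n => decide (u i ∈ E)), u)) ?_
  refine Measurable.prodMk (measurable_pi_lambda _ fun i => ?_) measurable_id
  refine measurable_to_bool ?_
  have : (fun u : Fin n → ℝ => decide (u i ∈ E)) ⁻¹' {true} = (fun u => u i) ⁻¹' E := by
    ext u; simp
  rw [this]
  exact (measurable_pi_apply i) hE

/-! ### Splitting a sample of independent points -/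

lemma measurePreserving_comp_equiv {ι ι' X : Type*} [Fintype ι] [Fintype ι'] [MeasurableSpace X]
    (μ : Measure X) [SigmaFinite μ] (e : ι ≃ ι') :
    MeasurePreserving (fun u : ι' → X => u ∘ e) (Measure.pi fun _ => μ) (Measure.pi fun _ => μ) :=
  measurePreserving_arrowCongr' (fun _ : ι' => μ) (fun _ : ι => μ) e.symm
    (MeasurableEquiv.refl X) fun _ => MeasurePreserving.id μ

/-- Coordinates in `T` and in its complement are independent; the increasing enumerations only
relabel them. -/
lemma pi_split_apply (μ : Measure ℝ) [IsProbabilityMeasure μ] {n : ℕ} (T : Finset (Fin n))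
    (S : Set (Fin T.card → ℝ)) (S' : Set (Fin Tᶜ.card → ℝ)) (hS : MeasurableSet S)
    (hS' : MeasurableSet S') :
    Measure.pi (fun _ : Fin n => μ)
        {u | u ∘ T.orderEmbOfFin rfl ∈ S ∧ u ∘ Tᶜ.orderEmbOfFin rfl ∈ S'} =
      Measure.pi (fun _ => μ) S * Measure.pi (fun _ => μ) S' := by
  have h1 := measurePreserving_comp_equiv μ (finSumEquivOfFinset (s := T) rfl rfl)
  have h2 := measurePreserving_sumPiEquivProdPi (fun _ : Fin T.card ⊕ Fin Tᶜ.card => μ)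
  have h3 := (h2.comp h1).measure_preimage (hS.prod hS').nullMeasurableSet
  rw [Measure.prod_prod] at h3
  rw [← h3]
  rfl

/-! ### Poisson series -/

/-- Subsets are grouped by their size `j` and the size `k` of the complement; a choice of `T` is how
marking or thinning splits a configuration. -/
lemma tsum_finset_card (w : ℕ → ℝ≥0∞) (F : ℕ → ℕ → ℝ≥0∞) :
    ∑' n, w n * ∑ T : Finset (Fin n), F T.card Tᶜ.card =
      ∑' j, ∑' k, w (j + k) * (((j + k).choose j : ℕ) * F j k) := by
  have h1 : ∀ n, ∑ T : Finset (Fin n), F T.card Tᶜ.card =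
      ∑ p ∈ Finset.HasAntidiagonal.antidiagonal n, ((p.1 + p.2).choose p.1 : ℕ) * F p.1 p.2 := by
    intro n
    have := Finset.sum_powerset_apply_card (fun j => F j (n - j)) (x := (Finset.univ : Finset (Fin n)))
    rw [Finset.powerset_univ, Finset.card_univ, Fintype.card_fin] at this
    rw [Finset.Nat.sum_antidiagonal_eq_sum_range_succ_mk]
    simp only [Finset.card_compl, Fintype.card_fin]
    rw [this]
    refine Finset.sum_congr rfl fun j hj => ?_
    rw [Finset.mem_range] at hj
    rw [Nat.add_sub_cancel' (by omega), nsmul_eq_mul]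
  simp_rw [h1, Finset.mul_sum]
  rw [← ENNReal.tsum_prod, ← (Finset.HasAntidiagonal.sigmaAntidiagonalEquivProd (A := ℕ)).tsum_eq,
    ENNReal.tsum_sigma']
  refine tsum_congr fun n => ?_
  rw [← Finset.tsum_subtype]
  refine tsum_congr fun p => ?_
  have : p.1.1 + p.1.2 = n := Finset.HasAntidiagonal.mem_antidiagonal.1 p.2
  simp [this]

/-- The only factor `exp(-s)` stays with `j`. The sum over `k` is then a full exponential series,
which is the normalising factor in the thinning formula. -/
lemma poissonMeasure_add_mul_choose (s : ℝ≥0) (j k : ℕ) :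
    poissonMeasure s {j + k} * ((j + k).choose j : ℕ) =
      poissonMeasure s {j} * ENNReal.ofReal (s ^ k / k !) := by
  simp only [poissonMeasure_singleton]
  rw [← ENNReal.ofReal_natCast, ← ENNReal.ofReal_mul (by positivity),
    ← ENNReal.ofReal_mul (by positivity)]
  congr 1
  have : ((j + k).choose j : ℝ) = (j + k)! / (j ! * k !) := by
    rw [Nat.cast_add_choose]
  rw [this, pow_add]
  have := Nat.factorial_ne_zero (j + k)
  field_simp

lemma poissonMeasure_two_mul (s : ℝ≥0) (j k : ℕ) :
    poissonMeasure (2 * s) {j + k} * ((j + k).choose j : ℕ) * (2⁻¹ : ℝ≥0∞) ^ (j + k) =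
      poissonMeasure s {j} * poissonMeasure s {k} := by
  have h2 : (2⁻¹ : ℝ≥0∞) = ENNReal.ofReal 2⁻¹ := by
    rw [ENNReal.ofReal_inv_of_pos two_pos]; simp
  rw [poissonMeasure_add_mul_choose, h2, ← ENNReal.ofReal_pow (by positivity)]
  simp only [poissonMeasure_singleton]
  rw [← ENNReal.ofReal_mul (by positivity), ← ENNReal.ofReal_mul (by positivity),
    ← ENNReal.ofReal_mul (by positivity)]
  congr 1
  have : Real.exp (-((2 * s : ℝ≥0) : ℝ)) = Real.exp (-s) * Real.exp (-s) := by
    rw [← Real.exp_add]; congr 1; push_cast; ring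
  rw [this, pow_add]
  push_cast
  simp only [mul_pow, inv_pow]
  field_simp

lemma tsum_ofReal_pow_div_factorial (s : ℝ) (hs : 0 ≤ s) :
    ∑' k : ℕ, ENNReal.ofReal (s ^ k / k !) = ENNReal.ofReal (Real.exp s) := by
  rw [← ENNReal.ofReal_tsum_of_nonneg (fun k => by positivity) (Real.summable_pow_div_factorial s),
    Real.exp_eq_exp_ℝ, NormedSpace.exp_eq_tsum_div]

/-! ### The Poisson process -/

lemma measurableSet_timeInterval {r : ℝ} : MeasurableSet (timeInterval r) := measurableSet_Icc

lemma isProbabilityMeasure_uniform {r : ℝ} (hr : 0 < r) :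
    IsProbabilityMeasure (volume[|timeInterval r] : Measure ℝ) := by
  refine cond_isProbabilityMeasure_of_finite ?_ ?_ <;> simp [timeInterval, hr]

lemma poissonProcess_eq_sum (ρ r : ℝ) : poissonProcess ρ r = Measure.sum fun n : ℕ =>
    poissonMeasure (Real.toNNReal (ρ * r)) {n} •
      (Measure.pi fun _ : Fin n => volume[|timeInterval r]).map (ofVec n) := rfl

lemma poissonProcess_apply (ρ r : ℝ) {S : Set PointConfig} (hS : MeasurableSet S) :
    poissonProcess ρ r S = ∑' n, poissonMeasure (Real.toNNReal (ρ * r)) {n} *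
      Measure.pi (fun _ : Fin n => volume[|timeInterval r]) (ofVec n ⁻¹' S) := by
  rw [poissonProcess_eq_sum, Measure.sum_apply _ hS]
  refine tsum_congr fun n => ?_
  rw [Measure.smul_apply, Measure.map_apply (measurable_ofVec n) hS, smul_eq_mul]

lemma lintegral_poissonProcess (ρ r : ℝ) {f : PointConfig → ℝ≥0∞} (hf : Measurable f) :
    ∫⁻ c, f c ∂(poissonProcess ρ r) = ∑' n, poissonMeasure (Real.toNNReal (ρ * r)) {n} *
      ∫⁻ u, f ⟨n, u⟩ ∂Measure.pi (fun _ : Fin n => volume[|timeInterval r]) := by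
  rw [poissonProcess_eq_sum, lintegral_sum_measure]
  refine tsum_congr fun n => ?_
  rw [lintegral_smul_measure, lintegral_map hf (measurable_ofVec n), smul_eq_mul]
  rfl

lemma isProbabilityMeasure_poissonProcess (ρ : ℝ) {r : ℝ} (hr : 0 < r) :
    IsProbabilityMeasure (poissonProcess ρ r) := by
  have := isProbabilityMeasure_uniform hr
  constructor
  rw [poissonProcess_apply ρ r MeasurableSet.univ]
  simp only [preimage_univ, measure_univ, mul_one]
  rw [← measure_univ (μ := poissonMeasure (Real.toNNReal (ρ * r))),
    ← Measure.tsum_indicator_apply_singleton _ _ MeasurableSet.univ]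
  simp

lemma ae_poissonProcess_iff {ρ r : ℝ} {p : PointConfig → Prop}
    (h : ∀ n, ∀ᵐ u ∂Measure.pi (fun _ : Fin n => volume[|timeInterval r]), p ⟨n, u⟩) :
    ∀ᵐ c ∂(poissonProcess ρ r), p c := by
  rw [poissonProcess_eq_sum, Measure.ae_sum_iff]
  intro n
  refine Measure.ae_smul_measure ?_ _
  exact (measurableEmbedding_ofVec n).ae_map_iff.2 (h n)

/-! ### Superposition -/

instance : IsProbabilityMeasure fairCoin := by unfold fairCoin; infer_instance

/-- The law of a sequence of independent fair coins. -/
def coinSeq : Measure (ℕ → Bool) := Measure.infinitePi fun _ => fairCoin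

instance : IsProbabilityMeasure coinSeq := by unfold coinSeq; infer_instance

lemma fairCoin_singleton (b : Bool) : fairCoin {b} = 2⁻¹ := by
  rw [fairCoin, PMF.toMeasure_apply_singleton _ _ (measurableSet_singleton b)]
  simp

lemma fairCoin_map_xor (b : Bool) : fairCoin.map (fun a => xor a b) = fairCoin := by
  refine Measure.ext_of_singleton fun a => ?_
  rw [Measure.map_apply (by fun_prop) (measurableSet_singleton a)]
  have : (fun x => xor x b) ⁻¹' {a} = {xor a b} := by
    ext x; cases x <;> cases a <;> cases b <;> simp
  rw [this, fairCoin_singleton, fairCoin_singleton]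

/-- Marks are infinite sequences, so that the space on which flips act does not depend on the number
of bridges. -/
lemma coinSeq_map_xor (b : ℕ → Bool) : coinSeq.map (fun a i => xor (a i) (b i)) = coinSeq := by
  rw [coinSeq, Measure.infinitePi_map_pi (f := fun i a => xor a (b i)) _ fun _ => by fun_prop]
  simp_rw [fairCoin_map_xor]

lemma coinSeq_initial (n : ℕ) (b : Fin n → Bool) :
    coinSeq {m | (fun i : Fin n => m i) = b} = 2⁻¹ ^ n := by
  have : {m : ℕ → Bool | (fun i : Fin n => m i) = b} =
      Set.pi (Finset.range n) fun i => if h : i < n then {b ⟨i, h⟩} else univ := by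
    ext m
    simp only [mem_ofPred_eq, mem_pi, Finset.coe_range, mem_Iio, funext_iff]
    constructor
    · intro h i hi
      simp [hi, h ⟨i, hi⟩]
    · intro h i
      simpa using h i i.2
  rw [this, coinSeq, Measure.infinitePi_pi]
  · rw [Finset.prod_congr rfl (g := fun _ => 2⁻¹)]
    · simp
    · intro i hi
      simp [Finset.mem_range.1 hi, fairCoin_singleton]
  · intro i _
    exact (Set.to_countable _).measurableSet

/-- The two configurations of points marked `true` and of points marked `false`. -/
def split (p : PointConfig × (ℕ → Bool)) : PointConfig × PointConfig :=
  (p.1.select p.2, p.1.select fun i => !(p.2 i))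

lemma measurable_split : Measurable split := by
  refine measurable_select.prodMk (measurable_select.comp
    (f := fun p : PointConfig × (ℕ → Bool) => (p.1, fun i => !(p.2 i))) ?_)
  refine measurable_fst.prodMk (measurable_pi_lambda _ fun i => ?_)
  exact (Measurable.of_discrete (f := fun b : Bool => !b)).comp (by fun_prop)

lemma coinSeq_marks (n : ℕ) (P : Finset (Fin n) → Prop) [DecidablePred P] :
    coinSeq {m | P (Finset.univ.filter fun i : Fin n => m i = true)} =
      ∑ T : Finset (Fin n), 2⁻¹ ^ n * if P T then 1 else 0 := by
  have h : {m : ℕ → Bool | P (Finset.univ.filter fun i : Fin n => m i = true)} =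
      ⋃ T ∈ Finset.univ.filter P,
        {m : ℕ → Bool | (fun i : Fin n => m i) = fun i => decide (i ∈ T)} := by
    ext m
    simp only [mem_ofPred_eq, mem_iUnion, Finset.mem_filter, Finset.mem_univ, true_and,
      exists_prop]
    constructor
    · intro h
      exact ⟨_, h, by funext i; simp⟩
    · rintro ⟨T, hT, h⟩
      convert hT
      ext i
      simp [congrFun h i]
  rw [h, measure_biUnion_finset]
  · simp_rw [coinSeq_initial, mul_ite, mul_one, mul_zero]
    rw [Finset.sum_filter]
  · intro T _ T' _ hTT'
    refine Set.disjoint_left.2 fun m hm hm' => hTT' ?_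
    simp only [mem_ofPred_eq] at hm hm'
    ext i
    have := congrFun (hm.symm.trans hm') i
    simpa using this
  · intro T _
    exact (measurable_pi_lambda (fun (m : ℕ → Bool) (i : Fin n) => m i)
      fun i => measurable_pi_apply _) (measurableSet_singleton _)

/-- Two independent Poisson processes of the same intensity arise by attaching independent fair
marks to the points of a single one of twice that intensity. -/
theorem poissonProcess_prod_self {lam r : ℝ} (hr : 0 < r) :
    (poissonProcess lam r).prod (poissonProcess lam r) =
      ((poissonProcess (2 * lam) r).prod coinSeq).map split := by
  classical
  have := isProbabilityMeasure_uniform hr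
  have := isProbabilityMeasure_poissonProcess lam hr
  have := isProbabilityMeasure_poissonProcess (2 * lam) hr
  refine Measure.prod_eq fun S S' hS hS' => ?_
  have hm := measurable_split (hS.prod hS')
  rw [Measure.map_apply measurable_split (hS.prod hS'), Measure.prod_apply hm,
    lintegral_poissonProcess _ _ (measurable_measure_prodMk_left hm)]
  set ν : Measure ℝ := volume[|timeInterval r]
  set a : ℕ → ℝ≥0∞ := fun j => Measure.pi (fun _ : Fin j => ν) (ofVec j ⁻¹' S) with ha
  set b : ℕ → ℝ≥0∞ := fun j => Measure.pi (fun _ : Fin j => ν) (ofVec j ⁻¹' S') with hb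
  -- Given `n` points, each set `T` of points marked `true` has probability `2⁻ⁿ`, and the points in
  -- `T` and outside it are independent samples.
  have key : ∀ n, ∫⁻ u, coinSeq (Prod.mk (⟨n, u⟩ : PointConfig) ⁻¹' (split ⁻¹' S ×ˢ S'))
      ∂Measure.pi (fun _ : Fin n => ν) =
      ∑ T : Finset (Fin n), 2⁻¹ ^ (T.card + Tᶜ.card) * (a T.card * b Tᶜ.card) := by
    intro n
    have h1 : ∀ u : Fin n → ℝ,
        coinSeq (Prod.mk (⟨n, u⟩ : PointConfig) ⁻¹' (split ⁻¹' S ×ˢ S')) =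
        ∑ T : Finset (Fin n), 2⁻¹ ^ n * indicator
          {u : Fin n → ℝ | u ∘ T.orderEmbOfFin rfl ∈ ofVec T.card ⁻¹' S ∧
            u ∘ Tᶜ.orderEmbOfFin rfl ∈ ofVec Tᶜ.card ⁻¹' S'} (fun _ => 1) u := by
      intro u
      have := coinSeq_marks n fun T => selectSet u T ∈ S ∧ selectSet u Tᶜ ∈ S'
      convert! this using 2
      swap
      · simp only [indicator_apply]
        rfl
      ext m
      simp only [mem_preimage, mem_prod, split, PointConfig.select, selectFin, mem_ofPred_eq]
      have : (Finset.univ.filter fun i : Fin n => (!(m i)) = true) =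
          (Finset.univ.filter fun i : Fin n => m i = true)ᶜ := by
        ext i; simp
      rw [this]
    simp_rw [h1]
    have hmeas : ∀ T : Finset (Fin n), MeasurableSet
          {u : Fin n → ℝ | u ∘ T.orderEmbOfFin rfl ∈ ofVec T.card ⁻¹' S ∧
            u ∘ Tᶜ.orderEmbOfFin rfl ∈ ofVec Tᶜ.card ⁻¹' S'} := by
      intro T
      have h2 : ∀ T : Finset (Fin n), Measurable fun u : Fin n → ℝ => u ∘ T.orderEmbOfFin rfl :=
        fun T => by fun_prop
      exact (h2 T (measurable_ofVec _ hS)).inter (h2 Tᶜ (measurable_ofVec _ hS'))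
    rw [lintegral_finsetSum _ fun T _ => (measurable_const.indicator (hmeas T)).const_mul _]
    refine Finset.sum_congr rfl fun T _ => ?_
    rw [lintegral_const_mul _ (measurable_const.indicator (hmeas T)),
      lintegral_indicator (hmeas T), lintegral_const, one_mul, Measure.restrict_apply_univ,
      pi_split_apply ν T _ _ (measurable_ofVec _ hS) (measurable_ofVec _ hS'),
      Finset.card_add_card_compl, Fintype.card_fin]
  simp_rw [key]
  rw [tsum_finset_card _ fun j k => 2⁻¹ ^ (j + k) * (a j * b k), poissonProcess_apply _ _ hS,
    poissonProcess_apply _ _ hS', ← ENNReal.tsum_mul_right]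
  refine tsum_congr fun j => ?_
  rw [← ENNReal.tsum_mul_left]
  refine tsum_congr fun k => ?_
  have hs : Real.toNNReal (2 * lam * r) = 2 * Real.toNNReal (lam * r) := by
    rw [mul_assoc, Real.toNNReal_mul zero_le_two]; simp
  have h3 := poissonMeasure_two_mul (Real.toNNReal (lam * r)) j k
  rw [hs]
  calc _ = (poissonMeasure (2 * Real.toNNReal (lam * r)) {j + k} * ((j + k).choose j : ℕ) *
        2⁻¹ ^ (j + k)) * (a j * b k) := by ring
    _ = _ := by rw [h3]; ring

/-! ### Thinning -/

lemma measurableSet_points_subset {E : Set ℝ} (hE : MeasurableSet E) :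
    MeasurableSet {c : PointConfig | c.points ⊆ E} := by
  rw [measurableSet_pointConfig_iff]
  intro n
  have : ofVec n ⁻¹' {c : PointConfig | c.points ⊆ E} = Set.pi univ fun _ => E := by
    ext u
    simp [ofVec, PointConfig.points, range_subset_iff]
  rw [this]
  exact MeasurableSet.univ_pi fun _ => hE

/-- The law of the points of a Poisson process in `E` is, up to normalization, that of the process
conditioned to have all its points in `E`. -/
theorem poissonProcess_filter_apply {ρ r : ℝ} (hr : 0 < r) (hρ : 0 ≤ ρ) {E : Set ℝ}
    (hE : MeasurableSet E) {S : Set PointConfig} (hS : MeasurableSet S) :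
    poissonProcess ρ r (PointConfig.filter E ⁻¹' S) =
      ENNReal.ofReal (Real.exp (ρ * volume.real (timeInterval r \ E))) *
        poissonProcess ρ r ({c | c.points ⊆ E} ∩ S) := by
  classical
  have := isProbabilityMeasure_uniform hr
  set ν : Measure ℝ := volume[|timeInterval r] with hν
  set a : ℕ → ℝ≥0∞ := fun j =>
    Measure.pi (fun _ : Fin j => ν) (ofVec j ⁻¹' ({c | c.points ⊆ E} ∩ S)) with ha
  have hES := (measurableSet_points_subset hE).inter hS
  -- `T` is the set of indices of points in `E`: the points outside `T` each contribute a factor `ν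
  -- Eᶜ`.
  have key : ∀ n, Measure.pi (fun _ : Fin n => ν) (ofVec n ⁻¹' (PointConfig.filter E ⁻¹' S)) =
      ∑ T : Finset (Fin n), a T.card * ν Eᶜ ^ Tᶜ.card := by
    intro n
    have h2 : ∀ (u : Fin n → ℝ) (T : Finset (Fin n)),
        (u ∘ T.orderEmbOfFin rfl ∈ ofVec T.card ⁻¹' ({c | c.points ⊆ E} ∩ S) ∧
        u ∘ Tᶜ.orderEmbOfFin rfl ∈ Set.pi univ fun _ => Eᶜ) ↔
        (Finset.univ.filter fun i => u i ∈ E) = T ∧ selectSet u T ∈ S := by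
      intro u T
      have h3 : u ∘ T.orderEmbOfFin rfl ∈ ofVec T.card ⁻¹' {c | c.points ⊆ E} ↔
          ∀ i ∈ T, u i ∈ E := by
        have : (ofVec T.card (u ∘ T.orderEmbOfFin rfl)).points = u '' T := by
          change range (u ∘ T.orderEmbOfFin rfl) = _
          rw [range_comp, Finset.range_orderEmbOfFin]
        simp [this, subset_def]
      have h4 : (u ∘ Tᶜ.orderEmbOfFin rfl ∈ Set.pi univ fun _ => Eᶜ) ↔
          ∀ i ∉ T, u i ∉ E := by
        have : (u ∘ Tᶜ.orderEmbOfFin rfl ∈ Set.pi univ fun _ => Eᶜ) ↔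
            range (u ∘ Tᶜ.orderEmbOfFin rfl) ⊆ Eᶜ := by
          simp [range_subset_iff]
        rw [this, range_comp, Finset.range_orderEmbOfFin]
        simp [subset_def]
      rw [preimage_inter, mem_inter_iff, h3, h4]
      constructor
      · rintro ⟨⟨h5, h6⟩, h7⟩
        refine ⟨?_, h6⟩
        ext i
        simp only [Finset.mem_filter, Finset.mem_univ, true_and]
        exact ⟨fun hi => by_contra fun h => h7 i h hi, h5 i⟩
      · rintro ⟨rfl, h6⟩
        exact ⟨⟨fun i hi => by simpa using hi, h6⟩, fun i hi => by simpa using hi⟩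
    have h1 : ofVec n ⁻¹' (PointConfig.filter E ⁻¹' S) = ⋃ T ∈ (Finset.univ : Finset (Finset (Fin n))),
        {u : Fin n → ℝ |
          u ∘ T.orderEmbOfFin rfl ∈ ofVec T.card ⁻¹' ({c | c.points ⊆ E} ∩ S) ∧
          u ∘ Tᶜ.orderEmbOfFin rfl ∈ Set.pi univ fun _ => Eᶜ} := by
      ext u
      simp only [mem_iUnion, Finset.mem_univ, exists_prop, true_and, mem_ofPred_eq, h2]
      simp only [exists_eq_left']
      simp [PointConfig.filter, selectFin, ofVec]
    have hmeas : ∀ T : Finset (Fin n), MeasurableSet {u : Fin n → ℝ |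
          u ∘ T.orderEmbOfFin rfl ∈ ofVec T.card ⁻¹' ({c | c.points ⊆ E} ∩ S) ∧
          u ∘ Tᶜ.orderEmbOfFin rfl ∈ Set.pi univ fun _ => Eᶜ} := by
      intro T
      have h2 : ∀ T : Finset (Fin n), Measurable fun u : Fin n → ℝ => u ∘ T.orderEmbOfFin rfl :=
        fun T => by fun_prop
      exact (h2 T (measurable_ofVec _ hES)).inter
        (h2 Tᶜ (MeasurableSet.univ_pi fun _ => hE.compl))
    rw [h1, measure_biUnion_finset _ fun T _ => hmeas T]
    · refine Finset.sum_congr rfl fun T _ => ?_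
      rw [pi_split_apply ν T _ _ (measurable_ofVec _ hES)
        (MeasurableSet.univ_pi fun _ => hE.compl), Measure.pi_pi]
      simp [ha]
    · intro T _ T' _ hTT'
      refine Set.disjoint_left.2 fun u hu hu' => hTT' ?_
      exact ((h2 u T).1 hu).1.symm.trans ((h2 u T').1 hu').1
  have hvol : volume (timeInterval r) = ENNReal.ofReal r := by
    rw [timeInterval, Real.volume_Icc]
    congr 1
    ring
  have hq : ν Eᶜ = ENNReal.ofReal (volume.real (timeInterval r \ E) / r) := by
    rw [hν, cond_apply measurableSet_timeInterval, hvol, ENNReal.ofReal_div_of_pos hr,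
      ofReal_measureReal (ne_top_of_le_ne_top (by simp [hvol]) (measure_mono sdiff_subset)),
      ENNReal.div_eq_inv_mul]
    rfl
  rw [poissonProcess_apply _ _ (measurable_filter hE hS), poissonProcess_apply _ _ hES]
  simp_rw [← hν, key]
  rw [tsum_finset_card _ fun j k => a j * ν Eᶜ ^ k, ← ENNReal.tsum_mul_left]
  refine tsum_congr fun j => ?_
  have h5 : ∀ k : ℕ, ENNReal.ofReal ((Real.toNNReal (ρ * r) : ℝ) ^ k / k !) * ν Eᶜ ^ k =
      ENNReal.ofReal ((ρ * volume.real (timeInterval r \ E)) ^ k / k !) := by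
    intro k
    rw [hq, ← ENNReal.ofReal_pow (by positivity), ← ENNReal.ofReal_mul (by positivity),
      Real.coe_toNNReal _ (by positivity)]
    congr 1
    rw [mul_pow, mul_pow, div_pow]
    field_simp
  calc _ = ∑' k, poissonMeasure (Real.toNNReal (ρ * r)) {j} * a j *
        (ENNReal.ofReal ((Real.toNNReal (ρ * r) : ℝ) ^ k / k !) * ν Eᶜ ^ k) := by
        refine tsum_congr fun k => ?_
        have := poissonMeasure_add_mul_choose (Real.toNNReal (ρ * r)) j k
        rw [← mul_assoc, this]
        ring
    _ = _ := by
        simp_rw [h5]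
        rw [ENNReal.tsum_mul_left, tsum_ofReal_pow_div_factorial _ (by positivity)]
        ring

variable {d N : ℕ}

/-! ### Generic samples: labels and consistency as additive parities. -/

/-! ### Labels as elements of `ZMod 2` -/

section LineSum

variable {M : Type*} [AddCommMonoid M]

/-- The sum of `g` over the switching points on the line of `x`, counted with multiplicity. -/
def lineSum (A : Finset (SpaceTime d N)) (B : Bond d N → PointConfig)
    (G : Site d N → PointConfig) (x : Site d N) (g : ℝ → M) : M :=
  (∑ p ∈ A, if p.1 = x then g p.2 else 0) + (∑ e, if x ∈ e.1 then (B e).sum g else 0) +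
    (G x).sum g

/-- Indices for the switching points on the line of `x`. -/
abbrev LineIndex (A : Finset (SpaceTime d N)) (B : Bond d N → PointConfig)
    (G : Site d N → PointConfig) (x : Site d N) : Type :=
  ({p // p ∈ A.filter fun p => p.1 = x} ⊕
    Σ e : {e : Bond d N // e ∈ Finset.univ.filter fun e : Bond d N => x ∈ e.1}, Fin (B e).1) ⊕
    Fin (G x).1

/-- The time of the switching point with a given index. -/
def lineTime (A : Finset (SpaceTime d N)) (B : Bond d N → PointConfig)
    (G : Site d N → PointConfig) (x : Site d N) : LineIndex A B G x → ℝ :=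
  Sum.elim (Sum.elim (fun p => p.1.2) fun q => (B q.1).2 q.2) (G x).2

/-- The switching points on each line are distinct, and lie in the open time interval. -/
structure GenericCopy (r : ℝ) (A : Finset (SpaceTime d N)) (B : Bond d N → PointConfig)
    (G : Site d N → PointConfig) : Prop where
  inj : ∀ x, Function.Injective (lineTime A B G x)
  mem : ∀ x j, lineTime A B G x j ∈ Ioo (-(r / 2)) (r / 2)

variable {r : ℝ} {A : Finset (SpaceTime d N)} {B : Bond d N → PointConfig}
    {G : Site d N → PointConfig}

lemma range_lineTime (x : Site d N) :
    range (lineTime A B G x) = switchingPoints ↑A B (fun x => (G x).points) x := by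
  ext t
  simp only [lineTime, Sum.elim_range, switchingPoints, mem_union, mem_range, PointConfig.points,
    mem_ofPred_eq, Finset.mem_coe]
  refine or_congr (or_congr ?_ ?_) Iff.rfl
  · constructor
    · rintro ⟨⟨⟨y, s⟩, hp⟩, rfl⟩
      obtain ⟨hp', rfl⟩ := Finset.mem_filter.1 hp
      exact hp'
    · intro h
      exact ⟨⟨(x, t), by simp [h]⟩, rfl⟩
  · constructor
    · rintro ⟨⟨⟨e, he⟩, i⟩, rfl⟩
      exact ⟨e, by simpa using he, i, rfl⟩
    · rintro ⟨e, he, i, rfl⟩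
      exact ⟨⟨⟨e, by simpa using he⟩, i⟩, rfl⟩

lemma sum_lineIndex (x : Site d N) (g : ℝ → M) :
    ∑ j, g (lineTime A B G x j) = lineSum A B G x g := by
  rw [Fintype.sum_sum_type, Fintype.sum_sum_type, Fintype.sum_sigma]
  unfold lineSum
  congr 2
  · rw [← Finset.sum_filter]
    exact Finset.sum_coe_sort _ fun p : SpaceTime d N => g p.2
  · rw [← Finset.sum_filter]
    exact Finset.sum_coe_sort _ fun e : Bond d N => (B e).sum g

lemma finite_switchingPoints (x : Site d N) :
    (switchingPoints ↑A B (fun x => (G x).points) x).Finite := by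
  rw [← range_lineTime]
  exact finite_range _

lemma lineSum_add (x : Site d N) (g h : ℝ → M) :
    lineSum A B G x (fun t => g t + h t) = lineSum A B G x g + lineSum A B G x h := by
  simp only [← sum_lineIndex, Finset.sum_add_distrib]

lemma GenericCopy.sum_eq (hg : GenericCopy r A B G) (x : Site d N) (g : ℝ → M) :
    ∑ t ∈ (finite_switchingPoints (A := A) (B := B) (G := G) x).toFinset, g t =
      lineSum A B G x g := by
  classical
  have : (finite_switchingPoints (A := A) (B := B) (G := G) x).toFinset =
      Finset.univ.image (lineTime A B G x) := by
    ext t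
    rw [Finite.mem_toFinset, ← range_lineTime]
    simp
  rw [this, Finset.sum_image fun i _ j _ h => hg.inj x h, sum_lineIndex]

lemma GenericCopy.mem_Ioo (hg : GenericCopy r A B G) {x : Site d N} {t : ℝ}
    (ht : t ∈ switchingPoints ↑A B (fun x => (G x).points) x) : t ∈ Ioo (-(r / 2)) (r / 2) := by
  rw [← range_lineTime] at ht
  obtain ⟨j, rfl⟩ := ht
  exact hg.mem x j

-- The cardinality of a set ignores multiplicity, the sum does not; they agree because distinct
-- indices have distinct times. Sums have the advantage of being additive when marks are flipped.
open Classical in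
lemma GenericCopy.ncard_inter (hg : GenericCopy r A B G) (x : Site d N) (W : Set ℝ) :
    ((switchingPoints ↑A B (fun x => (G x).points) x ∩ W).ncard : ZMod 2) =
      lineSum A B G x fun t => if t ∈ W then 1 else 0 := by
  rw [← hg.sum_eq, ← Finset.natCast_card_filter, ← Set.ncard_coe_finset]
  congr 2
  ext t
  simp

end LineSum

/-- The indicator of the times before `u`, as an element of `ZMod 2`. -/
def below (u t : ℝ) : ZMod 2 := if t ≤ u then 1 else 0

/-- The parity of the number of switching points on the line of `x` before time `u`. -/
def parity (A : Finset (SpaceTime d N)) (B : Bond d N → PointConfig)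
    (G : Site d N → PointConfig) (x : Site d N) (u : ℝ) : ZMod 2 :=
  lineSum A B G x (below u)

/-- The label of `(x, u)` (with `0` for `even`) computed from the parities `σ`. -/
def label (b : TimeBC) (τ : Site d N → Bool) (σ : Site d N → ℝ → ZMod 2) (x : Site d N) (u : ℝ) :
    ZMod 2 :=
  match b with
  | .free => σ x u
  | .wired => 1 + σ x u
  | .periodic => (τ x).toNat + σ x 0 + σ x u

section Copy

variable {r : ℝ} {A : Finset (SpaceTime d N)} {B : Bond d N → PointConfig}
    {G : Site d N → PointConfig} (hg : GenericCopy r A B G)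
include hg

lemma GenericCopy.ncard_Iic (x : Site d N) (u : ℝ) :
    ((switchingPoints ↑A B (fun x => (G x).points) x ∩ Iic u).ncard : ZMod 2) =
      parity A B G x u := by
  classical
  rw [hg.ncard_inter]
  rfl

lemma GenericCopy.consistent_iff :
    Consistent (switchingPoints ↑A B fun x => (G x).points) ↔ ∀ x, parity A B G x (r / 2) = 0 := by
  refine forall_congr' fun x => ?_
  rw [← hg.ncard_Iic, ZMod.natCast_eq_zero_iff_even]
  have : switchingPoints ↑A B (fun x => (G x).points) x ⊆ Iic (r / 2) :=
    fun t ht => (hg.mem_Ioo ht).2.le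
  rw [inter_eq_left.2 this]

lemma GenericCopy.isOdd_iff (b : TimeBC) (τ : Site d N → Bool) (x : Site d N) (u : ℝ) :
    IsOdd b r τ (switchingPoints ↑A B fun x => (G x).points) x u ↔
      u ∈ switchingPoints ↑A B (fun x => (G x).points) x ∨
        label b τ (parity A B G) x u = 1 := by
  classical
  have h1 : switchingPoints ↑A B (fun x => (G x).points) x ∩ Ioc (-(r / 2)) u =
      switchingPoints ↑A B (fun x => (G x).points) x ∩ Iic u := by
    ext t
    simp only [mem_inter_iff, mem_Ioc, mem_Iic]
    exact ⟨fun h => ⟨h.1, h.2.2⟩, fun h => ⟨h.1, (hg.mem_Ioo h.1).1, h.2⟩⟩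
  refine or_congr Iff.rfl ?_
  cases b
  · simp only [label]
    rw [h1, ← ZMod.natCast_eq_one_iff_odd, hg.ncard_Iic]
  · simp only [label]
    rw [h1, ← ZMod.natCast_eq_one_iff_odd, Nat.cast_add, hg.ncard_Iic, Nat.cast_one]
  · simp only [label]
    rw [← ZMod.natCast_eq_one_iff_odd, Nat.cast_add, hg.ncard_inter, add_assoc, parity, parity,
      ← lineSum_add]
    -- Modulo 2, the points between `0` and `u` are those up to `0` plus those up to `u`, whatever
    -- the sign of `u`.
    have h2 : (fun t => if t ∈ uIoc 0 u then (1 : ZMod 2) else 0) =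
        fun t => below 0 t + below u t := by
      funext t
      simp only [below, mem_uIoc]
      split_ifs <;> first | rfl | (exfalso; grind)
    rw [h2]

/-- Declaring switching points odd changes the labels only on a finite set, hence no length. -/
lemma GenericCopy.evenLength_eq (b : TimeBC) (τ : Site d N → Bool) :
    evenLength b r τ (switchingPoints ↑A B fun x => (G x).points) =
      ∑ x, volume.real {u ∈ timeInterval r | label b τ (parity A B G) x u = 0} := by
  refine Finset.sum_congr rfl fun x _ => measureReal_congr ?_
  have h0 : volume (switchingPoints ↑A B (fun x => (G x).points) x) = 0 :=
    (finite_switchingPoints x).measure_zero _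
  filter_upwards [measure_eq_zero_iff_ae_notMem.1 h0] with u hu
  refine propext (and_congr Iff.rfl ?_)
  rw [hg.isOdd_iff]
  simp only [hu, false_or]
  generalize label b τ (parity A B G) x u = z
  revert z
  decide

open Classical in
lemma GenericCopy.weight_eq (b : TimeBC) (δ : ℝ) (τ : Site d N → Bool) :
    weight b r δ τ (switchingPoints ↑A B fun x => (G x).points) =
      if ∀ x, parity A B G x (r / 2) = 0 then Real.exp (2 * δ *
        ∑ x, volume.real {u ∈ timeInterval r | label b τ (parity A B G) x u = 0}) else 0 := by
  rw [weight, hg.evenLength_eq]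
  simp only [hg.consistent_iff]

end Copy

/-! ### Generic samples -/

/-- The Poisson processes of a sample. -/
def Sample.config (ω : Sample d N) :
    Bond d N ⊕ ((Bond d N ⊕ Site d N) ⊕ Site d N) → PointConfig :=
  Sum.elim ω.B (Sum.elim (Sum.elim ω.Bhat ω.2.1.2) ω.2.2)

/-- All points of a family of configurations are distinct, lie in the open time interval and
avoid `Z`. -/
structure GenericFamily {K : Type*} (r : ℝ) (Z : Set ℝ) (c : K → PointConfig) : Prop where
  inj : Function.Injective fun p : Σ k, Fin (c k).1 => (c p.1).2 p.2
  mem : ∀ k i, (c k).2 i ∈ Ioo (-(r / 2)) (r / 2)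
  avoid : ∀ k i, (c k).2 i ∉ Z

/-- Two distinct coordinates of a product measure are independent, so their joint law is a product
and Fubini applies. -/
lemma ae_pi_pair {ι : Type*} [Fintype ι] {X : Type*} [MeasurableSpace X] (μ : ι → Measure X)
    [∀ i, IsProbabilityMeasure (μ i)] {i j : ι} (hij : i ≠ j) {p : X × X → Prop}
    (hp : MeasurableSet {q | p q}) (h : ∀ a, ∀ᵐ b ∂μ j, p (a, b)) :
    ∀ᵐ u ∂Measure.pi μ, p (u i, u j) := by
  have h1 : iIndepFun (fun i (u : ι → X) => u i) (Measure.pi μ) :=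
    iIndepFun_pi (X := fun i (x : X) => x) fun i => aemeasurable_id
  have h2 := (indepFun_iff_map_prod_eq_prod_map_map
    (measurable_pi_apply i).aemeasurable (measurable_pi_apply j).aemeasurable).1
    (h1.indepFun hij)
  rw [(measurePreserving_eval μ i).map_eq, (measurePreserving_eval μ j).map_eq] at h2
  have h3 : ∀ᵐ q ∂(μ i).prod (μ j), p q := by
    rw [Measure.ae_prod_iff_ae_ae hp]
    exact Filter.Eventually.of_forall h
  rw [← h2] at h3
  exact ae_of_ae_map ((measurable_pi_apply i).prodMk (measurable_pi_apply j)).aemeasurable h3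

lemma ae_uniform_mem {r : ℝ} (Z : Set ℝ) (hZ : Z.Countable) :
    ∀ᵐ t ∂(volume[|timeInterval r] : Measure ℝ), t ∈ Ioo (-(r / 2)) (r / 2) ∧ t ∉ Z := by
  have h1 : ∀ᵐ t ∂(volume[|timeInterval r] : Measure ℝ), t ∈ timeInterval r := by
    exact ae_cond_mem measurableSet_timeInterval
  have h2 : ∀ᵐ t ∂(volume[|timeInterval r] : Measure ℝ), t ∉ Z ∪ {-(r / 2), r / 2} := by
    refine cond_absolutelyContinuous.ae_le ?_
    exact ((hZ.union (to_countable _)).measure_zero volume) |> measure_eq_zero_iff_ae_notMem.1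
  filter_upwards [h1, h2] with t ht ht'
  simp only [mem_union, mem_insert_iff, mem_singleton_iff, not_or] at ht'
  exact ⟨⟨lt_of_le_of_ne ht.1 (Ne.symm ht'.2.1), lt_of_le_of_ne ht.2 ht'.2.2⟩, ht'.1⟩

lemma ae_poissonProcess_mem {ρ r : ℝ} (hr : 0 < r) (Z : Set ℝ) (hZ : Z.Countable) :
    ∀ᵐ c ∂(poissonProcess ρ r), ∀ i, c.2 i ∈ Ioo (-(r / 2)) (r / 2) ∧ c.2 i ∉ Z := by
  have := isProbabilityMeasure_uniform hr
  refine ae_poissonProcess_iff fun n => ?_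
  refine (ae_all_iff (ι := Fin n)).2 fun i => ?_
  exact (measurePreserving_eval (fun _ : Fin n => volume[|timeInterval r])
    i).quasiMeasurePreserving.ae (ae_uniform_mem Z hZ)

lemma ae_poissonProcess_injective {ρ r : ℝ} (hr : 0 < r) :
    ∀ᵐ c ∂(poissonProcess ρ r), Function.Injective c.2 := by
  have := isProbabilityMeasure_uniform hr
  refine ae_poissonProcess_iff fun n => ?_
  have : ∀ i j : Fin n, i ≠ j →
      ∀ᵐ u ∂Measure.pi (fun _ : Fin n => (volume[|timeInterval r] : Measure ℝ)), u i ≠ u j := by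
    intro i j hij
    refine ae_pi_pair (fun _ : Fin n => volume[|timeInterval r]) hij (p := fun q => q.1 ≠ q.2)
      (measurableSet_eq_fun measurable_fst measurable_snd).compl fun a => ?_
    filter_upwards [ae_uniform_mem {a} (countable_singleton a)] with b hb h
    exact hb.2 h.symm
  have h := ae_all_iff.2 fun i => ae_all_iff.2 fun j => ae_all_iff.2 (this i j)
  filter_upwards [h] with u hu i j hij
  by_contra hne
  exact hu i j hne hij

lemma measurableSet_disjoint_points :
    MeasurableSet {q : PointConfig × PointConfig | ∀ i < q.1.size, ∀ j < q.2.size,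
      q.1.pt i ≠ q.2.pt j} := by
  refine measurableSet_setOfPred.2 (.forall fun i => .imp ?_ (.forall fun j => .imp ?_ (.not ?_)))
  · exact measurableSet_setOfPred.1 (measurableSet_lt measurable_const (by fun_prop))
  · exact measurableSet_setOfPred.1 (measurableSet_lt measurable_const (by fun_prop))
  · exact measurableSet_setOfPred.1 (measurableSet_eq_fun (by fun_prop) (by fun_prop))

theorem ae_genericFamily {K : Type*} [Fintype K] {r : ℝ} (hr : 0 < r) (ρ : K → ℝ) {Z : Set ℝ}
    (hZ : Z.Countable) :
    ∀ᵐ c ∂Measure.pi (fun k => poissonProcess (ρ k) r), GenericFamily r Z c := by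
  have := fun k => isProbabilityMeasure_poissonProcess (ρ k) hr
  have h1 : ∀ᵐ c ∂Measure.pi (fun k => poissonProcess (ρ k) r),
      ∀ k i, (c k).2 i ∈ Ioo (-(r / 2)) (r / 2) ∧ (c k).2 i ∉ Z :=
    ae_all_iff.2 fun k => (measurePreserving_eval (fun k => poissonProcess (ρ k) r)
      k).quasiMeasurePreserving.ae (ae_poissonProcess_mem hr Z hZ)
  have h2 : ∀ᵐ c ∂Measure.pi (fun k => poissonProcess (ρ k) r), ∀ k, Function.Injective (c k).2 :=
    ae_all_iff.2 fun k => (measurePreserving_eval (fun k => poissonProcess (ρ k) r)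
      k).quasiMeasurePreserving.ae (ae_poissonProcess_injective hr)
  have h3 : ∀ k k', k ≠ k' → ∀ᵐ c ∂Measure.pi (fun k => poissonProcess (ρ k) r),
      ∀ i < (c k).size, ∀ j < (c k').size, (c k).pt i ≠ (c k').pt j := by
    intro k k' hkk'
    refine ae_pi_pair (fun k => poissonProcess (ρ k) r) hkk'
      (p := fun q => ∀ i < q.1.size, ∀ j < q.2.size, q.1.pt i ≠ q.2.pt j)
      measurableSet_disjoint_points fun a => ?_
    -- With the first configuration frozen, its points form a finite set which the second process
    -- almost surely avoids.
    filter_upwards [ae_poissonProcess_mem hr a.points (finite_range _).countable] with b hb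
    intro i hi j hj h
    have := (hb ⟨j, hj⟩).2
    rw [← b.pt_val, ← h] at this
    exact this ((a.mem_points_iff _).2 ⟨i, hi, rfl⟩)
  have h3' := ae_all_iff.2 fun k => ae_all_iff.2 fun k' => ae_all_iff.2 (h3 k k')
  filter_upwards [h1, h2, h3'] with c hc1 hc2 hc3
  refine ⟨?_, fun k i => (hc1 k i).1, fun k i => (hc1 k i).2⟩
  rintro ⟨k, i⟩ ⟨k', i'⟩ h
  by_cases hk : k = k'
  · subst hk
    rw [hc2 k (a₁ := i) (a₂ := i') h]
  · exfalso
    refine hc3 k k' hk i i.2 i' i'.2 ?_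
    rw [PointConfig.pt_val, PointConfig.pt_val]
    exact h

lemma GenericCopy.of_disjoint {r : ℝ} {A : Finset (SpaceTime d N)} {B : Bond d N → PointConfig}
    {G : Site d N → PointConfig} {Z : Set ℝ}
    (hB : Function.Injective fun q : Σ e, Fin (B e).1 => (B q.1).2 q.2)
    (hG : ∀ x, Function.Injective (G x).2) (hBG : ∀ e i x j, (B e).2 i ≠ (G x).2 j)
    (hBm : ∀ e i, (B e).2 i ∈ Ioo (-(r / 2)) (r / 2)) (hGm : ∀ x i, (G x).2 i ∈ Ioo (-(r / 2)) (r / 2))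
    (hBZ : ∀ e i, (B e).2 i ∉ Z) (hGZ : ∀ x i, (G x).2 i ∉ Z)
    (hA : ∀ p ∈ A, p.2 ∈ Z ∧ p.2 ∈ Ioo (-(r / 2)) (r / 2)) : GenericCopy r A B G where
  inj x := by
    refine Function.Injective.sumElim (Function.Injective.sumElim ?_ ?_ ?_) (hG x) ?_
    · rintro ⟨⟨y, s⟩, hp⟩ ⟨⟨y', s'⟩, hp'⟩ h
      obtain ⟨-, rfl⟩ := Finset.mem_filter.1 hp
      obtain ⟨-, h'⟩ := Finset.mem_filter.1 hp'
      exact Subtype.ext (Prod.ext h'.symm h)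
    · rintro ⟨⟨e, he⟩, i⟩ ⟨⟨e', he'⟩, i'⟩ h
      have := @hB ⟨e, i⟩ ⟨e', i'⟩ h
      obtain ⟨rfl, h2⟩ := Sigma.mk.inj_iff.1 this
      rw [eq_of_heq h2]
    · rintro ⟨p, hp⟩ ⟨e, i⟩ h
      have h' : p.2 = (B e.1).2 i := h
      exact hBZ e.1 i (h' ▸ (hA p (Finset.mem_filter.1 hp).1).1)
    · rintro (⟨p, hp⟩ | ⟨e, i⟩) j h
      · have h' : p.2 = (G x).2 j := h
        exact hGZ x j (h' ▸ (hA p (Finset.mem_filter.1 hp).1).1)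
      · exact hBG e.1 i x j h
  mem x := by
    rintro ((⟨p, hp⟩ | ⟨e, i⟩) | j)
    · exact (hA p (Finset.mem_filter.1 hp).1).2
    · exact hBm e.1 i
    · exact hGm x j

/-- The configuration without points. -/
def emptyConfig : PointConfig := ofVec 0 Fin.elim0

lemma emptyConfig_points : emptyConfig.points = ∅ := by
  simp [emptyConfig, ofVec, PointConfig.points]

section Generic

variable {r : ℝ} {Z : Set ℝ} {ω : Sample d N} (h : GenericFamily r Z ω.config)
include h

lemma GenericFamily.copy₁ {A : Finset (SpaceTime d N)}
    (hA : ∀ p ∈ A, p.2 ∈ Z ∧ p.2 ∈ Ioo (-(r / 2)) (r / 2)) :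
    GenericCopy r A ω.B fun _ => emptyConfig := by
  refine .of_disjoint (Z := Z) ?_ (fun _ i => i.elim0) (fun _ _ _ i => i.elim0)
    (fun e i => h.mem (.inl e) i) (fun _ i => i.elim0) (fun e i => h.avoid (.inl e) i)
    (fun _ i => i.elim0) hA
  rintro ⟨e, i⟩ ⟨e', i'⟩ hi
  have := @h.inj ⟨.inl e, i⟩ ⟨.inl e', i'⟩ hi
  obtain ⟨h1, h2⟩ := Sigma.mk.inj_iff.1 this
  obtain rfl := Sum.inl_injective h1
  rw [eq_of_heq h2]

lemma GenericFamily.copy₂ {A : Finset (SpaceTime d N)}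
    (hA : ∀ p ∈ A, p.2 ∈ Z ∧ p.2 ∈ Ioo (-(r / 2)) (r / 2)) :
    GenericCopy r A ω.Bhat ω.2.1.2 := by
  refine .of_disjoint (Z := Z) ?_ (fun x i j hi => ?_) (fun e i x j hi => ?_)
    (fun e i => h.mem (.inr (.inl (.inl e))) i) (fun x i => h.mem (.inr (.inl (.inr x))) i)
    (fun e i => h.avoid (.inr (.inl (.inl e))) i) (fun x i => h.avoid (.inr (.inl (.inr x))) i) hA
  · rintro ⟨e, i⟩ ⟨e', i'⟩ hi
    have := @h.inj ⟨.inr (.inl (.inl e)), i⟩ ⟨.inr (.inl (.inl e')), i'⟩ hi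
    obtain ⟨h1, h2⟩ := Sigma.mk.inj_iff.1 this
    simp only [Sum.inr.injEq, Sum.inl.injEq] at h1
    subst h1
    rw [eq_of_heq h2]
  · have := @h.inj ⟨.inr (.inl (.inr x)), i⟩ ⟨.inr (.inl (.inr x)), j⟩ hi
    exact eq_of_heq (Sigma.mk.inj_iff.1 this).2
  · have := @h.inj ⟨.inr (.inl (.inl e)), i⟩ ⟨.inr (.inl (.inr x)), j⟩ hi
    simpa using (Sigma.mk.inj_iff.1 this).1

end Generic

lemma isProbabilityMeasure_freeLaw {r : ℝ} (hr : 0 < r) (lam : ℝ) :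
    IsProbabilityMeasure (freeLaw d N r lam) := by
  have := isProbabilityMeasure_poissonProcess lam hr
  unfold freeLaw
  infer_instance

lemma isProbabilityMeasure_wiredLaw {r : ℝ} (hr : 0 < r) (lam : ℝ) :
    IsProbabilityMeasure (wiredLaw d N r lam) := by
  have := fun ρ => isProbabilityMeasure_poissonProcess ρ hr
  have := isProbabilityMeasure_freeLaw (d := d) (N := N) hr lam
  unfold wiredLaw
  infer_instance

lemma isProbabilityMeasure_cutLaw {r : ℝ} (hr : 0 < r) (δ : ℝ) :
    IsProbabilityMeasure (cutLaw d N r δ) := by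
  have := isProbabilityMeasure_poissonProcess (4 * δ) hr
  unfold cutLaw
  infer_instance

lemma isProbabilityMeasure_jointLaw {r : ℝ} (hr : 0 < r) (lam δ : ℝ) :
    IsProbabilityMeasure (jointLaw d N r lam δ) := by
  have := isProbabilityMeasure_freeLaw (d := d) (N := N) hr lam
  have := isProbabilityMeasure_wiredLaw (d := d) (N := N) hr lam
  have := isProbabilityMeasure_cutLaw (d := d) (N := N) hr δ
  unfold jointLaw
  infer_instance

theorem measurePreserving_config {r lam δ : ℝ} (hr : 0 < r) :
    MeasurePreserving (Sample.config (d := d) (N := N)) (jointLaw d N r lam δ)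
      (Measure.pi fun k => poissonProcess (Sum.elim (fun _ => lam) (Sum.elim (Sum.elim (fun _ => lam)
        fun x => lam * outerDegree x) fun _ => 4 * δ) k) r) := by
  have := fun ρ => isProbabilityMeasure_poissonProcess ρ hr
  have hfree : MeasurePreserving Prod.fst (freeLaw d N r lam)
      (Measure.pi fun _ => poissonProcess lam r) := measurePreserving_fst
  have := isProbabilityMeasure_freeLaw (d := d) (N := N) hr lam
  have := isProbabilityMeasure_wiredLaw (d := d) (N := N) hr lam
  have := isProbabilityMeasure_cutLaw (d := d) (N := N) hr δ
  have hwired : MeasurePreserving (Prod.map Prod.fst id) (wiredLaw d N r lam)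
      ((Measure.pi fun _ => poissonProcess lam r).prod
        (Measure.pi fun x : Site d N => poissonProcess (lam * outerDegree x) r)) :=
    hfree.prod (.id _)
  have h1 := hfree.prod (hwired.prod (.id (cutLaw d N r δ)))
  have hs := fun {K K' : Type} [Fintype K] [Fintype K'] (ρ : K ⊕ K' → ℝ) =>
    measurePreserving_sumPiEquivProdPi_symm (fun k => poissonProcess (ρ k) r)
  have h2 := hs (Sum.elim (fun _ : Bond d N => lam) fun x : Site d N => lam * outerDegree x)
  have h3 := hs (Sum.elim (Sum.elim (fun _ : Bond d N => lam)
    fun x : Site d N => lam * outerDegree x) fun _ : Site d N => 4 * δ)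
  have h4 := hs (Sum.elim (fun _ : Bond d N => lam) (Sum.elim (Sum.elim (fun _ : Bond d N => lam)
    fun x : Site d N => lam * outerDegree x) fun _ : Site d N => 4 * δ))
  have h5 := h4.comp (((MeasurePreserving.id _).prod (h3.comp (h2.prod (.id _)))).comp h1)
  exact h5

lemma ae_generic {r lam δ : ℝ} (hr : 0 < r) {Z : Set ℝ} (hZ : Z.Countable) :
    ∀ᵐ ω ∂jointLaw d N r lam δ, GenericFamily r Z ω.config :=
  (measurePreserving_config hr).quasiMeasurePreserving.ae (ae_genericFamily hr _ hZ)

/-! ### Deterministic combinatorics: cut-free paths, the flips they induce, and automatic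
connection. -/

/-! ### Paths that avoid the ghost site -/

/-- One may move from `p` to `q` along a line while avoiding the times in `D`. -/
def Passable (R : Regime) (r : ℝ) (D : Site d N → Set ℝ) (p q : SpaceTime d N) : Prop :=
  p.1 = q.1 ∧
    match R with
    | .groundState => Disjoint (uIcc p.2 q.2) (D p.1)
    | .positiveTemperature =>
        Disjoint (uIcc p.2 q.2) (D p.1) ∨
        Disjoint (Icc (-(r / 2)) (min p.2 q.2) ∪ Icc (max p.2 q.2) (r / 2)) (D p.1)

/-- `p` and `q` are the endpoints of a bridge, the bridges being at the times in `Q`. -/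
def Bridged (Q : Bond d N → Set ℝ) (p q : SpaceTime d N) : Prop :=
  p.2 = q.2 ∧ ∃ e : Bond d N, e.1 = s(p.1, q.1) ∧ p.2 ∈ Q e

/-- There is a path from `p` to `q` crossing `m` bridges. -/
def ReachIn (R : Regime) (r : ℝ) (D : Site d N → Set ℝ) (Q : Bond d N → Set ℝ)
    (p : SpaceTime d N) : ℕ → SpaceTime d N → Prop
  | 0, q => p.2 ∈ timeInterval r ∧ q.2 ∈ timeInterval r ∧ Passable R r D p q
  | m + 1, q => q.2 ∈ timeInterval r ∧
      ∃ y z, ReachIn R r D Q p m y ∧ Bridged Q y z ∧ Passable R r D z q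

/-- There is a path from `p` to `q`. -/
def Reach (R : Regime) (r : ℝ) (D : Site d N → Set ℝ) (Q : Bond d N → Set ℝ)
    (p q : SpaceTime d N) : Prop :=
  ∃ m, ReachIn R r D Q p m q

section Reach

variable {R : Regime} {r : ℝ} {D : Site d N → Set ℝ} {Q : Bond d N → Set ℝ}
  {p q q' : SpaceTime d N} {m : ℕ}

lemma ReachIn.mem (h : ReachIn R r D Q p m q) : q.2 ∈ timeInterval r := by
  cases m with
  | zero => exact h.2.1
  | succ m => exact h.1

lemma reachIn_iff_exists_seq :
    ReachIn R r D Q p m q ↔ ∃ k : ℕ → SpaceTime d N,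
      (∀ i ≤ 2 * m + 1, (k i).2 ∈ timeInterval r) ∧ k 0 = p ∧ k (2 * m + 1) = q ∧
      (∀ j ≤ m, Passable R r D (k (2 * j)) (k (2 * j + 1))) ∧
      ∀ j < m, Bridged Q (k (2 * j + 1)) (k (2 * j + 2)) := by
  induction m generalizing q with
  | zero =>
    constructor
    · rintro ⟨h1, h2, h3⟩
      refine ⟨fun i => if i = 0 then p else q, fun i _ => ?_, by simp, by simp, ?_, by simp⟩
      · dsimp only
        split_ifs
        exacts [h1, h2]
      · intro j hj
        obtain rfl : j = 0 := by omega
        simpa using h3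
    · rintro ⟨k, h1, rfl, rfl, h4, -⟩
      exact ⟨h1 0 (by omega), h1 1 (by omega), h4 0 le_rfl⟩
  | succ m ih =>
    constructor
    · rintro ⟨hq, y, z, hy, hyz, hzq⟩
      have hym := hy.mem
      obtain ⟨k, h1, h2, h3, h4, h5⟩ := ih.1 hy
      refine ⟨fun i => if i ≤ 2 * m + 1 then k i else if i = 2 * m + 2 then z else q,
        fun i hi => ?_, by simpa using h2, ?_, fun j hj => ?_, fun j hj => ?_⟩
      · dsimp only
        split_ifs with h6 h7
        · exact h1 i h6
        · rw [← hyz.1]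
          exact hym
        · exact hq
      · simp only [show ¬ (2 * (m + 1) + 1 ≤ 2 * m + 1) by omega,
          show ¬ (2 * (m + 1) + 1 = 2 * m + 2) by omega, if_false]
      · rcases Nat.lt_or_ge m j with h | h
        · obtain rfl : j = m + 1 := by omega
          have h7 : ¬ (2 * m + 2 ≤ 2 * m + 1) := by omega
          have h8 : ¬ (2 * m + 2 + 1 ≤ 2 * m + 1) := by omega
          have h9 : ¬ (2 * m + 2 + 1 = 2 * m + 2) := by omega
          simp only [Nat.mul_add, Nat.mul_one, h7, h8, h9, if_false, if_true]
          exact hzq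
        · simp only [show 2 * j ≤ 2 * m + 1 by omega, show 2 * j + 1 ≤ 2 * m + 1 by omega, if_true]
          exact h4 j h
      · rcases Nat.lt_or_ge j m with h | h
        · simp only [show 2 * j + 1 ≤ 2 * m + 1 by omega, show 2 * j + 2 ≤ 2 * m + 1 by omega,
            if_true]
          exact h5 j h
        · obtain rfl : j = m := by omega
          simp only [le_refl, show ¬ (2 * j + 2 ≤ 2 * j + 1) by omega, if_false, if_true, h3]
          exact hyz
    · rintro ⟨k, h1, h2, rfl, h4, h5⟩
      refine ⟨h1 _ le_rfl, k (2 * m + 1), k (2 * m + 2), ?_, h5 m (by omega), h4 (m + 1) le_rfl⟩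
      exact ih.2 ⟨k, fun i hi => h1 i (by omega), h2, rfl, fun j hj => h4 j (by omega),
        fun j hj => h5 j (by omega)⟩

lemma Passable.symm (h : Passable R r D p q) : Passable R r D q p := by
  obtain ⟨h1, h2⟩ := h
  refine ⟨h1.symm, ?_⟩
  rw [← h1]
  cases R <;> simpa only [uIcc_comm, min_comm, max_comm] using h2

lemma Bridged.symm (h : Bridged Q p q) : Bridged Q q p := by
  obtain ⟨h1, e, h2, h3⟩ := h
  exact ⟨h1.symm, e, by rw [h2, Sym2.eq_swap], h1 ▸ h3⟩

/-- On a circle, two direct or two complementary arcs give the direct arc between the outer times;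
one of each gives the complementary arc. -/
lemma Passable.trans (hp : p.2 ∈ timeInterval r) (hq' : q'.2 ∈ timeInterval r)
    (h : Passable R r D p q) (h' : Passable R r D q q') : Passable R r D p q' := by
  obtain ⟨x, s⟩ := p
  obtain ⟨y, t⟩ := q
  obtain ⟨z, u⟩ := q'
  obtain ⟨h1, h2⟩ := h
  obtain ⟨h1', h2'⟩ := h'
  dsimp only at h1 h1' hp hq'
  subst h1 h1'
  refine ⟨rfl, ?_⟩
  cases R
  · simp only [Set.disjoint_left, mem_union, mem_Icc, mem_uIcc, timeInterval] at h2 h2' hp hq' ⊢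
    rcases h2 with h2 | h2 <;> rcases h2' with h2' | h2'
    · left
      intro w hw hD
      replace h2 := h2 (a := w)
      replace h2' := h2' (a := w)
      grind
    · right
      intro w hw hD
      replace h2 := h2 (a := w)
      replace h2' := h2' (a := w)
      grind
    · right
      intro w hw hD
      replace h2 := h2 (a := w)
      replace h2' := h2' (a := w)
      grind
    · left
      intro w hw hD
      replace h2 := h2 (a := w)
      replace h2' := h2' (a := w)
      grind
  · exact (h2.union_left h2').mono_left uIcc_subset_uIcc_union_uIcc

lemma Reach.passable (h : Reach R r D Q p q) (h' : Passable R r D q q')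
    (hq' : q'.2 ∈ timeInterval r) : Reach R r D Q p q' := by
  obtain ⟨m, h⟩ := h
  refine ⟨m, ?_⟩
  cases m with
  | zero => exact ⟨h.1, hq', h.2.2.trans h.1 hq' h'⟩
  | succ m =>
    obtain ⟨-, y, z, h1, h2, h3⟩ := h
    exact ⟨hq', y, z, h1, h2, h3.trans (h2.1 ▸ h1.mem) hq' h'⟩

lemma passable_self (h : p.2 ∉ D p.1) : Passable R r D p p := by
  refine ⟨rfl, ?_⟩
  have : Disjoint (uIcc p.2 p.2) (D p.1) := by simpa using h
  cases R
  · exact Or.inl this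
  · exact this

/-- A path must end with a move along a line, possibly trivial; as blocking intervals are closed,
the trivial move requires that the landing point is not in `D`. -/
lemma Reach.bridged (h : Reach R r D Q p q) (h' : Bridged Q q q') (hq' : q'.2 ∉ D q'.1) :
    Reach R r D Q p q' := by
  obtain ⟨m, h⟩ := h
  exact ⟨m + 1, h'.1 ▸ h.mem, q, q', h, h', passable_self hq'⟩

end Reach

/-! ### Flips along paths -/

/-- The contribution of a source at `p` to the parities. -/
def source (p : SpaceTime d N) (x : Site d N) (u : ℝ) : ZMod 2 :=
  if p.1 = x then below u p.2 else 0

/-- The change of the parities when the marks `T` of the bridges are flipped and sources are added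
at `p` and `q`. -/
def flipParity (Q : Bond d N → PointConfig) (T : Bond d N → ℕ → Bool) (p q : SpaceTime d N)
    (x : Site d N) (u : ℝ) : ZMod 2 :=
  source p x u + source q x u + parity ∅ (fun e => (Q e).select (T e)) (fun _ => emptyConfig) x u

lemma emptyConfig_sum {M : Type*} [AddCommMonoid M] (g : ℝ → M) : emptyConfig.sum g = 0 :=
  Finset.sum_of_isEmpty (ι := Fin 0) _

lemma select_sum {M : Type*} [AddCommMonoid M] (c : PointConfig) (m : ℕ → Bool) (g : ℝ → M) :
    (c.select m).sum g = ∑ i : Fin c.1, if m i = true then g (c.2 i) else 0 :=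
  selectFin_sum _ _ _

lemma select_sum_xor (c : PointConfig) (m m' : ℕ → Bool) (g : ℝ → ZMod 2) :
    (c.select fun i => xor (m i) (m' i)).sum g = (c.select m).sum g + (c.select m').sum g := by
  simp only [select_sum, ← Finset.sum_add_distrib]
  refine Finset.sum_congr rfl fun i _ => ?_
  cases m i <;> cases m' i <;> simp [CharTwo.add_self_eq_zero]

lemma parity_empty (B : Bond d N → PointConfig) (x : Site d N) (u : ℝ) :
    parity ∅ B (fun _ => emptyConfig) x u = ∑ e, if x ∈ e.1 then (B e).sum (below u) else 0 := by
  simp [parity, lineSum, emptyConfig_sum]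

/-- The source at the intermediate point `q` occurs twice and cancels, which makes flips composable
along a path. -/
lemma flipParity_add (Q : Bond d N → PointConfig) (T T' : Bond d N → ℕ → Bool)
    (p q q' : SpaceTime d N) (x : Site d N) (u : ℝ) :
    flipParity Q (fun e i => xor (T e i) (T' e i)) p q' x u =
      flipParity Q T p q x u + flipParity Q T' q q' x u := by
  have h : parity ∅ (fun e => (Q e).select fun i => xor (T e i) (T' e i))
      (fun _ => emptyConfig) x u = parity ∅ (fun e => (Q e).select (T e)) (fun _ => emptyConfig) x u +
      parity ∅ (fun e => (Q e).select (T' e)) (fun _ => emptyConfig) x u := by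
    simp only [parity_empty, select_sum_xor, ← Finset.sum_add_distrib]
    refine Finset.sum_congr rfl fun e _ => ?_
    split_ifs <;> simp
  unfold flipParity
  rw [h]
  have := CharTwo.add_self_eq_zero (source q x u)
  linear_combination -this

lemma toNat_xor_cast (a b : Bool) :
    ((xor a b).toNat : ZMod 2) = (a.toNat : ZMod 2) + (b.toNat : ZMod 2) := by
  cases a <;> cases b <;> decide

lemma label_bc₁_add (R : Regime) (c c' : Site d N → Bool) (σ σ' : Site d N → ℝ → ZMod 2)
    (x : Site d N) (u : ℝ) :
    label R.bc₁ (fun x => xor (c x) (c' x)) (fun x u => σ x u + σ' x u) x u =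
      label R.bc₁ c σ x u + label R.bc₁ c' σ' x u := by
  cases R <;> simp only [Regime.bc₁, label]
  rw [toNat_xor_cast]
  ring

/-- Flipping the marks of some bridges between `Q` and some coins moves sources at `p` and `q`
from one copy to the other, without changing the labels in `D`. -/
def Linked (R : Regime) (r : ℝ) (D : Site d N → Set ℝ) (Q : Bond d N → PointConfig)
    (p q : SpaceTime d N) : Prop :=
  ∃ (T : Bond d N → ℕ → Bool) (c : Site d N → Bool),
    (∀ x, flipParity Q T p q x (r / 2) = 0) ∧
    ∀ x, ∀ u ∈ D x, label R.bc₁ c (flipParity Q T p q) x u = 0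

section Linked

variable {R : Regime} {r : ℝ} {D : Site d N → Set ℝ} {Q : Bond d N → PointConfig}
  {p q q' : SpaceTime d N}

lemma Linked.trans (h : Linked R r D Q p q) (h' : Linked R r D Q q q') :
    Linked R r D Q p q' := by
  obtain ⟨T, c, h1, h2⟩ := h
  obtain ⟨T', c', h1', h2'⟩ := h'
  refine ⟨fun e i => xor (T e i) (T' e i), fun x => xor (c x) (c' x), fun x => ?_, fun x u hu => ?_⟩
  · rw [flipParity_add Q T T' p q q', h1, h1', add_zero]
  · have : flipParity Q (fun e i => xor (T e i) (T' e i)) p q' =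
        fun x u => flipParity Q T p q x u + flipParity Q T' q q' x u := by
      funext x u
      exact flipParity_add Q T T' p q q' x u
    rw [this, label_bc₁_add, h2 x u hu, h2' x u hu, add_zero]

lemma flipParity_false (x : Site d N) (u : ℝ) :
    flipParity Q (fun _ _ => false) p q x u = source p x u + source q x u := by
  simp [flipParity, parity_empty, select_sum]

/-- No mark is flipped: two sources on one line change the labels on one of the pieces into which
they cut it. On an interval with free ends this is the piece between them; on a circle the coin
selects the arc, and the arc avoiding `D` is taken. -/
lemma Linked.of_passable (hD : ∀ x, D x ⊆ timeInterval r) (hp : p.2 ∈ timeInterval r)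
    (hq : q.2 ∈ timeInterval r) (h : Passable R r D p q) : Linked R r D Q p q := by
  obtain ⟨x, s⟩ := p
  obtain ⟨y, t⟩ := q
  obtain ⟨h1, h2⟩ := h
  dsimp only at h1 h2 hp hq
  subst h1
  have h0 : ∀ z, flipParity Q (fun _ _ => false) (x, s) (x, t) z (r / 2) = 0 := by
    intro z
    rw [flipParity_false]
    simp only [source, below, hp.2, hq.2, if_true]
    exact CharTwo.add_self_eq_zero _
  have hne : ∀ z, z ≠ x → ∀ u, flipParity Q (fun _ _ => false) (x, s) (x, t) z u = 0 := by
    intro z hz u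
    rw [flipParity_false]
    simp [source, hz.symm]
  have heq : ∀ u, flipParity Q (fun _ _ => false) (x, s) (x, t) x u = below u s + below u t := by
    intro u
    rw [flipParity_false]
    simp [source]
  have hin : ∀ u, u ∉ uIcc s t → below u s + below u t = 0 := by
    intro u hu
    simp only [below, mem_uIcc] at hu ⊢
    split_ifs <;> first | rfl | (exfalso; grind)
  cases R
  · rcases h2 with h2 | h2
    -- The coin cancels the parity at time `0`, so the change of label is `below u s + below u t`,
    -- which vanishes off the direct arc.
    · refine ⟨fun _ _ => false, fun z => decide (z = x) && decide (below 0 s + below 0 t = 1), h0,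
        fun z u hu => ?_⟩
      simp only [Regime.bc₁, label]
      by_cases hz : z = x
      · subst hz
        rw [heq, heq, hin u fun h => Set.disjoint_left.1 h2 h hu, add_zero]
        rw [decide_eq_true (rfl : z = z), Bool.true_and]
        generalize below 0 s + below 0 t = w
        clear * -
        revert w
        decide
      · rw [hne z hz, hne z hz]
        simp [hz]
    -- The opposite coin adds `1`: the change of label now vanishes between the two times, which is
    -- where `D` lies.
    · refine ⟨fun _ _ => false, fun z => decide (z = x) && decide (below 0 s + below 0 t = 0), h0,
        fun z u hu => ?_⟩
      simp only [Regime.bc₁, label]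
      by_cases hz : z = x
      · subst hz
        have hu' : below u s + below u t = 1 := by
          have h3 := hD z hu
          have h4 : ¬ _ := fun h => Set.disjoint_left.1 h2 h hu
          simp only [mem_union, mem_Icc, timeInterval, below] at h3 h4 ⊢
          split_ifs <;> first | rfl | (exfalso; grind)
        rw [heq, heq, hu']
        rw [decide_eq_true (rfl : z = z), Bool.true_and]
        generalize below 0 s + below 0 t = w
        clear * -
        revert w
        decide
      · rw [hne z hz, hne z hz]
        simp [hz]
  · refine ⟨fun _ _ => false, fun _ => false, h0, fun z u hu => ?_⟩
    simp only [Regime.bc₁, label]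
    by_cases hz : z = x
    · subst hz
      rw [heq, hin u fun h => Set.disjoint_left.1 h2 h hu]
    · exact hne z hz u

lemma Bond.ne {e : Bond d N} {y z : Site d N} (h : e.1 = s(y, z)) : y ≠ z := by
  have := e.2
  rw [h, SimpleGraph.mem_edgeSet] at this
  exact this.ne

/-- Toggling the mark of the crossed bridge alone switches both lines at time `t`, exactly undoing
the two sources; no label changes anywhere. -/
lemma Linked.of_bridged (h : Bridged (fun e => (Q e).points) p q) : Linked R r D Q p q := by
  classical
  obtain ⟨y, t⟩ := p
  obtain ⟨z, t'⟩ := q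
  obtain ⟨h1, e, he, i, hi⟩ := h
  dsimp only at h1 hi he
  subst h1
  have h0 : ∀ x u, flipParity Q (fun e' j => decide (e' = e ∧ j = i)) (y, t) (z, t) x u = 0 := by
    intro x u
    rw [flipParity, parity_empty, Finset.sum_eq_single e]
    · have h2 : ((Q e).select fun j => decide (e = e ∧ j = i)).sum (below u) = below u t := by
        rw [select_sum, Finset.sum_eq_single i]
        · simp [hi]
        · intro j _ hj
          simp [Fin.val_eq_val, hj]
        · simp
      rw [h2, he]
      have hyz := Bond.ne he
      have h3 := CharTwo.add_self_eq_zero (below u t)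
      simp only [source, Sym2.mem_iff]
      by_cases hy : y = x
      · subst hy
        simp [hyz.symm, h3]
      · by_cases hz : z = x
        · subst hz
          simp [hyz, h3]
        · simp [hy, hz, Ne.symm hy, Ne.symm hz]
    · intro e' _ he'
      simp [select_sum, he']
    · simp
  refine ⟨_, fun _ => false, fun x => h0 x _, fun x u _ => ?_⟩
  cases R
  · simp only [Regime.bc₁, label, h0]
    simp
  · exact h0 x u

lemma Linked.of_reach (hD : ∀ x, D x ⊆ timeInterval r)
    (h : Reach R r D (fun e => (Q e).points) p q) : Linked R r D Q p q := by
  obtain ⟨m, h⟩ := h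
  induction m generalizing q with
  | zero => exact .of_passable hD h.1 h.2.1 h.2.2
  | succ m ih =>
    obtain ⟨hq, y, z, h1, h2, h3⟩ := h
    exact ((ih h1).trans (.of_bridged h2)).trans (.of_passable hD (h2.1 ▸ h1.mem) hq h3)

end Linked

/-! ### Sources of one copy are connected -/

/-- With `b` the label at `a`, the switching points in `F` are the ends of the odd segments. The two
ends of an odd segment have equal `f` and cancel. What remains is an end at `a` if the first label
is odd, and an end at `v` if the last one is. The right end `w` is restricted to `F` or `v` because
these are the points known to avoid the cuts. -/
lemma sum_eq_of_locally_constant (a : ℝ) (b : ZMod 2) (f : ℝ → ZMod 2) (F : Finset ℝ) (v : ℝ)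
    (hav : a ≤ v) (hF : ∀ s ∈ F, a ≤ s ∧ s ≤ v)
    (hf : ∀ u w, a ≤ u → u ≤ w → w ≤ v → (w ∈ F ∨ w = v) →
      (∀ t ∈ Ico u w, b + ∑ s ∈ F, below t s = 1) → f u = f w) :
    ∑ s ∈ F, f s = b * f a + (b + F.card) * f v := by
  have hcases : ∀ z : ZMod 2, z = 0 ∨ z = 1 := by decide
  induction F using Finset.induction_on_max generalizing v with
  | empty =>
    rcases hcases b with rfl | rfl
    · simp
    · have := hf a v le_rfl hav le_rfl (Or.inr rfl) (by simp)
      simp [this, CharTwo.add_self_eq_zero]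
  | insert m F hm ih =>
    have hmF : m ∉ F := fun h => lt_irrefl _ (hm m h)
    have hmv := hF m (Finset.mem_insert_self _ _)
    have h1 := ih m hmv.1
      (fun s hs => ⟨(hF s (Finset.mem_insert_of_mem hs)).1, (hm s hs).le⟩) (by
        intro u w hau huw hwm hw ht
        refine hf u w hau huw (hwm.trans hmv.2) (Or.inl ?_) fun t htt => ?_
        · rcases hw with hw | rfl
          · exact Finset.mem_insert_of_mem hw
          · exact Finset.mem_insert_self _ _
        · have : below t m = 0 := by simp [below, htt.2.trans_le hwm]
          rw [Finset.sum_insert hmF, this, zero_add]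
          exact ht t htt)
    rw [Finset.sum_insert hmF, h1, Finset.card_insert_of_notMem hmF]
    -- The coefficient is the label on the last stretch `[m, v)`; when it is `1`, `f` agrees at the
    -- two ends.
    have h2 : (b + ((F.card + 1 : ℕ) : ZMod 2)) * f m = (b + ((F.card + 1 : ℕ) : ZMod 2)) * f v := by
      rcases hcases (b + ((F.card + 1 : ℕ) : ZMod 2)) with h | h
      · rw [h, zero_mul, zero_mul]
      · congr 1
        refine hf m v hmv.1 hmv.2 le_rfl (Or.inr rfl) fun t ht => ?_
        rw [← h, ← Finset.card_insert_of_notMem hmF, Finset.card_eq_sum_ones, Nat.cast_sum]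
        congr 1
        refine Finset.sum_congr rfl fun s hs => ?_
        have : s ≤ t := by
          rcases Finset.mem_insert.1 hs with rfl | hs
          · exact ht.1
          · exact (hm s hs).le.trans ht.1
        simp [below, this]
    rw [← h2]
    push_cast
    ring

section AutoConnect

variable {R : Regime} {r : ℝ} {D : Site d N → Set ℝ} {Q : Bond d N → Set ℝ}
  {B : Bond d N → PointConfig} {A : Finset (SpaceTime d N)} {τ : Site d N → Bool}

/-- An even number of switches makes the labels at the two ends of the line equal, so the boundary
terms left by the cancellation also pair up. -/
lemma sum_line_eq_zero (hr : 0 < r) (hg : GenericCopy r A B fun _ => emptyConfig)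
    (hD : ∀ x, D x ⊆ Ioo (-(r / 2)) (r / 2))
    (hDS : ∀ x, Disjoint (D x) (switchingPoints ↑A B (fun _ => emptyConfig.points) x))
    (hcons : ∀ x, parity A B (fun _ => emptyConfig) x (r / 2) = 0)
    (heven : ∀ x, ∀ u ∈ D x, label R.bc₁ τ (parity A B fun _ => emptyConfig) x u = 0)
    (f : SpaceTime d N → ZMod 2)
    (hf : ∀ p q, p.2 ∈ timeInterval r → q.2 ∈ timeInterval r → Passable R r D p q → f p = f q)
    (x : Site d N) : lineSum A B (fun _ => emptyConfig) x (fun t => f (x, t)) = 0 := by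
  have hrr : -(r / 2) ≤ r / 2 := by linarith
  set F := (finite_switchingPoints (A := A) (B := B) (G := fun _ => emptyConfig) x).toFinset with hF
  have hFm : ∀ s ∈ F, s ∈ Ioo (-(r / 2)) (r / 2) := by
    intro s hs
    exact hg.mem_Ioo ((Finite.mem_toFinset _).1 hs)
  have hpar : ∀ t, ∑ s ∈ F, below t s = parity A B (fun _ => emptyConfig) x t := fun t =>
    hg.sum_eq x (below t)
  -- `b` is the label at the bottom of the line. The boundary terms vanish because `b = 0` for free
  -- ends, or because the two ends are one point of the circle.
  obtain ⟨b, hb, hb'⟩ : ∃ b : ZMod 2,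
      (∀ u, label R.bc₁ τ (parity A B fun _ => emptyConfig) x u =
        b + parity A B (fun _ => emptyConfig) x u) ∧
      b * (f (x, -(r / 2)) + f (x, r / 2)) = 0 := by
    cases R
    · refine ⟨_, fun u => rfl, ?_⟩
      rw [hf (x, -(r / 2)) (x, r / 2) ⟨le_rfl, hrr⟩ ⟨hrr, le_rfl⟩, CharTwo.add_self_eq_zero,
        mul_zero]
      refine ⟨rfl, Or.inr (Set.disjoint_left.2 fun w hw hwD => ?_)⟩
      have := hD x hwD
      simp only [min_eq_left hrr, max_eq_right hrr, Icc_self, mem_union, mem_singleton_iff,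
        mem_Ioo] at hw this
      rcases hw with rfl | rfl
      · exact lt_irrefl _ this.1
      · exact lt_irrefl _ this.2
    · exact ⟨0, fun u => by simp [Regime.bc₁, label], by simp⟩
  have hcard : (F.card : ZMod 2) = 0 := by
    rw [← hcons x, ← hpar, Finset.card_eq_sum_ones, Nat.cast_sum]
    refine Finset.sum_congr rfl fun s hs => ?_
    simp [below, (hFm s hs).2.le]
  rw [← hg.sum_eq, sum_eq_of_locally_constant (-(r / 2)) b (fun t => f (x, t)) F (r / 2) hrr
    (fun s hs => ⟨(hFm s hs).1.le, (hFm s hs).2.le⟩), hcard, add_zero, ← mul_add, hb']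
  intro u w hau huw hwv hw ht
  refine hf (x, u) (x, w) ⟨hau, huw.trans hwv⟩ ⟨hau.trans huw, hwv⟩ ?_
  -- Points of `D` are even while `[u, w)` is odd; the endpoint `w` is a switching point or the end
  -- `r / 2`, neither of which lies in `D`.
  have hdisj : Disjoint (uIcc u w) (D x) := by
    rw [uIcc_of_le huw]
    refine Set.disjoint_left.2 fun t htt htD => ?_
    rcases eq_or_lt_of_le htt.2 with rfl | hlt
    · rcases hw with hw | rfl
      · exact Set.disjoint_left.1 (hDS x) htD ((Finite.mem_toFinset _).1 hw)
      · exact lt_irrefl _ (hD x htD).2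
    · have h1 := ht t ⟨htt.1, hlt⟩
      rw [hpar, ← hb, heven x t htD] at h1
      exact zero_ne_one h1
  refine ⟨rfl, ?_⟩
  cases R
  · exact Or.inl hdisj
  · exact hdisj

/-- If no point of `D` is labelled odd, the two sources are connected by a path avoiding `D`. -/
theorem reach_of_sources (hr : 0 < r) {p q : SpaceTime d N} (hpq : p ≠ q)
    (hg : GenericCopy r {p, q} B fun _ => emptyConfig)
    (hD : ∀ x, D x ⊆ Ioo (-(r / 2)) (r / 2))
    (hDS : ∀ x, Disjoint (D x) (switchingPoints ↑({p, q} : Finset (SpaceTime d N)) B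
      (fun _ => emptyConfig.points) x))
    (hBQ : ∀ e, (B e).points ⊆ Q e)
    (hcons : ∀ x, parity {p, q} B (fun _ => emptyConfig) x (r / 2) = 0)
    (heven : ∀ x, ∀ u ∈ D x, label R.bc₁ τ (parity {p, q} B fun _ => emptyConfig) x u = 0) :
    Reach R r D Q p q := by
  classical
  have hS : ∀ {y : Site d N} {t}, t ∈ switchingPoints ↑({p, q} : Finset (SpaceTime d N)) B
      (fun _ => emptyConfig.points) y → t ∉ D y :=
    fun {y t} ht htD => Set.disjoint_left.1 (hDS y) htD ht
  set f : SpaceTime d N → ZMod 2 := fun z => if Reach R r D Q p z then 1 else 0 with hf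
  have h1 := sum_line_eq_zero (R := R) (τ := τ) hr hg hD hDS hcons heven f (by
    intro y z hy hz hyz
    have : Reach R r D Q p y ↔ Reach R r D Q p z :=
      ⟨fun h => h.passable hyz hz, fun h => h.passable hyz.symm hy⟩
    simp only [hf, this])
  -- Each bridge is counted on both its lines with equal values of `f`, so only the sources survive.
  have h2 : ∑ x, lineSum {p, q} B (fun _ => emptyConfig) x (fun t => f (x, t)) = f p + f q := by
    simp only [lineSum, emptyConfig_sum, add_zero, Finset.sum_add_distrib]
    rw [Finset.sum_comm, Finset.sum_comm (s := Finset.univ) (t := (Finset.univ : Finset (Bond d N)))]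
    have h3 : ∀ e : Bond d N, ∑ x, (if x ∈ e.1 then (B e).sum fun t => f (x, t) else 0) = 0 := by
      intro e
      obtain ⟨y, z, hyz⟩ : ∃ y z, e.1 = s(y, z) := by
        induction h : e.1 with
        | _ y z => exact ⟨y, z, rfl⟩
      have hne := Bond.ne hyz
      have hye : y ∈ e.1 := by simp [hyz]
      have hze : z ∈ e.1 := by simp [hyz]
      rw [← Finset.sum_filter]
      have : (Finset.univ.filter fun x => x ∈ e.1) = {y, z} := by
        ext x
        simp [hyz]
      rw [this, Finset.sum_pair hne]
      unfold PointConfig.sum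
      rw [← Finset.sum_add_distrib]
      refine Finset.sum_eq_zero fun i _ => ?_
      have hbr : Bridged Q (y, (B e).2 i) (z, (B e).2 i) := ⟨rfl, e, hyz, hBQ e ⟨i, rfl⟩⟩
      have hiff : Reach R r D Q p (y, (B e).2 i) ↔ Reach R r D Q p (z, (B e).2 i) :=
        ⟨fun h => h.bridged hbr (hS (Or.inl (Or.inr ⟨e, hze, i, rfl⟩))),
          fun h => h.bridged hbr.symm (hS (Or.inl (Or.inr ⟨e, hye, i, rfl⟩)))⟩
      simp only [hf, hiff]
      exact CharTwo.add_self_eq_zero _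
    rw [Finset.sum_eq_zero fun e _ => h3 e, add_zero]
    have h4 : ∀ a : SpaceTime d N, ∑ x, (if a.1 = x then f (x, a.2) else 0) = f a := by
      intro a
      rw [Finset.sum_ite_eq]
      simp
    rw [Finset.sum_congr rfl fun a _ => h4 a, Finset.sum_pair hpq]
  rw [Finset.sum_eq_zero fun x _ => h1 x] at h2
  have hp : Reach R r D Q p p := by
    have hpm : p.2 ∈ switchingPoints ↑({p, q} : Finset (SpaceTime d N)) B
        (fun _ => emptyConfig.points) p.1 := Or.inl (Or.inl (by simp))
    have hpI : p.2 ∈ timeInterval r := Ioo_subset_Icc_self (hg.mem_Ioo hpm)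
    exact ⟨0, hpI, hpI, passable_self (hS hpm)⟩
  by_contra hq
  simp [hf, hp, hq] at h2

end AutoConnect

/-! ### Measurability of events and weights, and absorption of weights into the cuts. -/

/-! ### Measurability of connection events -/

section Measurability

variable {Ω : Type*} [MeasurableSpace Ω]

lemma measurable_mem_Icc {f g h : Ω → ℝ} (hf : Measurable f) (hg : Measurable g)
    (hh : Measurable h) : Measurable fun ω => f ω ∈ Icc (g ω) (h ω) :=
  (measurableSet_setOfPred.1 (measurableSet_le hg hf)).and
    (measurableSet_setOfPred.1 (measurableSet_le hf hh))

/-- A random set of times that is measurably enumerated by `s`, where `act` tells which elements of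
the enumeration are used. -/
structure Enumerated (D : Ω → Set ℝ) (act : ℕ → Ω → Prop) (s : ℕ → Ω → ℝ) : Prop where
  measurable_act : ∀ i, Measurable (act i)
  measurable_time : ∀ i, Measurable (s i)
  mem_iff : ∀ ω t, t ∈ D ω ↔ ∃ i, act i ω ∧ s i ω = t

lemma measurable_disjoint {D : Ω → Set ℝ} {act : ℕ → Ω → Prop} {s : ℕ → Ω → ℝ}
    (hD : Enumerated D act s) {W : Ω → Set ℝ}
    (hW : ∀ i, Measurable fun ω => s i ω ∈ W ω) : Measurable fun ω => Disjoint (W ω) (D ω) := by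
  have : (fun ω => Disjoint (W ω) (D ω)) = fun ω => ∀ i, act i ω → ¬ s i ω ∈ W ω := by
    funext ω
    refine propext ?_
    rw [Set.disjoint_left]
    constructor
    · intro h i hi hs
      exact h hs ((hD.mem_iff ω _).2 ⟨i, hi, rfl⟩)
    · intro h t ht htD
      obtain ⟨i, hi, rfl⟩ := (hD.mem_iff ω _).1 htD
      exact h i hi ht
  rw [this]
  exact .forall fun i => (hD.measurable_act i).imp (hW i).not

variable {R : Regime} {r : ℝ} {D : Ω → Site d N → Set ℝ} {act : Site d N → ℕ → Ω → Prop}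
  {s : Site d N → ℕ → Ω → ℝ} {Q : Ω → Bond d N → Set ℝ} {act' : Bond d N → ℕ → Ω → Prop}
  {s' : Bond d N → ℕ → Ω → ℝ}

lemma measurable_passable (hD : ∀ x, Enumerated (fun ω => D ω x) (act x) (s x)) (x : Site d N)
    {f g : Ω → ℝ} (hf : Measurable f) (hg : Measurable g) :
    Measurable fun ω => Passable R r (D ω) (x, f ω) (x, g ω) := by
  have h1 : Measurable fun ω => Disjoint (uIcc (f ω) (g ω)) (D ω x) :=
    measurable_disjoint (hD x) fun i =>
      measurable_mem_Icc ((hD x).measurable_time i) (hf.min hg) (hf.max hg)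
  cases R
  · have h2 : Measurable fun ω => Disjoint
        (Icc (-(r / 2)) (min (f ω) (g ω)) ∪ Icc (max (f ω) (g ω)) (r / 2)) (D ω x) :=
      measurable_disjoint (hD x) fun i =>
        (measurable_mem_Icc ((hD x).measurable_time i) measurable_const (hf.min hg)).or
          (measurable_mem_Icc ((hD x).measurable_time i) (hf.max hg) measurable_const)
    simpa only [Passable, true_and] using h1.or h2
  · simpa only [Passable, true_and] using h1

/-- Jumps occur only at bridge times, so the existential over paths reduces to a countable one. The
endpoint is allowed to be random because the induction passes through bridge times. -/
lemma measurable_reachIn (hD : ∀ x, Enumerated (fun ω => D ω x) (act x) (s x))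
    (hQ : ∀ e, Enumerated (fun ω => Q ω e) (act' e) (s' e)) (p : SpaceTime d N) (m : ℕ)
    (x : Site d N) {f : Ω → ℝ} (hf : Measurable f) :
    Measurable fun ω => ReachIn R r (D ω) (Q ω) p m (x, f ω) := by
  have hI : ∀ {f : Ω → ℝ}, Measurable f → Measurable fun ω => f ω ∈ timeInterval r :=
    fun hf => measurable_mem_Icc hf measurable_const measurable_const
  induction m generalizing x f with
  | zero =>
    refine (hI measurable_const).and ((hI hf).and ?_)
    by_cases hx : p.1 = x
    · subst hx
      exact measurable_passable hD p.1 measurable_const hf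
    · have : (fun ω => Passable R r (D ω) p (x, f ω)) = fun _ => False := by
        funext ω
        simp [Passable, hx]
      rw [this]
      exact measurable_const
  | succ m ih =>
    refine (hI hf).and ?_
    have : (fun ω => ∃ y z, ReachIn R r (D ω) (Q ω) p m y ∧ Bridged (Q ω) y z ∧
        Passable R r (D ω) z (x, f ω)) = fun ω => ∃ (y : Site d N) (e : Bond d N) (i : ℕ),
          e.1 = s(y, x) ∧ act' e i ω ∧ ReachIn R r (D ω) (Q ω) p m (y, s' e i ω) ∧
          Passable R r (D ω) (x, s' e i ω) (x, f ω) := by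
      funext ω
      refine propext ⟨?_, ?_⟩
      · rintro ⟨⟨y, t⟩, ⟨z, t'⟩, h1, ⟨h2, e, he, ht⟩, h3⟩
        obtain ⟨i, hi, hi'⟩ := ((hQ e).mem_iff ω _).1 ht
        obtain rfl : z = x := h3.1
        dsimp only at h2 hi'
        subst h2 hi'
        exact ⟨y, e, i, he, hi, h1, h3⟩
      · rintro ⟨y, e, i, he, hi, h1, h3⟩
        exact ⟨(y, s' e i ω), (x, s' e i ω), h1, ⟨rfl, e, he, ((hQ e).mem_iff ω _).2 ⟨i, hi, rfl⟩⟩, h3⟩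
    rw [this]
    exact .exists fun y => .exists fun e => .exists fun i => measurable_const.and
      (((hQ e).measurable_act i).and ((ih y ((hQ e).measurable_time i)).and
        (measurable_passable hD x ((hQ e).measurable_time i) hf)))

lemma measurable_reach (hD : ∀ x, Enumerated (fun ω => D ω x) (act x) (s x))
    (hQ : ∀ e, Enumerated (fun ω => Q ω e) (act' e) (s' e)) (p q : SpaceTime d N) :
    Measurable fun ω => Reach R r (D ω) (Q ω) p q :=
  .exists fun m => measurable_reachIn hD hQ p m q.1 (measurable_const (a := q.2))

end Measurability

/-! ### Weights -/

open Classical in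
/-- The product of the weights of two labellings `l₁` and `l₂` with final parities `e₁`, `e₂`. -/
def pairWeight (r δ : ℝ) (e₁ e₂ : Site d N → ZMod 2) (l₁ l₂ : Site d N → ℝ → ZMod 2) : ℝ≥0∞ :=
  if (∀ x, e₁ x = 0) ∧ ∀ x, e₂ x = 0 then
    ENNReal.ofReal (Real.exp (2 * δ * ∑ x, (volume.real {u ∈ timeInterval r | l₁ x u = 0} +
      volume.real {u ∈ timeInterval r | l₂ x u = 0})))
  else 0

open Classical in
/-- The weight that remains after removing the contribution of the times that are even in both
labellings. -/
def reducedWeight (r δ : ℝ) (e₁ e₂ : Site d N → ZMod 2) (l₁ l₂ : Site d N → ℝ → ZMod 2) : ℝ≥0∞ :=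
  if (∀ x, e₁ x = 0) ∧ ∀ x, e₂ x = 0 then
    ENNReal.ofReal (Real.exp (2 * δ * ∑ x, volume.real {u ∈ timeInterval r | l₁ x u ≠ l₂ x u}))
  else 0

/-- The times that are even in both labellings. -/
def bothEven (l₁ l₂ : Site d N → ℝ → ZMod 2) (x : Site d N) : Set ℝ :=
  {u | l₁ x u = 0 ∧ l₂ x u = 0}

section Thinning

variable {r δ : ℝ}

lemma cutLaw_map_filter (hr : 0 < r) (hδ : 0 < δ) {E : Site d N → Set ℝ}
    (hE : ∀ x, MeasurableSet (E x)) :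
    (cutLaw d N r δ).map (fun Δ x => (Δ x).filter (E x)) =
      ENNReal.ofReal (Real.exp (4 * δ * ∑ x, volume.real (timeInterval r \ E x))) •
        (cutLaw d N r δ).restrict (Set.pi univ fun x => {c | c.points ⊆ E x}) := by
  have := isProbabilityMeasure_poissonProcess (4 * δ) hr
  have hfm := fun x => measurable_filter (hE x)
  have hp : ∀ x, IsProbabilityMeasure ((poissonProcess (4 * δ) r).map (PointConfig.filter (E x))) :=
    fun x => Measure.isProbabilityMeasure_map (hfm x).aemeasurable
  unfold cutLaw
  rw [Measure.pi_map_pi (f := fun x => PointConfig.filter (E x)) fun x => (hfm x).aemeasurable]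
  refine Measure.pi_eq fun S hS => ?_
  rw [Measure.smul_apply, Measure.restrict_apply (MeasurableSet.univ_pi hS), ← pi_inter_distrib,
    Measure.pi_pi, smul_eq_mul, Finset.mul_sum, Real.exp_sum,
    ENNReal.ofReal_prod_of_nonneg fun x _ => (Real.exp_pos _).le, ← Finset.prod_mul_distrib]
  refine Finset.prod_congr rfl fun x _ => ?_
  rw [Measure.map_apply (hfm x) (hS x), poissonProcess_filter_apply hr (by positivity) (hE x) (hS x),
    inter_comm]

lemma lintegral_cutLaw_filter (hr : 0 < r) (hδ : 0 < δ) {E : Site d N → Set ℝ}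
    (hE : ∀ x, MeasurableSet (E x)) {f : (Site d N → PointConfig) → ℝ≥0∞} (hf : Measurable f) :
    ∫⁻ Δ, f (fun x => (Δ x).filter (E x)) ∂cutLaw d N r δ =
      ENNReal.ofReal (Real.exp (4 * δ * ∑ x, volume.real (timeInterval r \ E x))) *
        ∫⁻ Δ, {Δ : Site d N → PointConfig | ∀ x, (Δ x).points ⊆ E x}.indicator f Δ
          ∂cutLaw d N r δ := by
  have hm : Measurable fun (Δ : Site d N → PointConfig) x => (Δ x).filter (E x) :=
    measurable_pi_lambda _ fun x => (measurable_filter (hE x)).comp (measurable_pi_apply x)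
  have hset : {Δ : Site d N → PointConfig | ∀ x, (Δ x).points ⊆ E x} =
      Set.pi univ fun x => {c | c.points ⊆ E x} := by
    ext Δ
    simp
  rw [← lintegral_map hf hm, cutLaw_map_filter hr hδ hE, lintegral_smul_measure, hset,
    lintegral_indicator (MeasurableSet.univ_pi fun x => measurableSet_points_subset (hE x)),
    smul_eq_mul]

lemma zmod_two_cases (z : ZMod 2) : z = 0 ∨ z = 1 := by
  revert z
  decide

/-- Both even lengths count the doubly even part, so its coefficient on the left is `4`; that of its
complement is `4` as well, and together they give `4r`. -/
lemma even_volume_add {l₁ l₂ : ℝ → ZMod 2} (h₁ : MeasurableSet {u | l₁ u = 0})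
    (h₂ : MeasurableSet {u | l₂ u = 0}) (hr : 0 < r) :
    2 * (volume.real {u ∈ timeInterval r | l₁ u = 0} +
        volume.real {u ∈ timeInterval r | l₂ u = 0}) +
      4 * volume.real (timeInterval r \ {u | l₁ u = 0 ∧ l₂ u = 0}) =
      4 * r + 2 * volume.real {u ∈ timeInterval r | l₁ u ≠ l₂ u} := by
  have hI : volume (timeInterval r) ≠ ⊤ := by simp [timeInterval]
  have hfin : ∀ {s}, s ⊆ timeInterval r → volume s ≠ ⊤ := fun hs =>
    ne_top_of_le_ne_top hI (measure_mono hs)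
  have hvol : volume.real (timeInterval r) = r := by
    rw [timeInterval, Real.volume_real_Icc_of_le (by linarith)]
    ring
  set EE := {u ∈ timeInterval r | l₁ u = 0 ∧ l₂ u = 0}
  set EO := {u ∈ timeInterval r | l₁ u = 0 ∧ l₂ u ≠ 0}
  set OE := {u ∈ timeInterval r | l₁ u ≠ 0 ∧ l₂ u = 0}
  have mI := measurableSet_timeInterval (r := r)
  have mEE : MeasurableSet EE := mI.inter (h₁.inter h₂)
  have mEO : MeasurableSet EO := mI.inter (h₁.inter h₂.compl)
  have mOE : MeasurableSet OE := mI.inter (h₁.compl.inter h₂)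
  have e1 : volume.real {u ∈ timeInterval r | l₁ u = 0} = volume.real EE + volume.real EO := by
    rw [← measureReal_union _ mEO (hfin fun u hu => hu.1) (hfin fun u hu => hu.1)]
    · congr 1
      ext u
      simp only [EE, EO, mem_union, mem_ofPred_eq]
      tauto
    · exact Set.disjoint_left.2 fun u hu hu' => hu'.2.2 hu.2.2
  have e2 : volume.real {u ∈ timeInterval r | l₂ u = 0} = volume.real EE + volume.real OE := by
    rw [← measureReal_union _ mOE (hfin fun u hu => hu.1) (hfin fun u hu => hu.1)]
    · congr 1
      ext u
      simp only [EE, OE, mem_union, mem_ofPred_eq]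
      tauto
    · exact Set.disjoint_left.2 fun u hu hu' => hu'.2.1 hu.2.1
  have e3 : volume.real {u ∈ timeInterval r | l₁ u ≠ l₂ u} = volume.real EO + volume.real OE := by
    rw [← measureReal_union _ mOE (hfin fun u hu => hu.1) (hfin fun u hu => hu.1)]
    · congr 1
      ext u
      simp only [EO, OE, mem_union, mem_ofPred_eq]
      rcases zmod_two_cases (l₁ u) with h | h <;> rcases zmod_two_cases (l₂ u) with h' | h' <;>
        simp [h, h']
    · exact Set.disjoint_left.2 fun u hu hu' => hu'.2.1 hu.2.1
  have e4 : volume.real (timeInterval r \ {u | l₁ u = 0 ∧ l₂ u = 0}) = r - volume.real EE := by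
    have : timeInterval r \ {u | l₁ u = 0 ∧ l₂ u = 0} = timeInterval r \ EE := by
      ext u
      simp only [EE, mem_sdiff, mem_ofPred_eq]
      tauto
    rw [this, measureReal_sdiff (fun u hu => hu.1) mEE hI, hvol]
  rw [e1, e2, e3, e4]
  ring

/-- Discarding the cuts outside the doubly even set costs an exponential that completes the weight
of this set to a constant. Only the length where the labels differ remains. -/
theorem pairWeight_mul_lintegral (hr : 0 < r) (hδ : 0 < δ) (e₁ e₂ : Site d N → ZMod 2)
    {l₁ l₂ : Site d N → ℝ → ZMod 2} (h₁ : ∀ x, MeasurableSet {u | l₁ x u = 0})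
    (h₂ : ∀ x, MeasurableSet {u | l₂ x u = 0})
    {f : (Site d N → PointConfig) → ℝ≥0∞} (hf : Measurable f) :
    pairWeight r δ e₁ e₂ l₁ l₂ *
        ∫⁻ Δ, f (fun x => (Δ x).filter (bothEven l₁ l₂ x)) ∂cutLaw d N r δ =
      ENNReal.ofReal (Real.exp (4 * δ * r * Fintype.card (Site d N))) *
        (reducedWeight r δ e₁ e₂ l₁ l₂ *
        ∫⁻ Δ, {Δ : Site d N → PointConfig | ∀ x, (Δ x).points ⊆ bothEven l₁ l₂ x}.indicator f Δ
          ∂cutLaw d N r δ) := by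
  unfold pairWeight reducedWeight
  split_ifs with h
  · rw [lintegral_cutLaw_filter hr hδ (E := bothEven l₁ l₂) (fun x => (h₁ x).inter (h₂ x)) hf, ← mul_assoc, ← mul_assoc,
      ← ENNReal.ofReal_mul (Real.exp_pos _).le, ← ENNReal.ofReal_mul (Real.exp_pos _).le,
      ← Real.exp_add, ← Real.exp_add]
    congr 3
    have := Finset.sum_congr (rfl : (Finset.univ : Finset (Site d N)) = Finset.univ)
      fun x _ => even_volume_add (h₁ x) (h₂ x) hr
    simp only [Finset.sum_add_distrib, ← Finset.mul_sum] at this ⊢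
    simp only [Finset.sum_const, Finset.card_univ, nsmul_eq_mul, bothEven] at this ⊢
    linear_combination δ * this
  · simp

end Thinning

/-! ### Measurability of labels -/

instance : MeasurableSpace (ZMod 2) := ⊤

lemma measurable_zmod_add {Ω : Type*} [MeasurableSpace Ω] {f g : Ω → ZMod 2} (hf : Measurable f)
    (hg : Measurable g) : Measurable fun ω => f ω + g ω :=
  (Measurable.of_discrete (f := fun p : ZMod 2 × ZMod 2 => p.1 + p.2)).comp (hf.prodMk hg)

lemma measurable_zmod_sum {Ω ι : Type*} [MeasurableSpace Ω] (s : Finset ι) {f : ι → Ω → ZMod 2}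
    (hf : ∀ i, Measurable (f i)) : Measurable fun ω => ∑ i ∈ s, f i ω := by
  classical
  induction s using Finset.induction_on with
  | empty => simp
  | insert a s ha ih =>
    simp only [Finset.sum_insert ha]
    exact measurable_zmod_add (hf a) ih

lemma measurable_below {Ω : Type*} [MeasurableSpace Ω] {f g : Ω → ℝ} (hf : Measurable f)
    (hg : Measurable g) : Measurable fun ω => below (f ω) (g ω) :=
  Measurable.ite (measurableSet_le hg hf) measurable_const measurable_const

lemma measurable_config_sum_below :
    Measurable fun p : PointConfig × ℝ => p.1.sum (below p.2) := by
  refine measurable_pointConfig_prod fun n => ?_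
  have h : ∀ i : Fin n, Measurable fun p : (Fin n → ℝ) × ℝ => below p.2 (p.1 i) := fun i =>
    measurable_below measurable_snd ((measurable_pi_apply i).comp measurable_fst)
  exact measurable_zmod_sum Finset.univ h

lemma measurable_parity {Ω : Type*} [MeasurableSpace Ω] (A : Finset (SpaceTime d N))
    {B : Ω → Bond d N → PointConfig} {G : Ω → Site d N → PointConfig} {u : Ω → ℝ}
    (hB : Measurable B) (hG : Measurable G) (hu : Measurable u) (x : Site d N) :
    Measurable fun ω => parity A (B ω) (G ω) x (u ω) := by
  unfold parity lineSum
  refine measurable_zmod_add (measurable_zmod_add ?_ ?_) ?_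
  · refine measurable_zmod_sum _ fun p => ?_
    by_cases h : p.1 = x
    · simpa only [h, if_true] using measurable_below hu measurable_const
    · simpa only [h, if_false] using measurable_const
  · refine measurable_zmod_sum _ fun e => ?_
    by_cases h : x ∈ e.1
    · simp only [h, if_true]
      exact measurable_config_sum_below.comp (((measurable_pi_apply e).comp hB).prodMk hu)
    · simpa only [h, if_false] using measurable_const
  · exact measurable_config_sum_below.comp (((measurable_pi_apply x).comp hG).prodMk hu)

lemma measurable_label {Ω : Type*} [MeasurableSpace Ω] (b : TimeBC) (A : Finset (SpaceTime d N))
    {τ : Ω → Site d N → Bool}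
    {B : Ω → Bond d N → PointConfig} {G : Ω → Site d N → PointConfig} {u : Ω → ℝ}
    (hτ : Measurable τ) (hB : Measurable B) (hG : Measurable G) (hu : Measurable u)
    (x : Site d N) : Measurable fun ω => label b (τ ω) (parity A (B ω) (G ω)) x (u ω) := by
  have h1 := measurable_parity A hB hG hu x
  cases b
  · exact h1
  · exact measurable_zmod_add measurable_const h1
  · refine measurable_zmod_add (measurable_zmod_add ?_
      (measurable_parity A hB hG measurable_const x)) h1
    exact (Measurable.of_discrete (f := fun b : Bool => (b.toNat : ZMod 2))).comp
      ((measurable_pi_apply x).comp hτ)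

/-! ### The two labellings of a sample -/

/-- The labelling of the first copy. -/
def label₁ (R : Regime) (A : Finset (SpaceTime d N)) (a : FreeSample d N) :
    Site d N → ℝ → ZMod 2 :=
  label R.bc₁ a.2 (parity A a.1 fun _ => emptyConfig)

/-- The labelling of the second copy. -/
def label₂ (R : Regime) (A : Finset (SpaceTime d N)) (w : WiredSample d N) :
    Site d N → ℝ → ZMod 2 :=
  label R.bc₂ w.1.2 (parity A w.1.1 w.2)

/-- The parity of the number of switching points of the first copy on each line. -/
def final₁ (r : ℝ) (A : Finset (SpaceTime d N)) (a : FreeSample d N) (x : Site d N) : ZMod 2 :=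
  parity A a.1 (fun _ => emptyConfig) x (r / 2)

/-- The parity of the number of switching points of the second copy on each line. -/
def final₂ (r : ℝ) (A : Finset (SpaceTime d N)) (w : WiredSample d N) (x : Site d N) : ZMod 2 :=
  parity A w.1.1 w.2 x (r / 2)

/-- The product of the weights of the two copies. -/
def sampleWeight (R : Regime) (r δ : ℝ) (A₁ A₂ : Finset (SpaceTime d N)) (a : FreeSample d N)
    (w : WiredSample d N) : ℝ≥0∞ :=
  pairWeight r δ (final₁ r A₁ a) (final₂ r A₂ w) (label₁ R A₁ a) (label₂ R A₂ w)

/-- The reduced weight of the two copies. -/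
def sampleReduced (R : Regime) (r δ : ℝ) (A₁ A₂ : Finset (SpaceTime d N)) (a : FreeSample d N)
    (w : WiredSample d N) : ℝ≥0∞ :=
  reducedWeight r δ (final₁ r A₁ a) (final₂ r A₂ w) (label₁ R A₁ a) (label₂ R A₂ w)

/-- The times that are even in both copies. -/
def sampleEven (R : Regime) (A₁ A₂ : Finset (SpaceTime d N)) (a : FreeSample d N)
    (w : WiredSample d N) : Site d N → Set ℝ :=
  bothEven (label₁ R A₁ a) (label₂ R A₂ w)

/-- A path from `p` to `q` avoids all cuts. -/
def CutFree (R : Regime) (r : ℝ) (p q : SpaceTime d N) (ω : Sample d N) : Prop :=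
  (∀ x, ω.cuts x ⊆ timeInterval r) ∧
    Reach R r ω.cuts (fun e => (ω.B e).points ∪ (ω.Bhat e).points) p q

/-- The sample in which only the cuts that are even in both copies are kept. -/
def keepEven (R : Regime) (A₁ A₂ : Finset (SpaceTime d N)) (ω : Sample d N) : Sample d N :=
  (ω.1, ω.2.1, fun x => (ω.2.2 x).filter (sampleEven R A₁ A₂ ω.1 ω.2.1 x))

section Measurability

variable (R : Regime) (r δ : ℝ) (A A₁ A₂ : Finset (SpaceTime d N)) {Ω : Type*} [MeasurableSpace Ω]

lemma measurable_eq_zmod {f g : Ω → ZMod 2} (hf : Measurable f) (hg : Measurable g) :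
    Measurable fun ω => f ω = g ω :=
  (Measurable.of_discrete (f := fun p : ZMod 2 × ZMod 2 => p.1 = p.2)).comp (hf.prodMk hg)

lemma measurable_label₁ {a : Ω → FreeSample d N} {u : Ω → ℝ} (ha : Measurable a)
    (hu : Measurable u) (x : Site d N) : Measurable fun ω => label₁ R A (a ω) x (u ω) :=
  measurable_label _ A (measurable_snd.comp ha) (measurable_fst.comp ha) measurable_const hu x

lemma measurable_label₂ {w : Ω → WiredSample d N} {u : Ω → ℝ} (hw : Measurable w)
    (hu : Measurable u) (x : Site d N) : Measurable fun ω => label₂ R A (w ω) x (u ω) :=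
  measurable_label _ A (measurable_snd.comp (measurable_fst.comp hw))
    (measurable_fst.comp (measurable_fst.comp hw)) (measurable_snd.comp hw) hu x

lemma measurable_final₁ {a : Ω → FreeSample d N} (ha : Measurable a) (x : Site d N) :
    Measurable fun ω => final₁ r A (a ω) x :=
  measurable_parity A (measurable_fst.comp ha) measurable_const measurable_const x

lemma measurable_final₂ {w : Ω → WiredSample d N} (hw : Measurable w) (x : Site d N) :
    Measurable fun ω => final₂ r A (w ω) x :=
  measurable_parity A (measurable_fst.comp (measurable_fst.comp hw)) (measurable_snd.comp hw)
    measurable_const x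

lemma measurable_volume_section {p : Ω → ℝ → Prop} (hp : Measurable fun q : Ω × ℝ => p q.1 q.2) :
    Measurable fun ω => volume.real {u ∈ timeInterval r | p ω u} := by
  have h : MeasurableSet {q : Ω × ℝ | q.2 ∈ timeInterval r ∧ p q.1 q.2} :=
    (measurable_snd measurableSet_timeInterval).inter (measurableSet_setOfPred.2 hp)
  exact (measurable_measure_prodMk_left (ν := volume) h).ennreal_toReal

lemma measurable_final_eq_zero : Measurable fun q : FreeSample d N × WiredSample d N =>
    (∀ x, final₁ r A₁ q.1 x = 0) ∧ ∀ x, final₂ r A₂ q.2 x = 0 :=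
  .and (.forall fun x => measurable_eq_zmod (measurable_final₁ r A₁ measurable_fst x)
    measurable_const) (.forall fun x =>
      measurable_eq_zmod (measurable_final₂ r A₂ measurable_snd x) measurable_const)

lemma measurable_sampleWeight : Measurable fun q : FreeSample d N × WiredSample d N =>
    sampleWeight R r δ A₁ A₂ q.1 q.2 := by
  refine Measurable.ite (measurableSet_setOfPred.2 (measurable_final_eq_zero r A₁ A₂)) ?_
    measurable_const
  refine (Real.measurable_exp.comp (Measurable.const_mul ?_ _)).ennreal_ofReal
  refine Finset.measurable_sum _ fun x _ => .add ?_ ?_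
  · exact measurable_volume_section r (measurable_eq_zmod
      (measurable_label₁ R A₁ (measurable_fst.comp measurable_fst) measurable_snd x)
      measurable_const)
  · exact measurable_volume_section r (measurable_eq_zmod
      (measurable_label₂ R A₂ (measurable_snd.comp measurable_fst) measurable_snd x)
      measurable_const)

lemma measurable_sampleReduced : Measurable fun q : FreeSample d N × WiredSample d N =>
    sampleReduced R r δ A₁ A₂ q.1 q.2 := by
  refine Measurable.ite (measurableSet_setOfPred.2 (measurable_final_eq_zero r A₁ A₂)) ?_
    measurable_const
  refine (Real.measurable_exp.comp (Measurable.const_mul ?_ _)).ennreal_ofReal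
  refine Finset.measurable_sum _ fun x _ => ?_
  exact measurable_volume_section r (measurable_eq_zmod
      (measurable_label₁ R A₁ (measurable_fst.comp measurable_fst) measurable_snd x)
      (measurable_label₂ R A₂ (measurable_snd.comp measurable_fst) measurable_snd x)).not

/-- The `i`-th cut on the line of `x`. -/
def cutTime (x : Site d N) (i : ℕ) (ω : Sample d N) : ℝ := (ω.2.2 x).pt i

lemma measurable_cutTime (x : Site d N) (i : ℕ) : Measurable (cutTime (d := d) (N := N) x i) := by
  unfold cutTime
  exact (measurable_pt i).comp ((measurable_pi_apply x).comp
    (measurable_snd.comp measurable_snd))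

lemma measurable_lt_size {f : Ω → PointConfig} (hf : Measurable f) (i : ℕ) :
    Measurable fun ω => i < (f ω).size :=
  measurableSet_setOfPred.1 (measurableSet_lt measurable_const (measurable_size.comp hf))

lemma measurable_cutTime_mem_sampleEven (x : Site d N) (i : ℕ) :
    Measurable fun ω : Sample d N => cutTime x i ω ∈ sampleEven R A₁ A₂ ω.1 ω.2.1 x :=
  .and (measurable_eq_zmod (measurable_label₁ R A₁ measurable_fst (measurable_cutTime x i) x)
      measurable_const)
    (measurable_eq_zmod (measurable_label₂ R A₂ (measurable_fst.comp measurable_snd)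
      (measurable_cutTime x i) x) measurable_const)

lemma measurable_cutConfig (x : Site d N) : Measurable fun ω : Sample d N => ω.2.2 x :=
  (measurable_pi_apply x).comp (measurable_snd.comp measurable_snd)

lemma enumerated_cuts (x : Site d N) : Enumerated (fun ω : Sample d N => ω.cuts x)
    (fun i ω => i < (ω.2.2 x).size) (cutTime x) where
  measurable_act i := measurable_lt_size (measurable_cutConfig x) i
  measurable_time := measurable_cutTime x
  mem_iff _ t := PointConfig.mem_points_iff _ t

lemma keepEven_cuts (ω : Sample d N) (x : Site d N) :
    (keepEven R A₁ A₂ ω).cuts x = ω.cuts x ∩ sampleEven R A₁ A₂ ω.1 ω.2.1 x :=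
  filter_points _ _

lemma enumerated_keepEven_cuts (x : Site d N) :
    Enumerated (fun ω : Sample d N => (keepEven R A₁ A₂ ω).cuts x)
      (fun i ω => i < (ω.2.2 x).size ∧ cutTime x i ω ∈ sampleEven R A₁ A₂ ω.1 ω.2.1 x)
      (cutTime x) where
  measurable_act i := (measurable_lt_size (measurable_cutConfig x) i).and
    (measurable_cutTime_mem_sampleEven R A₁ A₂ x i)
  measurable_time := measurable_cutTime x
  mem_iff ω t := by
    rw [keepEven_cuts, mem_inter_iff, (enumerated_cuts x).mem_iff]
    constructor
    · rintro ⟨⟨i, hi, rfl⟩, h⟩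
      exact ⟨i, ⟨hi, h⟩, rfl⟩
    · rintro ⟨i, ⟨hi, h⟩, rfl⟩
      exact ⟨⟨i, hi, rfl⟩, h⟩

lemma enumerated_bridges (e : Bond d N) :
    Enumerated (fun ω : Sample d N => (ω.B e).points ∪ (ω.Bhat e).points)
      (fun i ω => if Even i then i / 2 < (ω.B e).size else i / 2 < (ω.Bhat e).size)
      (fun i ω => if Even i then (ω.B e).pt (i / 2) else (ω.Bhat e).pt (i / 2)) := by
  have hB : Measurable fun ω : Sample d N => ω.B e :=
    (measurable_pi_apply e).comp (measurable_fst.comp measurable_fst)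
  have hB' : Measurable fun ω : Sample d N => ω.Bhat e :=
    (measurable_pi_apply e).comp (measurable_fst.comp (measurable_fst.comp
      (measurable_fst.comp measurable_snd)))
  refine ⟨fun i => ?_, fun i => ?_, fun ω t => ?_⟩
  · by_cases h : Even i
    · simpa only [h, if_true] using measurable_lt_size hB _
    · simpa only [h, if_false] using measurable_lt_size hB' _
  · by_cases h : Even i
    · simp only [h, if_true]
      exact (measurable_pt _).comp hB
    · simp only [h, if_false]
      exact (measurable_pt _).comp hB'
  · rw [mem_union, PointConfig.mem_points_iff, PointConfig.mem_points_iff]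
    constructor
    · rintro (⟨i, hi, rfl⟩ | ⟨i, hi, rfl⟩)
      · exact ⟨2 * i, by simpa using hi, by simp⟩
      · have h1 : ¬ Even (2 * i + 1) := by simp
        have h2 : (2 * i + 1) / 2 = i := by omega
        exact ⟨2 * i + 1, by simpa only [h1, h2, if_false] using hi, by simp only [h1, h2, if_false]⟩
    · rintro ⟨i, hi, rfl⟩
      by_cases h : Even i
      · simp only [h, if_true] at hi ⊢
        exact Or.inl ⟨_, hi, rfl⟩
      · simp only [h, if_false] at hi ⊢
        exact Or.inr ⟨_, hi, rfl⟩

lemma measurable_subset_timeInterval {D : Ω → Set ℝ} {act : ℕ → Ω → Prop} {s : ℕ → Ω → ℝ}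
    (hD : Enumerated D act s) : Measurable fun ω => D ω ⊆ timeInterval r := by
  have := measurable_disjoint hD (W := fun _ => (timeInterval r)ᶜ) fun i =>
    (measurable_mem_Icc (hD.measurable_time i) (measurable_const (a := -(r / 2)))
      (measurable_const (a := r / 2))).not
  simpa only [disjoint_compl_left_iff_subset] using this

lemma measurable_cutFree (p q : SpaceTime d N) : Measurable (CutFree R r p q) :=
  .and (.forall fun x => measurable_subset_timeInterval r (enumerated_cuts x))
    (measurable_reach enumerated_cuts enumerated_bridges p q)

lemma measurable_cutFree_keepEven (p q : SpaceTime d N) :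
    Measurable fun ω => CutFree R r p q (keepEven R A₁ A₂ ω) :=
  .and (.forall fun x => measurable_subset_timeInterval r (enumerated_keepEven_cuts R A₁ A₂ x))
    (measurable_reach (D := fun ω => (keepEven R A₁ A₂ ω).cuts)
      (Q := fun ω e => (ω.B e).points ∪ (ω.Bhat e).points)
      (enumerated_keepEven_cuts R A₁ A₂) enumerated_bridges p q)

lemma measurable_cuts_subset_sampleEven : Measurable fun ω : Sample d N =>
    ∀ x, ω.cuts x ⊆ sampleEven R A₁ A₂ ω.1 ω.2.1 x := by
  refine .forall fun x => ?_
  have := measurable_disjoint (enumerated_cuts x)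
    (W := fun ω : Sample d N => (sampleEven R A₁ A₂ ω.1 ω.2.1 x)ᶜ) fun i =>
    (measurable_cutTime_mem_sampleEven R A₁ A₂ x i).not
  simpa only [disjoint_compl_left_iff_subset] using this

end Measurability

/-! ### Thinning the cuts -/

lemma lintegral_jointLaw_eq_mul {r : ℝ} (hr : 0 < r) (lam δ : ℝ) {f g : Sample d N → ℝ≥0∞}
    (hf : Measurable f) (hg : Measurable g) (C : ℝ≥0∞)
    (h : ∀ a w, ∫⁻ Δ, f (a, w, Δ) ∂cutLaw d N r δ = C * ∫⁻ Δ, g (a, w, Δ) ∂cutLaw d N r δ) :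
    ∫⁻ ω, f ω ∂jointLaw d N r lam δ = C * ∫⁻ ω, g ω ∂jointLaw d N r lam δ := by
  have := isProbabilityMeasure_freeLaw (d := d) (N := N) hr lam
  have := isProbabilityMeasure_wiredLaw (d := d) (N := N) hr lam
  have := isProbabilityMeasure_cutLaw (d := d) (N := N) hr δ
  unfold jointLaw
  rw [lintegral_prod _ hf.aemeasurable, lintegral_prod _ hg.aemeasurable,
    ← lintegral_const_mul _ hg.lintegral_prod_right']
  refine lintegral_congr fun a => ?_
  have hf' := hf.comp (measurable_prodMk_left (x := a))
  have hg' := hg.comp (measurable_prodMk_left (x := a))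
  change ∫⁻ y, (f ∘ Prod.mk a) y ∂_ = C * ∫⁻ y, (g ∘ Prod.mk a) y ∂_
  rw [lintegral_prod _ hf'.aemeasurable, lintegral_prod _ hg'.aemeasurable,
    ← lintegral_const_mul _ hg'.lintegral_prod_right']
  exact lintegral_congr fun w => h a w

/-- Replaces a functional of the kept cuts, which depends on the labels, by the same functional of
all cuts on the event that none is discarded. -/
theorem lintegral_sampleWeight_mul (R : Regime) {r δ : ℝ} (hr : 0 < r) (hδ : 0 < δ) (lam : ℝ)
    (A₁ A₂ : Finset (SpaceTime d N)) {f : Sample d N → ℝ≥0∞} (hf : Measurable f)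
    (hf' : Measurable fun ω => f (keepEven R A₁ A₂ ω)) :
    ∫⁻ ω, sampleWeight R r δ A₁ A₂ ω.1 ω.2.1 * f (keepEven R A₁ A₂ ω) ∂jointLaw d N r lam δ =
      ENNReal.ofReal (Real.exp (4 * δ * r * Fintype.card (Site d N))) *
      ∫⁻ ω, sampleReduced R r δ A₁ A₂ ω.1 ω.2.1 *
        {ω : Sample d N | ∀ x, ω.cuts x ⊆ sampleEven R A₁ A₂ ω.1 ω.2.1 x}.indicator f ω
          ∂jointLaw d N r lam δ := by
  have hpair : Measurable fun ω : Sample d N => (ω.1, ω.2.1) := by fun_prop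
  have hm1 : Measurable fun ω : Sample d N =>
      sampleWeight R r δ A₁ A₂ ω.1 ω.2.1 * f (keepEven R A₁ A₂ ω) :=
    ((measurable_sampleWeight R r δ A₁ A₂).comp hpair).mul hf'
  have hm2 : Measurable fun ω : Sample d N => sampleReduced R r δ A₁ A₂ ω.1 ω.2.1 *
      {ω : Sample d N | ∀ x, ω.cuts x ⊆ sampleEven R A₁ A₂ ω.1 ω.2.1 x}.indicator f ω :=
    ((measurable_sampleReduced R r δ A₁ A₂).comp hpair).mul (hf.indicator
      (measurableSet_setOfPred.2 (measurable_cuts_subset_sampleEven R A₁ A₂)))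
  refine lintegral_jointLaw_eq_mul hr lam δ hm1 hm2 _ fun a w => ?_
  have hfs : Measurable fun Δ => f (a, w, Δ) := hf.comp (by fun_prop)
  have h1 : ∀ x, MeasurableSet {u | label₁ R A₁ a x u = 0} := fun x =>
    measurableSet_setOfPred.2 (measurable_eq_zmod
      (measurable_label₁ R A₁ measurable_const measurable_id x) measurable_const)
  have h2 : ∀ x, MeasurableSet {u | label₂ R A₂ w x u = 0} := fun x =>
    measurableSet_setOfPred.2 (measurable_eq_zmod
      (measurable_label₂ R A₂ measurable_const measurable_id x) measurable_const)
  have key := pairWeight_mul_lintegral hr hδ (final₁ r A₁ a) (final₂ r A₂ w) h1 h2 hfs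
  have hset : MeasurableSet
      {Δ : Site d N → PointConfig | ∀ x, (Δ x).points ⊆ sampleEven R A₁ A₂ a w x} :=
    (measurable_prodMk_left.comp measurable_prodMk_left : Measurable fun Δ => (a, w, Δ))
      (measurableSet_setOfPred.2 (measurable_cuts_subset_sampleEven R A₁ A₂))
  have hfilter : Measurable fun (Δ : Site d N → PointConfig) x =>
      (Δ x).filter (sampleEven R A₁ A₂ a w x) :=
    measurable_pi_lambda _ fun x =>
      (measurable_filter ((h1 x).inter (h2 x))).comp (measurable_pi_apply x)
  calc _ = sampleWeight R r δ A₁ A₂ a w *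
        ∫⁻ Δ, f (a, w, fun x => (Δ x).filter (sampleEven R A₁ A₂ a w x)) ∂cutLaw d N r δ :=
        lintegral_const_mul _ (hfs.comp hfilter)
    _ = _ := key
    _ = _ := by
      congr 1
      exact (lintegral_const_mul _ (hfs.indicator hset)).symm

/-! ### Marked bridges, invariance under flips, and the exchange of sources. -/

/-! ### The joint law through marked bridges -/

lemma measurePreserving_prodProdProdComm {α β γ ε : Type*} [MeasurableSpace α] [MeasurableSpace β]
    [MeasurableSpace γ] [MeasurableSpace ε] (μ : Measure α) (ν : Measure β) (ρ : Measure γ)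
    (σ : Measure ε) [SFinite μ] [SFinite ν] [SFinite ρ] [SFinite σ] :
    MeasurePreserving (fun p : (α × β) × (γ × ε) => ((p.1.1, p.2.1), (p.1.2, p.2.2)))
      ((μ.prod ν).prod (ρ.prod σ)) ((μ.prod ρ).prod (ν.prod σ)) := by
  have h1 := measurePreserving_prodAssoc μ ν (ρ.prod σ)
  have h2 := (MeasurePreserving.id μ).prod (measurePreserving_prodAssoc ν ρ σ).symm
  have h3 := (MeasurePreserving.id μ).prod
    ((Measure.measurePreserving_swap (μ := ν) (ν := ρ)).prod (MeasurePreserving.id σ))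
  have h4 := (MeasurePreserving.id μ).prod (measurePreserving_prodAssoc ρ ν σ)
  have h5 := (measurePreserving_prodAssoc μ ρ (ν.prod σ)).symm
  exact h5.comp (h4.comp (h3.comp (h2.comp h1)))

/-- Bridges in both copies from bridges with marks. -/
def splitBridges (p : (Bond d N → PointConfig) × (Bond d N → ℕ → Bool)) :
    (Bond d N → PointConfig) × (Bond d N → PointConfig) :=
  (fun e => (p.1 e).select (p.2 e), fun e => (p.1 e).select fun i => !(p.2 e i))

lemma measurePreserving_splitBridges {r : ℝ} (hr : 0 < r) (lam : ℝ) :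
    MeasurePreserving (splitBridges (d := d) (N := N))
      ((Measure.pi fun _ => poissonProcess (2 * lam) r).prod (Measure.pi fun _ => coinSeq))
      ((Measure.pi fun _ => poissonProcess lam r).prod
        (Measure.pi fun _ => poissonProcess lam r)) := by
  have := isProbabilityMeasure_poissonProcess lam hr
  have := isProbabilityMeasure_poissonProcess (2 * lam) hr
  have h1 := (measurePreserving_arrowProdEquivProdArrow PointConfig (ℕ → Bool) (Bond d N)
    (fun _ => poissonProcess (2 * lam) r) (fun _ => coinSeq)).symm
  have hs : MeasurePreserving split ((poissonProcess (2 * lam) r).prod coinSeq)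
      ((poissonProcess lam r).prod (poissonProcess lam r)) :=
    ⟨measurable_split, (poissonProcess_prod_self hr).symm⟩
  have h2 : MeasurePreserving (fun (q : Bond d N → PointConfig × (ℕ → Bool)) e => split (q e))
      (Measure.pi fun _ => (poissonProcess (2 * lam) r).prod coinSeq)
      (Measure.pi fun _ => (poissonProcess lam r).prod (poissonProcess lam r)) :=
    measurePreserving_pi _ _ fun _ => hs
  have h3 := measurePreserving_arrowProdEquivProdArrow PointConfig PointConfig (Bond d N)
    (fun _ => poissonProcess lam r) (fun _ => poissonProcess lam r)
  exact h3.comp (h2.comp h1)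

/-- Marked bridges, coins of both copies, ghost points and cuts. -/
abbrev MarkedSample (d N : ℕ) : Type :=
  (((Bond d N → PointConfig) × (Bond d N → ℕ → Bool)) ×
    ((Site d N → Bool) × (Site d N → Bool))) ×
      ((Site d N → PointConfig) × (Site d N → PointConfig))

/-- The sample determined by a marked sample. -/
def MarkedSample.toSample (q : MarkedSample d N) : Sample d N :=
  (((splitBridges q.1.1).1, q.1.2.1), (((splitBridges q.1.1).2, q.1.2.2), q.2.1), q.2.2)

/-- The law of marked samples. -/
def markedLaw (d N : ℕ) (r lam δ : ℝ) : Measure (MarkedSample d N) :=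
  (((Measure.pi fun _ => poissonProcess (2 * lam) r).prod (Measure.pi fun _ => coinSeq)).prod
    ((Measure.pi fun _ => fairCoin).prod (Measure.pi fun _ => fairCoin))).prod
      ((Measure.pi fun x : Site d N => poissonProcess (lam * outerDegree x) r).prod
        (cutLaw d N r δ))

lemma measurePreserving_toSample {r : ℝ} (hr : 0 < r) (lam δ : ℝ) :
    MeasurePreserving (MarkedSample.toSample (d := d) (N := N)) (markedLaw d N r lam δ)
      (jointLaw d N r lam δ) := by
  have := fun ρ => isProbabilityMeasure_poissonProcess ρ hr
  have := isProbabilityMeasure_freeLaw (d := d) (N := N) hr lam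
  have := isProbabilityMeasure_cutLaw (d := d) (N := N) hr δ
  have h1 := ((measurePreserving_splitBridges (d := d) (N := N) hr lam).prod
    (MeasurePreserving.id ((Measure.pi fun _ : Site d N => fairCoin).prod
      (Measure.pi fun _ : Site d N => fairCoin))))
  have h2 := measurePreserving_prodProdProdComm (Measure.pi fun _ : Bond d N => poissonProcess lam r)
    (Measure.pi fun _ : Bond d N => poissonProcess lam r) (Measure.pi fun _ : Site d N => fairCoin)
    (Measure.pi fun _ : Site d N => fairCoin)
  have h3 := (h2.comp h1).prod (MeasurePreserving.id
    ((Measure.pi fun x : Site d N => poissonProcess (lam * outerDegree x) r).prod (cutLaw d N r δ)))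
  have h4 := measurePreserving_prodAssoc (freeLaw d N r lam) (freeLaw d N r lam)
    ((Measure.pi fun x : Site d N => poissonProcess (lam * outerDegree x) r).prod (cutLaw d N r δ))
  have h5 := (MeasurePreserving.id (freeLaw d N r lam)).prod (measurePreserving_prodAssoc
    (freeLaw d N r lam) (Measure.pi fun x : Site d N => poissonProcess (lam * outerDegree x) r)
    (cutLaw d N r δ)).symm
  exact h5.comp (h4.comp h3)

/-! ### Flips preserve the law -/

/-- Flip the marks in `T` and the coins in `c`, in both copies. -/
def flip (T : Bond d N → ℕ → Bool) (c : Site d N → Bool)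
    (m : (Bond d N → ℕ → Bool) × ((Site d N → Bool) × (Site d N → Bool))) :
    (Bond d N → ℕ → Bool) × ((Site d N → Bool) × (Site d N → Bool)) :=
  (fun e i => xor (m.1 e i) (T e i), (fun x => xor (m.2.1 x) (c x), fun x => xor (m.2.2 x) (c x)))

lemma measurePreserving_flip (T : Bond d N → ℕ → Bool) (c : Site d N → Bool) :
    MeasurePreserving (flip T c)
      ((Measure.pi fun _ => coinSeq).prod
        ((Measure.pi fun _ => fairCoin).prod (Measure.pi fun _ => fairCoin)))
      ((Measure.pi fun _ => coinSeq).prod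
        ((Measure.pi fun _ => fairCoin).prod (Measure.pi fun _ => fairCoin))) := by
  have h1 : MeasurePreserving (fun (m : Bond d N → ℕ → Bool) e i => xor (m e i) (T e i))
      (Measure.pi fun _ => coinSeq) (Measure.pi fun _ => coinSeq) := by
    refine measurePreserving_pi _ _ (f := fun e (m : ℕ → Bool) i => xor (m i) (T e i)) fun e =>
      ⟨measurable_pi_lambda _ fun i => ?_, coinSeq_map_xor _⟩
    exact (Measurable.of_discrete (f := fun b => xor b (T e i))).comp (measurable_pi_apply i)
  have h2 : MeasurePreserving (fun (m : Site d N → Bool) x => xor (m x) (c x))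
      (Measure.pi fun _ => fairCoin) (Measure.pi fun _ => fairCoin) :=
    measurePreserving_pi _ _ (f := fun x b => xor b (c x)) fun x =>
      ⟨Measurable.of_discrete, fairCoin_map_xor _⟩
  exact h1.prod (h2.prod h2)

/-- Two functionals of the sample have the same mean if, given the positions of all points, they
are related by a flip or vanish. -/
theorem lintegral_eq_of_flip {r : ℝ} (hr : 0 < r) (lam δ : ℝ) {f g : Sample d N → ℝ≥0∞}
    (hf : Measurable f) (hg : Measurable g)
    (h : ∀ (Q : Bond d N → PointConfig) (Y : (Site d N → PointConfig) × (Site d N → PointConfig)),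
      ∃ T c, ∀ m : (Bond d N → ℕ → Bool) × ((Site d N → Bool) × (Site d N → Bool)),
        f (MarkedSample.toSample (((Q, m.1), m.2), Y)) =
          g (MarkedSample.toSample (((Q, (flip T c m).1), (flip T c m).2), Y))) :
    ∫⁻ ω, f ω ∂jointLaw d N r lam δ = ∫⁻ ω, g ω ∂jointLaw d N r lam δ := by
  have := fun ρ => isProbabilityMeasure_poissonProcess ρ hr
  have := isProbabilityMeasure_cutLaw (d := d) (N := N) hr δ
  have hmp := measurePreserving_toSample (d := d) (N := N) hr lam δ
  -- Marks and coins are integrated innermost, with the positions of all points frozen.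
  have key : ∀ {k : Sample d N → ℝ≥0∞}, Measurable k → ∫⁻ ω, k ω ∂jointLaw d N r lam δ =
      ∫⁻ Y, ∫⁻ Q, ∫⁻ m, k (MarkedSample.toSample (((Q, m.1), m.2), Y))
        ∂((Measure.pi fun _ => coinSeq).prod
          ((Measure.pi fun _ => fairCoin).prod (Measure.pi fun _ => fairCoin)))
        ∂(Measure.pi fun _ => poissonProcess (2 * lam) r)
        ∂((Measure.pi fun x : Site d N => poissonProcess (lam * outerDegree x) r).prod
          (cutLaw d N r δ)) := by
    intro k hk
    have hk' : Measurable (k ∘ MarkedSample.toSample (d := d) (N := N)) := hk.comp hmp.measurable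
    rw [← hmp.lintegral_comp hk, markedLaw]
    change ∫⁻ q, (k ∘ MarkedSample.toSample) q ∂_ = _
    rw [lintegral_prod_symm _ hk'.aemeasurable]
    refine lintegral_congr fun Y => ?_
    have hkY : Measurable fun q => (k ∘ MarkedSample.toSample (d := d) (N := N)) (q, Y) :=
      hk'.comp measurable_prodMk_right
    have hassoc := (measurePreserving_prodAssoc
      (Measure.pi fun _ : Bond d N => poissonProcess (2 * lam) r)
      (Measure.pi fun _ : Bond d N => coinSeq)
      ((Measure.pi fun _ : Site d N => fairCoin).prod (Measure.pi fun _ : Site d N => fairCoin))).symm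
    rw [← hassoc.lintegral_comp hkY]
    exact lintegral_prod _ (hkY.comp hassoc.measurable).aemeasurable
  rw [key hf, key hg]
  refine lintegral_congr fun Y => lintegral_congr fun Q => ?_
  -- The inner integrals agree for each fixed `Q` and `Y`, so no measurable choice of the flip is
  -- needed.
  obtain ⟨T, c, hTc⟩ := h Q Y
  simp_rw [hTc]
  refine (measurePreserving_flip T c).lintegral_comp
    (f := fun m => g (MarkedSample.toSample (((Q, m.1), m.2), Y))) ?_
  exact hg.comp (hmp.measurable.comp (by fun_prop))

/-! ### Moving the sources from one copy to the other -/

lemma parity_pair {p q : SpaceTime d N} (hpq : p ≠ q) (B : Bond d N → PointConfig)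
    (G : Site d N → PointConfig) (x : Site d N) (u : ℝ) :
    parity {p, q} B G x u = source p x u + source q x u + parity ∅ B G x u := by
  simp only [parity, lineSum, Finset.sum_pair hpq, source, Finset.sum_empty]
  ring

lemma parity_empty_add (B : Bond d N → PointConfig) (G : Site d N → PointConfig) (x : Site d N)
    (u : ℝ) : parity ∅ B G x u =
      parity ∅ B (fun _ => emptyConfig) x u + (G x).sum (below u) := by
  simp [parity, lineSum, emptyConfig_sum]

lemma parity_select_xor (Q : Bond d N → PointConfig) (m T : Bond d N → ℕ → Bool)
    (G : Site d N → PointConfig) (x : Site d N) (u : ℝ) :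
    parity ∅ (fun e => (Q e).select fun i => xor (m e i) (T e i)) G x u =
      parity ∅ (fun e => (Q e).select (m e)) G x u +
        parity ∅ (fun e => (Q e).select (T e)) (fun _ => emptyConfig) x u := by
  rw [parity_empty_add _ G, parity_empty_add (fun e => (Q e).select (m e)) G]
  have : parity ∅ (fun e => (Q e).select fun i => xor (m e i) (T e i)) (fun _ => emptyConfig) x u =
      parity ∅ (fun e => (Q e).select (m e)) (fun _ => emptyConfig) x u +
      parity ∅ (fun e => (Q e).select (T e)) (fun _ => emptyConfig) x u := by
    simp only [parity_empty, select_sum_xor, ← Finset.sum_add_distrib]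
    refine Finset.sum_congr rfl fun e _ => ?_
    split_ifs <;> simp
  rw [this]
  ring

lemma parity_flip₁ {p q : SpaceTime d N} (hpq : p ≠ q) (Q : Bond d N → PointConfig)
    (m T : Bond d N → ℕ → Bool) (G : Site d N → PointConfig) :
    parity ∅ (fun e => (Q e).select fun i => xor (m e i) (T e i)) G =
      fun x u => parity {p, q} (fun e => (Q e).select (m e)) G x u + flipParity Q T p q x u := by
  funext x u
  rw [parity_select_xor, parity_pair hpq, flipParity]
  have h1 := CharTwo.add_self_eq_zero (source p x u)
  have h2 := CharTwo.add_self_eq_zero (source q x u)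
  linear_combination -h1 - h2

/-- The complement of the flipped marks is the flip of the complementary marks, so the second copy
undergoes the same change as the first. -/
lemma parity_flip₂ {p q : SpaceTime d N} (hpq : p ≠ q) (Q : Bond d N → PointConfig)
    (m T : Bond d N → ℕ → Bool) (G : Site d N → PointConfig) :
    parity {p, q} (fun e => (Q e).select fun i => !(xor (m e i) (T e i))) G =
      fun x u => parity ∅ (fun e => (Q e).select fun i => !(m e i)) G x u +
        flipParity Q T p q x u := by
  funext x u
  have : (fun e => (Q e).select fun i => !(xor (m e i) (T e i))) =
      fun e => (Q e).select fun i => xor (!(m e i)) (T e i) := by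
    funext e
    congr 1
    funext i
    cases m e i <;> cases T e i <;> rfl
  rw [parity_pair hpq, this, parity_select_xor Q (fun e i => !(m e i)), flipParity]
  ring

/-- The constant `1` of the wired condition belongs to the labelling and not to the change. The
change is therefore computed with `bc₁` in both copies, and is the same function. -/
lemma label_bc₂_add (R : Regime) (c c' : Site d N → Bool) (σ σ' : Site d N → ℝ → ZMod 2)
    (x : Site d N) (u : ℝ) :
    label R.bc₂ (fun x => xor (c x) (c' x)) (fun x u => σ x u + σ' x u) x u =
      label R.bc₂ c σ x u + label R.bc₁ c' σ' x u := by
  cases R <;> simp only [Regime.bc₁, Regime.bc₂, label]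
  · rw [toNat_xor_cast]
    ring
  · ring

/-- The indicator of a path from `p` to `q` that avoids all cuts. -/
def cutFreeIndicator (R : Regime) (r : ℝ) (p q : SpaceTime d N) : Sample d N → ℝ≥0∞ :=
  {ω | CutFree R r p q ω}.indicator fun _ => 1

lemma measurable_cutFreeIndicator (R : Regime) (r : ℝ) (p q : SpaceTime d N) :
    Measurable (cutFreeIndicator R r p q) :=
  measurable_const.indicator (measurableSet_setOfPred.2 (measurable_cutFree R r p q))

/-- The reduced weight, restricted to samples all of whose cuts are even in both copies. -/
def evenCutWeight (R : Regime) (r δ : ℝ) (A₁ A₂ : Finset (SpaceTime d N))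
    (f : Sample d N → ℝ≥0∞) (ω : Sample d N) : ℝ≥0∞ :=
  sampleReduced R r δ A₁ A₂ ω.1 ω.2.1 *
    {ω : Sample d N | ∀ x, ω.cuts x ⊆ sampleEven R A₁ A₂ ω.1 ω.2.1 x}.indicator f ω

lemma measurable_evenCutWeight (R : Regime) (r δ : ℝ) (A₁ A₂ : Finset (SpaceTime d N))
    {f : Sample d N → ℝ≥0∞} (hf : Measurable f) :
    Measurable (evenCutWeight R r δ A₁ A₂ f) :=
  ((measurable_sampleReduced R r δ A₁ A₂).comp
    (by fun_prop : Measurable fun ω : Sample d N => (ω.1, ω.2.1))).mul (hf.indicator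
      (measurableSet_setOfPred.2 (measurable_cuts_subset_sampleEven R A₁ A₂)))

lemma cutFree_toSample (R : Regime) (r : ℝ) (p q : SpaceTime d N) (s : MarkedSample d N) :
    CutFree R r p q s.toSample ↔ (∀ x, (s.2.2 x).points ⊆ timeInterval r) ∧
      Reach R r (fun x => (s.2.2 x).points) (fun e => (s.1.1.1 e).points) p q := by
  have : (fun e => (s.toSample.B e).points ∪ (s.toSample.Bhat e).points) =
      fun e => (s.1.1.1 e).points := by
    funext e
    exact select_points_union (s.1.1.1 e) (s.1.1.2 e)
  rw [CutFree, this]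
  rfl

theorem lintegral_evenCutWeight_swap (R : Regime) {r : ℝ} (hr : 0 < r) (lam δ : ℝ)
    {p q : SpaceTime d N} (hpq : p ≠ q) :
    ∫⁻ ω, evenCutWeight R r δ {p, q} ∅ (cutFreeIndicator R r p q) ω ∂jointLaw d N r lam δ =
      ∫⁻ ω, evenCutWeight R r δ ∅ {p, q} (cutFreeIndicator R r p q) ω ∂jointLaw d N r lam δ := by
  refine lintegral_eq_of_flip hr lam δ
    (measurable_evenCutWeight R r δ _ _ (measurable_cutFreeIndicator R r p q))
    (measurable_evenCutWeight R r δ _ _ (measurable_cutFreeIndicator R r p q)) fun Q Y => ?_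
  -- The connection event is decided by the positions alone; if it fails, both functionals vanish
  -- and any flip serves.
  by_cases hc : (∀ x, (Y.2 x).points ⊆ timeInterval r) ∧
      Reach R r (fun x => (Y.2 x).points) (fun e => (Q e).points) p q
  swap
  · refine ⟨fun _ _ => false, fun _ => false, fun m => ?_⟩
    have h0 : ∀ m : (Bond d N → ℕ → Bool) × ((Site d N → Bool) × (Site d N → Bool)),
        cutFreeIndicator R r p q (MarkedSample.toSample (((Q, m.1), m.2), Y)) = 0 := by
      intro m
      refine indicator_of_notMem (fun h => hc ?_) _
      exact (cutFree_toSample R r p q (((Q, m.1), m.2), Y)).1 h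
    have h1 : ∀ (A₁ A₂ : Finset (SpaceTime d N))
        (m : (Bond d N → ℕ → Bool) × ((Site d N → Bool) × (Site d N → Bool))),
        evenCutWeight R r δ A₁ A₂ (cutFreeIndicator R r p q)
          (MarkedSample.toSample (((Q, m.1), m.2), Y)) = 0 := by
      classical
      intro A₁ A₂ m
      rw [evenCutWeight, indicator_apply, h0]
      simp
    rw [h1, h1]
  obtain ⟨T, c, hT, hc'⟩ := Linked.of_reach (Q := Q) hc.1 hc.2
  refine ⟨T, c, fun m => ?_⟩
  have h1 : ∀ m : (Bond d N → ℕ → Bool) × ((Site d N → Bool) × (Site d N → Bool)),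
      cutFreeIndicator R r p q (MarkedSample.toSample (((Q, m.1), m.2), Y)) = 1 := fun m =>
    indicator_of_mem (by exact (cutFree_toSample R r p q _).2 hc) _
  set ω : Sample d N := MarkedSample.toSample (((Q, m.1), m.2), Y) with hω
  set ω' : Sample d N := MarkedSample.toSample (((Q, (flip T c m).1), (flip T c m).2), Y) with hω'
  -- `θ` is the common change of the two labellings; it vanishes at every cut.
  set θ := label R.bc₁ c (flipParity Q T p q) with hθ
  have hl1 : ∀ x u, label₁ R ∅ ω'.1 x u = label₁ R {p, q} ω.1 x u + θ x u := by
    intro x u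
    have := parity_flip₁ hpq Q m.1 T fun _ => emptyConfig
    change label R.bc₁ (fun x => xor (m.2.1 x) (c x)) (parity ∅ (fun e => (Q e).select
      fun i => xor (m.1 e i) (T e i)) fun _ => emptyConfig) x u = _
    rw [this, label_bc₁_add]
    rfl
  have hl2 : ∀ x u, label₂ R {p, q} ω'.2.1 x u = label₂ R ∅ ω.2.1 x u + θ x u := by
    intro x u
    have := parity_flip₂ hpq Q m.1 T Y.1
    change label R.bc₂ (fun x => xor (m.2.2 x) (c x)) (parity {p, q} (fun e => (Q e).select
      fun i => !(xor (m.1 e i) (T e i))) Y.1) x u = _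
    rw [this, label_bc₂_add]
    rfl
  have hf1 : final₁ r ∅ ω'.1 = final₁ r {p, q} ω.1 := by
    funext x
    have := congrFun (congrFun (parity_flip₁ hpq Q m.1 T fun _ => emptyConfig) x) (r / 2)
    rw [hT x, add_zero] at this
    exact this
  have hf2 : final₂ r {p, q} ω'.2.1 = final₂ r ∅ ω.2.1 := by
    funext x
    have := congrFun (congrFun (parity_flip₂ hpq Q m.1 T Y.1) x) (r / 2)
    rw [hT x, add_zero] at this
    exact this
  have hcuts : ∀ x, ω'.cuts x = ω.cuts x := fun x => rfl
  unfold evenCutWeight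
  congr 1
  -- Adding the same `θ` to both labels preserves the set where they differ, and the final parities
  -- are unchanged.
  · simp only [sampleReduced, reducedWeight, hf1, hf2, hl1, hl2, ne_eq, add_left_inj]
  · classical
    rw [indicator_apply, indicator_apply, h1, h1]
    refine if_congr ?_ rfl rfl
    simp only [mem_ofPred_eq]
    refine forall_congr' fun x => forall_congr' fun u => ?_
    rw [hcuts]
    refine imp_congr_right fun hu => ?_
    have h0 : θ x u = 0 := hc' x u hu
    simp only [sampleEven, bothEven, mem_ofPred_eq, hl1, hl2, h0, add_zero]

/-! ### Translation of the model on generic samples, and conclusion. -/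

/-! ### Generic samples -/

section Generic

variable {R : Regime} {r : ℝ} {p q : SpaceTime d N} {ω : Sample d N}
  {A A₁ A₂ : Finset (SpaceTime d N)} {Z : Set ℝ}

lemma sample_S_eq (A : Finset (SpaceTime d N)) (ω : Sample d N) :
    ω.S ↑A = switchingPoints ↑A ω.B fun _ => emptyConfig.points := by
  simp [Sample.S, emptyConfig_points]

lemma GenericFamily.cut_not_mem_S (h : GenericFamily r Z ω.config) (hA : ∀ p ∈ A, p.2 ∈ Z)
    {x : Site d N} {u : ℝ} (hu : u ∈ ω.cuts x) : u ∉ ω.S ↑A x := by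
  obtain ⟨i, rfl⟩ := hu
  rintro ((hp | ⟨e, -, j, hj⟩) | hG)
  · exact h.avoid (.inr (.inr x)) i (hA _ hp)
  · have := @h.inj ⟨.inl e, j⟩ ⟨.inr (.inr x), i⟩ hj
    simpa using (Sigma.mk.inj_iff.1 this).1
  · exact hG

lemma GenericFamily.cut_not_mem_Shat (h : GenericFamily r Z ω.config) (hA : ∀ p ∈ A, p.2 ∈ Z)
    {x : Site d N} {u : ℝ} (hu : u ∈ ω.cuts x) : u ∉ ω.Shat ↑A x := by
  obtain ⟨i, rfl⟩ := hu
  rintro ((hp | ⟨e, -, j, hj⟩) | ⟨j, hj⟩)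
  · exact h.avoid (.inr (.inr x)) i (hA _ hp)
  · have := @h.inj ⟨.inr (.inl (.inl e)), j⟩ ⟨.inr (.inr x), i⟩ hj
    simpa using (Sigma.mk.inj_iff.1 this).1
  · have := @h.inj ⟨.inr (.inl (.inr x)), j⟩ ⟨.inr (.inr x), i⟩ hj
    simpa using (Sigma.mk.inj_iff.1 this).1

lemma GenericFamily.cuts_subset (h : GenericFamily r Z ω.config) (x : Site d N) :
    ω.cuts x ⊆ Ioo (-(r / 2)) (r / 2) := by
  rintro _ ⟨i, rfl⟩
  exact h.mem (.inr (.inr x)) i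

lemma GenericFamily.psiWeight_mul_eq (h : GenericFamily r Z ω.config) (δ : ℝ)
    (hA₁ : ∀ p ∈ A₁, p.2 ∈ Z ∧ p.2 ∈ Ioo (-(r / 2)) (r / 2))
    (hA₂ : ∀ p ∈ A₂, p.2 ∈ Z ∧ p.2 ∈ Ioo (-(r / 2)) (r / 2)) :
    ω.psiWeight R.bc₁ r δ ↑A₁ * ω.psiHatWeight R.bc₂ r δ ↑A₂ =
      (sampleWeight R r δ A₁ A₂ ω.1 ω.2.1).toReal := by
  classical
  rw [Sample.psiWeight, Sample.psiHatWeight, sample_S_eq, (h.copy₁ hA₁).weight_eq]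
  change _ * weight R.bc₂ r δ ω.τhat (switchingPoints ↑A₂ ω.Bhat fun x => (ω.2.1.2 x).points) = _
  rw [(h.copy₂ hA₂).weight_eq, sampleWeight, pairWeight, ite_mul, mul_ite, zero_mul, mul_zero,
    ← Real.exp_add, ← mul_add, ← Finset.sum_add_distrib]
  by_cases h1 : ∀ x, parity A₁ ω.B (fun _ => emptyConfig) x (r / 2) = 0
  · by_cases h2 : ∀ x, parity A₂ ω.Bhat ω.2.1.2 x (r / 2) = 0
    · rw [if_pos h1, if_pos h2, if_pos ⟨h1, h2⟩, ENNReal.toReal_ofReal (Real.exp_pos _).le]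
      rfl
    · rw [if_pos h1, if_neg h2, if_neg fun h => h2 h.2, ENNReal.toReal_zero]
  · rw [if_neg h1, if_neg fun h => h1 h.1, ENNReal.toReal_zero]

lemma GenericFamily.blockingCuts_eq (h : GenericFamily r Z ω.config)
    (hA₁ : ∀ p ∈ A₁, p.2 ∈ Z ∧ p.2 ∈ Ioo (-(r / 2)) (r / 2))
    (hA₂ : ∀ p ∈ A₂, p.2 ∈ Z ∧ p.2 ∈ Ioo (-(r / 2)) (r / 2)) :
    blockingCuts R r ↑A₁ ↑A₂ ω = (keepEven R A₁ A₂ ω).cuts := by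
  funext x
  rw [keepEven_cuts]
  ext u
  refine and_congr_right fun hu => ?_
  have hu1 := h.cut_not_mem_S (A := A₁) (fun p hp => (hA₁ p hp).1) hu
  have hu2 := h.cut_not_mem_Shat (A := A₂) (fun p hp => (hA₂ p hp).1) hu
  have hz : ∀ z : ZMod 2, ¬ z = 1 ↔ z = 0 := by decide
  have e1 := (h.copy₁ hA₁).isOdd_iff R.bc₁ ω.τ x u
  have e2 := (h.copy₂ hA₂).isOdd_iff R.bc₂ ω.τhat x u
  rw [← sample_S_eq] at e1
  change IsOdd R.bc₂ r ω.τhat (ω.Shat ↑A₂) x u ↔ u ∈ ω.Shat ↑A₂ x ∨ _ at e2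
  simp only [e1, e2, hu1, hu2, false_or, hz]
  rfl

lemma traverse_iff (B₁ B₂ : Set (SpaceTime d N)) (ω : Sample d N) (p q : SpaceTime d N) :
    Traverse R r B₁ B₂ ω p q ↔ Passable R r (blockingCuts R r B₁ B₂ ω) p q := by
  cases R <;> rfl

/-- Bridge times avoid ghost points and the ends of the interval. Hence the ban on jumps via `Γ`
excludes no bridge. -/
lemma GenericFamily.not_ghostJump (h : GenericFamily r Z ω.config) {y z : SpaceTime d N}
    (hyz : BridgeJump ω y z) : ¬ GhostJump R r ω y z := by
  rintro ⟨hy, -⟩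
  obtain ⟨-, e, -, he⟩ := hyz
  have hG : y.2 ∉ ω.G y.1 := by
    rintro ⟨j, hj⟩
    rcases he with ⟨i, hi⟩ | ⟨i, hi⟩
    · have := @h.inj ⟨.inl e, i⟩ ⟨.inr (.inl (.inr y.1)), j⟩ (hi.trans hj.symm)
      simpa using (Sigma.mk.inj_iff.1 this).1
    · have := @h.inj ⟨.inr (.inl (.inl e)), i⟩ ⟨.inr (.inl (.inr y.1)), j⟩ (hi.trans hj.symm)
      simpa using (Sigma.mk.inj_iff.1 this).1
  have hI : y.2 ∈ Ioo (-(r / 2)) (r / 2) := by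
    rcases he with ⟨i, hi⟩ | ⟨i, hi⟩
    · rw [← hi]
      exact h.mem (.inl e) i
    · rw [← hi]
      exact h.mem (.inr (.inl (.inl e))) i
  cases R
  · exact hG hy
  · rcases hy with hy | hy | hy
    · exact hG hy
    · exact hI.1.ne' hy
    · exact hI.2.ne hy

lemma GenericFamily.connectedOffGhost_iff (h : GenericFamily r Z ω.config)
    (hA₁ : ∀ p ∈ A₁, p.2 ∈ Z ∧ p.2 ∈ Ioo (-(r / 2)) (r / 2))
    (hA₂ : ∀ p ∈ A₂, p.2 ∈ Z ∧ p.2 ∈ Ioo (-(r / 2)) (r / 2)) :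
    ConnectedOffGhost R r ↑A₁ ↑A₂ ω p q ↔ CutFree R r p q (keepEven R A₁ A₂ ω) := by
  have hcuts : ∀ x, (keepEven R A₁ A₂ ω).cuts x ⊆ timeInterval r := by
    intro x
    rw [keepEven_cuts]
    exact inter_subset_left.trans ((h.cuts_subset x).trans Ioo_subset_Icc_self)
  have hb := h.blockingCuts_eq (R := R) hA₁ hA₂
  constructor
  · rintro ⟨m, k, hk, hg⟩
    refine ⟨hcuts, m, reachIn_iff_exists_seq.2 ⟨k, hk.mem, hk.first, hk.last, fun j hj => ?_,
      fun j hj => (hk.jump j hj).resolve_right (hg j hj)⟩⟩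
    have := (traverse_iff _ _ _ _ _).1 (hk.traverse j hj)
    rwa [hb] at this
  · rintro ⟨-, m, hm⟩
    obtain ⟨k, h1, h2, h3, h4, h5⟩ := reachIn_iff_exists_seq.1 hm
    refine ⟨m, k, ⟨h1, h2, h3, fun j hj => ?_, fun j hj => Or.inl (h5 j hj)⟩,
      fun j hj => h.not_ghostJump (h5 j hj)⟩
    rw [traverse_iff, hb]
    exact h4 j hj

lemma GenericFamily.cutFree_of_even (h : GenericFamily r Z ω.config) (hr : 0 < r) (hpq : p ≠ q)
    (hA : ∀ a ∈ ({p, q} : Finset (SpaceTime d N)), a.2 ∈ Z ∧ a.2 ∈ Ioo (-(r / 2)) (r / 2))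
    (hfinal : ∀ x, final₁ r {p, q} ω.1 x = 0)
    (heven : ∀ x, ω.cuts x ⊆ sampleEven R {p, q} ∅ ω.1 ω.2.1 x) : CutFree R r p q ω := by
  refine ⟨fun x => (h.cuts_subset x).trans Ioo_subset_Icc_self, ?_⟩
  refine reach_of_sources (R := R) (τ := ω.τ) hr hpq (h.copy₁ hA) h.cuts_subset (fun x => ?_)
    (fun e => subset_union_left) hfinal fun x u hu => (heven x hu).1
  rw [← sample_S_eq]
  exact Set.disjoint_left.2 fun u hu => h.cut_not_mem_S (fun a ha => (hA a ha).1) hu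

end Generic

/-- Even lengths are at most `r` per line, so the weights are bounded; integrability follows from
finiteness of the measure. -/
lemma sampleWeight_le (R : Regime) {r δ : ℝ} (hr : 0 < r) (hδ : 0 < δ)
    (A₁ A₂ : Finset (SpaceTime d N)) (a : FreeSample d N) (w : WiredSample d N) :
    sampleWeight R r δ A₁ A₂ a w ≤
      ENNReal.ofReal (Real.exp (2 * δ * ∑ _x : Site d N, (r + r))) := by
  have hvol : ∀ s : Set ℝ, s ⊆ timeInterval r → volume.real s ≤ r := by
    intro s hs
    have h1 : volume.real (timeInterval r) = r := by
      rw [timeInterval, Real.volume_real_Icc_of_le (by linarith)]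
      ring
    calc volume.real s ≤ volume.real (timeInterval r) :=
          measureReal_mono hs (by simp [timeInterval])
      _ = r := h1
  unfold sampleWeight pairWeight
  split_ifs
  · gcongr
    · exact hvol _ fun u hu => hu.1
    · exact hvol _ fun u hu => hu.1
  · exact zero_le

lemma lintegral_ne_top_of_le_const {α : Type*} [MeasurableSpace α] {μ : Measure α}
    [IsFiniteMeasure μ] {f : α → ℝ≥0∞} {c : ℝ≥0∞} (hc : c ≠ ⊤) (hf : ∀ a, f a ≤ c) :
    ∫⁻ a, f a ∂μ ≠ ⊤ := by
  refine ne_top_of_le_ne_top ?_ (lintegral_mono hf)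
  rw [lintegral_const]
  exact ENNReal.mul_ne_top hc (measure_ne_top _ _)

section Switching

variable {r δ : ℝ} {p q : SpaceTime d N}

/-- The weight of `∅` and `A` on the event that `p` and `q` are joined by a path on which every cut
is odd in one of the copies. -/
def connectedWeight (R : Regime) (r δ : ℝ) (A : Finset (SpaceTime d N)) (p q : SpaceTime d N)
    (ω : Sample d N) : ℝ≥0∞ :=
  sampleWeight R r δ ∅ A ω.1 ω.2.1 * cutFreeIndicator R r p q (keepEven R ∅ A ω)

lemma measurable_cutFreeIndicator_keepEven (R : Regime) (r : ℝ) (A : Finset (SpaceTime d N))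
    (p q : SpaceTime d N) :
    Measurable fun ω => cutFreeIndicator R r p q (keepEven R ∅ A ω) :=
  measurable_const.indicator
    (measurableSet_setOfPred.2 (measurable_cutFree_keepEven R r ∅ A p q))

lemma measurable_sampleWeight_comp (R : Regime) (r δ : ℝ) (A₁ A₂ : Finset (SpaceTime d N)) :
    Measurable fun ω : Sample d N => sampleWeight R r δ A₁ A₂ ω.1 ω.2.1 := by
  have h : Measurable fun ω : Sample d N => (ω.1, ω.2.1) := by fun_prop
  have := (measurable_sampleWeight R r δ A₁ A₂).comp h
  rwa [Function.comp_def] at this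

lemma measurable_connectedWeight (R : Regime) (r δ : ℝ) (A : Finset (SpaceTime d N))
    (p q : SpaceTime d N) : Measurable (connectedWeight R r δ A p q) :=
  (measurable_sampleWeight_comp R r δ ∅ A).mul (measurable_cutFreeIndicator_keepEven R r A p q)

lemma connectedWeight_le (R : Regime) (hr : 0 < r) (hδ : 0 < δ) (A : Finset (SpaceTime d N))
    (p q : SpaceTime d N) (ω : Sample d N) : connectedWeight R r δ A p q ω ≤
      ENNReal.ofReal (Real.exp (2 * δ * ∑ _x : Site d N, (r + r))) := by
  refine (mul_le_of_le_one_right' ?_).trans (sampleWeight_le R hr hδ ∅ A ω.1 ω.2.1)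
  exact indicator_apply_le' (fun _ => le_rfl) fun _ => zero_le

lemma psiWeight_mul_ae_eq (R : Regime) (hr : 0 < r) (lam δ : ℝ) {A₁ A₂ : Finset (SpaceTime d N)}
    (hA₁ : ∀ a ∈ A₁, a.2 ∈ Ioo (-(r / 2)) (r / 2))
    (hA₂ : ∀ a ∈ A₂, a.2 ∈ Ioo (-(r / 2)) (r / 2)) :
    (fun ω : Sample d N => ω.psiWeight R.bc₁ r δ ↑A₁ * ω.psiHatWeight R.bc₂ r δ ↑A₂)
      =ᵐ[jointLaw d N r lam δ] fun ω => (sampleWeight R r δ A₁ A₂ ω.1 ω.2.1).toReal := by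
  have hZ : (Prod.snd '' ((A₁ : Set (SpaceTime d N)) ∪ A₂)).Countable :=
    ((A₁.finite_toSet.union A₂.finite_toSet).image _).countable
  filter_upwards [ae_generic hr hZ] with ω hω
  exact hω.psiWeight_mul_eq δ (fun a ha => ⟨mem_image_of_mem _ (Or.inl ha), hA₁ a ha⟩)
    fun a ha => ⟨mem_image_of_mem _ (Or.inr ha), hA₂ a ha⟩

lemma connectedOffGhost_ae_iff (R : Regime) (hr : 0 < r) (lam δ : ℝ)
    {A₁ A₂ : Finset (SpaceTime d N)} (hA₁ : ∀ a ∈ A₁, a.2 ∈ Ioo (-(r / 2)) (r / 2))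
    (hA₂ : ∀ a ∈ A₂, a.2 ∈ Ioo (-(r / 2)) (r / 2)) (p q : SpaceTime d N) :
    ∀ᵐ ω ∂jointLaw d N r lam δ, ConnectedOffGhost R r ↑A₁ ↑A₂ ω p q ↔
      CutFree R r p q (keepEven R A₁ A₂ ω) := by
  have hZ : (Prod.snd '' ((A₁ : Set (SpaceTime d N)) ∪ A₂)).Countable :=
    ((A₁.finite_toSet.union A₂.finite_toSet).image _).countable
  filter_upwards [ae_generic hr hZ] with ω hω
  exact hω.connectedOffGhost_iff (fun a ha => ⟨mem_image_of_mem _ (Or.inl ha), hA₁ a ha⟩)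
    fun a ha => ⟨mem_image_of_mem _ (Or.inr ha), hA₂ a ha⟩

lemma connectedWeight_ae_eq (R : Regime) (hr : 0 < r) (lam δ : ℝ) {A : Finset (SpaceTime d N)}
    (hA : ∀ a ∈ A, a.2 ∈ Ioo (-(r / 2)) (r / 2)) (p q : SpaceTime d N) :
    (fun ω : Sample d N => ω.psiWeight R.bc₁ r δ ↑(∅ : Finset (SpaceTime d N)) *
      ω.psiHatWeight R.bc₂ r δ ↑A *
        {ω : Sample d N | ConnectedOffGhost R r ↑(∅ : Finset (SpaceTime d N)) ↑A ω
          p q}.indicator (fun _ => (1 : ℝ)) ω) =ᵐ[jointLaw d N r lam δ]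
      fun ω => (connectedWeight R r δ A p q ω).toReal := by
  classical
  have hE : ∀ a ∈ (∅ : Finset (SpaceTime d N)), a.2 ∈ Ioo (-(r / 2)) (r / 2) :=
    fun a ha => absurd ha (Finset.notMem_empty a)
  filter_upwards [psiWeight_mul_ae_eq R hr lam δ hE hA,
    connectedOffGhost_ae_iff R hr lam δ hE hA p q] with ω h1 h2
  rw [h1, connectedWeight, ENNReal.toReal_mul]
  congr 1
  rw [indicator_apply, cutFreeIndicator, indicator_apply]
  simp only [mem_ofPred_eq, h2]
  split_ifs <;> simp

lemma evenCutWeight_one_ae_eq (R : Regime) (hr : 0 < r) (lam δ : ℝ) (hpq : p ≠ q)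
    (hA : ∀ a ∈ ({p, q} : Finset (SpaceTime d N)), a.2 ∈ Ioo (-(r / 2)) (r / 2)) :
    evenCutWeight R r δ {p, q} ∅ (fun _ => 1) =ᵐ[jointLaw d N r lam δ]
      evenCutWeight R r δ {p, q} ∅ (cutFreeIndicator R r p q) := by
  classical
  have hZ : (Prod.snd '' (({p, q} : Finset (SpaceTime d N)) : Set (SpaceTime d N))).Countable :=
    ((Finset.finite_toSet _).image _).countable
  filter_upwards [ae_generic hr hZ] with ω hω
  by_cases h1 : ∀ x, final₁ r {p, q} ω.1 x = 0
  · unfold evenCutWeight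
    congr 1
    rw [indicator_apply, indicator_apply]
    refine ite_congr rfl (fun h2 => ?_) fun _ => rfl
    have h3 : CutFree R r p q ω := hω.cutFree_of_even hr hpq
      (fun a ha => ⟨mem_image_of_mem _ ha, hA a ha⟩) h1 h2
    exact (indicator_of_mem (s := {ω | CutFree R r p q ω}) (f := fun _ => (1 : ℝ≥0∞)) h3).symm
  · have : sampleReduced R r δ {p, q} ∅ ω.1 ω.2.1 = 0 := if_neg fun h => h1 h.1
    rw [evenCutWeight, evenCutWeight, this, zero_mul, zero_mul]

/-- Thinning is applied with the constant functional on the left and with the connection indicator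
on the right. In between, the indicator is inserted at no cost and the sources are exchanged. -/
theorem lintegral_sampleWeight_eq_connectedWeight (R : Regime) (hr : 0 < r) (hδ : 0 < δ) (lam : ℝ)
    (hpq : p ≠ q)
    (hA : ∀ a ∈ ({p, q} : Finset (SpaceTime d N)), a.2 ∈ Ioo (-(r / 2)) (r / 2)) :
    ∫⁻ ω, sampleWeight R r δ {p, q} ∅ ω.1 ω.2.1 ∂jointLaw d N r lam δ =
      ∫⁻ ω, connectedWeight R r δ {p, q} p q ω ∂jointLaw d N r lam δ := by
  have t1 := lintegral_sampleWeight_mul R hr hδ lam {p, q} ∅ (f := fun _ => 1) measurable_const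
    measurable_const
  have t2 := lintegral_sampleWeight_mul R hr hδ lam ∅ {p, q} (measurable_cutFreeIndicator R r p q)
    (measurable_cutFreeIndicator_keepEven R r {p, q} p q)
  simp only [mul_one] at t1
  refine t1.trans (Eq.trans ?_ t2.symm)
  exact congrArg (_ * ·) ((lintegral_congr_ae (evenCutWeight_one_ae_eq R hr lam δ hpq hA)).trans
    (lintegral_evenCutWeight_swap R hr lam δ hpq))

/-- The switching identity with two distinct sources in the interior of the time interval. -/
theorem switching (R : Regime) (hr : 0 < r) (hδ : 0 < δ) (lam : ℝ) (hpq : p ≠ q)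
    (hp : |p.2| < r / 2) (hq : |q.2| < r / 2) :
    Integrable (fun ω : Sample d N =>
        ω.psiWeight R.bc₁ r δ {p, q} * ω.psiHatWeight R.bc₂ r δ ∅) (jointLaw d N r lam δ) ∧
    Integrable (fun ω : Sample d N =>
        ω.psiWeight R.bc₁ r δ ∅ * ω.psiHatWeight R.bc₂ r δ {p, q} *
          {ω : Sample d N | ConnectedOffGhost R r ∅ {p, q} ω p q}.indicator (fun _ => (1 : ℝ)) ω)
      (jointLaw d N r lam δ) ∧
    ∫ ω : Sample d N, ω.psiWeight R.bc₁ r δ {p, q} * ω.psiHatWeight R.bc₂ r δ ∅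
      ∂(jointLaw d N r lam δ) =
    ∫ ω : Sample d N, ω.psiWeight R.bc₁ r δ ∅ * ω.psiHatWeight R.bc₂ r δ {p, q} *
        {ω : Sample d N | ConnectedOffGhost R r ∅ {p, q} ω p q}.indicator (fun _ => (1 : ℝ)) ω
      ∂(jointLaw d N r lam δ) := by
  have := isProbabilityMeasure_jointLaw (d := d) (N := N) hr lam δ
  have hA : ∀ a ∈ ({p, q} : Finset (SpaceTime d N)), a.2 ∈ Ioo (-(r / 2)) (r / 2) := by
    intro a ha
    rcases Finset.mem_insert.1 ha with rfl | ha
    · exact abs_lt.1 hp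
    · rw [Finset.mem_singleton.1 ha]
      exact abs_lt.1 hq
  have hE : ∀ a ∈ (∅ : Finset (SpaceTime d N)), a.2 ∈ Ioo (-(r / 2)) (r / 2) :=
    fun a ha => absurd ha (Finset.notMem_empty a)
  have e1 := psiWeight_mul_ae_eq R hr lam δ hA hE
  have e2 := connectedWeight_ae_eq R hr lam δ hA p q
  rw [Finset.coe_pair, Finset.coe_empty] at e1 e2
  have m1 := measurable_sampleWeight_comp R r δ {p, q} ∅
  have m2 := measurable_connectedWeight R r δ {p, q} p q
  have f1 := lintegral_ne_top_of_le_const (μ := jointLaw d N r lam δ) ENNReal.ofReal_ne_top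
    fun ω => sampleWeight_le R hr hδ {p, q} ∅ ω.1 ω.2.1
  have f2 := lintegral_ne_top_of_le_const (μ := jointLaw d N r lam δ) ENNReal.ofReal_ne_top
    (connectedWeight_le R hr hδ {p, q} p q)
  refine ⟨(integrable_toReal_of_lintegral_ne_top m1.aemeasurable f1).congr e1.symm,
    (integrable_toReal_of_lintegral_ne_top m2.aemeasurable f2).congr e2.symm, ?_⟩
  rw [integral_congr_ae e1, integral_congr_ae e2,
    integral_toReal m1.aemeasurable (ae_lt_top m1 f1),
    integral_toReal m2.aemeasurable (ae_lt_top m2 f2),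
    lintegral_sampleWeight_eq_connectedWeight R hr hδ lam hpq hA]

end Switching

end

end RandomParity

theorem mainTheorem8 (d N : ℕ) (hd : 1 ≤ d) (hN : 1 ≤ N) (r lam δ : ℝ) (hr : 0 < r)
    (hlam : 0 ≤ lam) (hδ : 0 < δ) (R : Regime)
    (κ : SpaceTime d N) (hκr : |κ.2| < r / 2) (hκ : κ ≠ (origin d N, 0)) :
    Integrable (fun ω : Sample d N =>
        ω.psiWeight R.bc₁ r δ {(origin d N, 0), κ} * ω.psiHatWeight R.bc₂ r δ ∅)
      (jointLaw d N r lam δ) ∧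
    Integrable (fun ω : Sample d N =>
        ω.psiWeight R.bc₁ r δ ∅ * ω.psiHatWeight R.bc₂ r δ {(origin d N, 0), κ} *
          {ω : Sample d N | ConnectedOffGhost R r ∅ {(origin d N, 0), κ} ω
            (origin d N, 0) κ}.indicator (fun _ => (1 : ℝ)) ω)
      (jointLaw d N r lam δ) ∧
    ∫ ω : Sample d N,
        ω.psiWeight R.bc₁ r δ {(origin d N, 0), κ} * ω.psiHatWeight R.bc₂ r δ ∅
      ∂(jointLaw d N r lam δ) =
    ∫ ω : Sample d N,
        ω.psiWeight R.bc₁ r δ ∅ * ω.psiHatWeight R.bc₂ r δ {(origin d N, 0), κ} *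
          {ω : Sample d N | ConnectedOffGhost R r ∅ {(origin d N, 0), κ} ω
            (origin d N, 0) κ}.indicator (fun _ => (1 : ℝ)) ω
      ∂(jointLaw d N r lam δ) := by
  exact switching R hr hδ lam hκ.symm (by simpa using hr) hκr
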